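/- **Definitions.** For a parameter $\zeta$ put $$F(x,y,z)=(\zeta+2)xyz-\zeta(xy+yz+xz+x+y+z)+\zeta(2\zeta+1),$$ $$G(x,y)=(\zeta+2)xy(x+y)-\zeta(x^2+y^2)-2(\zeta^2+3\zeta+1)xy+\zeta(2\zeta+1)(x+y).$$ For $n\ge 0$ let $S_n$ be the polynomial in $2n+1$ variables (and in $\zeta$) given by $$S_n(x_1,\dots,x_n,y_1,\dots,y_n,z)=\frac{\prod_{i,j=1}^n G(x_i,y_j)}{\prod_{1\le i<j\le n}(x_j-x_i)(y_j-y_i)}\,\det_{1\le i,j\le n}\left(\frac{F(x_i,y_j,z)}{G(x_i,y_j)}\right).$$ Write $\delta_n=\lfloor n^2/4\rfloor$. Let $P_n(x,\zeta)$ and $p_n(\zeta)$ be the polynomials determined by $$\left(1+\tfrac\zeta2\right)^{n^2}S_n\Big(x,\underbrace{2\zeta+1,\dots,2\zeta+1}_{n},\underbrace{\tfrac{\zeta}{\zeta+2},\dots,\tfrac{\zeta}{\zeta+2}}_{n}\Big)=(-1)^{\binom{n+1}2}\zeta^{n^2}(1+\zeta)^{n^2}(1+2\zeta)^{\delta_{n-1}}\left(1+\tfrac\zeta2\right)^{\delta_{n-1}}P_n(x,\zeta),$$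 $$\left(1+\tfrac\zeta2\right)^{n^2}S_n\Big(\underbrace{2\zeta+1,\dots,2\zeta+1}_{n+1},\underbrace{\tfrac{\zeta}{\zeta+2},\dots,\tfrac{\zeta}{\zeta+2}}_{n}\Big)=(-1)^{\binom{n+1}2}\zeta^{n^2}(1+\zeta)^{n^2}(1+2\zeta)^{\delta_{n}}\left(1+\tfrac\zeta2\right)^{\delta_{n-1}}p_n(\zeta).$$ **Proposition.** Assume that at least one of the following two conjectures holds: * for every $n\ge0$, the polynomial $p_n$ does not vanish in the interval $-2<\zeta<-1/2$; * for every $n\ge0$, the polynomial $p_n$ has exactly $\lfloor (n+1)/2\rfloor$ real zeroes, counted with multiplicity. Let $\zeta$ be a real number with $-2<\zeta<-1/2$ and $\zeta\ne-1$, and let $n\ge 0$. Then all complex zeroes of $P_n(x,\zeta)$, as a polynomial in $x$, are simple, real and positive. Moreover, the zeroes of $P_{n+1}(x,\zeta)$ interlace those of $P_n(x,\zeta)$: the zeroes of $P_{n+1}(x,\zeta)$ are real numbers $c_1<\dots<c_{n+1}$, the zeroes of $P_n(x,\zeta)$ are real numbers $b_1<\dots<b_n$, and $$c_1<b_1<c_2<b_2<\dots<b_n<c_{n+1}.$$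 -/

import Mathlib

namespace ThreeColour

open Polynomial

section Elementary

variable {A B : Type*} [CommRing A] [CommRing B]

/-- The symmetric polynomial `F(x,y,z)`, with parameter `ζ`. -/
def F (ζ x y z : A) : A :=
  (ζ + 2) * x * y * z - ζ * (x * y + y * z + x * z + x + y + z) + ζ * (2 * ζ + 1)

/-- The symmetric polynomial `G(x,y)`, with parameter `ζ`. -/
def G (ζ x y : A) : A :=
  (ζ + 2) * x * y * (x + y) - ζ * (x ^ 2 + y ^ 2) - 2 * (ζ ^ 2 + 3 * ζ + 1) * x * y
    + ζ * (2 * ζ + 1) * (x + y)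

/-- The product `∏_{i,j} G(x_i,y_j) · det (F(x_i,y_j,z) / G(x_i,y_j))`, with the denominators
of the column `j` of the determinant cleared by the factor `∏_k G(x_k,y_j)`, so that it makes sense
in every commutative ring (see `numer_eq`). -/
def numer {n : ℕ} (ζ : A) (x y : Fin n → A) (z : A) : A :=
  Matrix.det (Matrix.of fun i j : Fin n =>
    F ζ (x i) (y j) z * ∏ k ∈ Finset.univ.erase i, G ζ (x k) (y j))

/-- The Vandermonde product `∏_{i<j} (x_j - x_i)`. -/
def vand {n : ℕ} (x : Fin n → A) : A :=
  ∏ i : Fin n, ∏ j ∈ Finset.Ioi i, (x j - x i)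

theorem numer_eq {K : Type*} [Field K] {n : ℕ} (ζ : K) (x y : Fin n → K) (z : K)
    (hG : ∀ i j, G ζ (x i) (y j) ≠ 0) :
    numer ζ x y z = (∏ i, ∏ j, G ζ (x i) (y j)) *
      Matrix.det (Matrix.of fun i j => F ζ (x i) (y j) z / G ζ (x i) (y j)) := by
  rw [Finset.prod_comm, ← Matrix.det_mul_row, numer]
  congr 1
  ext i j
  simp only [Matrix.of_apply]
  rw [← Finset.mul_prod_erase Finset.univ (fun k => G ζ (x k) (y j)) (Finset.mem_univ i)]
  field_simp [hG i j]

theorem map_numer (φ : A →+* B) {n : ℕ} (ζ : A) (x y : Fin n → A) (z : A) :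
    φ (numer ζ x y z) = numer (φ ζ) (fun i => φ (x i)) (fun i => φ (y i)) (φ z) := by
  rw [numer, numer, RingHom.map_det]
  congr 1
  ext i j
  simp [F, G, map_prod, map_ofNat φ]

theorem map_vand (φ : A →+* B) {n : ℕ} (x : Fin n → A) :
    φ (vand x) = vand (fun i => φ (x i)) := by
  simp [vand, map_prod]

theorem numer_eq_zero_left {n : ℕ} (ζ : A) (x y : Fin n → A) (z : A) {a b : Fin n} (hab : a ≠ b)
    (h : x a = x b) : numer ζ x y z = 0 := by
  refine Matrix.det_zero_of_row_eq hab ?_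
  ext j
  simp only [Matrix.of_apply, h]
  congr 1
  rw [← Finset.mul_prod_erase (Finset.univ.erase a) (fun k => G ζ (x k) (y j)) (a := b)
      (by simp [hab.symm]),
    ← Finset.mul_prod_erase (Finset.univ.erase b) (fun k => G ζ (x k) (y j)) (a := a)
      (by simp [hab]), h, Finset.erase_right_comm]

theorem numer_eq_zero_right {n : ℕ} (ζ : A) (x y : Fin n → A) (z : A) {a b : Fin n} (hab : a ≠ b)
    (h : y a = y b) : numer ζ x y z = 0 := by
  refine Matrix.det_zero_of_column_eq hab ?_
  intro i
  simp only [Matrix.of_apply, h]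

end Elementary

section Slots

variable {A : Type*} {n : ℕ}

/-- In a list `(x_1,…,x_n,y_1,…,y_n,z)` of length `2n+1`, the entries `x_1,…,x_n`. -/
def xs (v : Fin (2 * n + 1) → A) (i : Fin n) : A := v ⟨i, by omega⟩

/-- In a list `(x_1,…,x_n,y_1,…,y_n,z)` of length `2n+1`, the entries `y_1,…,y_n`. -/
def ys (v : Fin (2 * n + 1) → A) (i : Fin n) : A := v ⟨n + i, by omega⟩

/-- In a list `(x_1,…,x_n,y_1,…,y_n,z)` of length `2n+1`, the entry `z`. -/
def zl (v : Fin (2 * n + 1) → A) : A := v (Fin.last (2 * n))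

end Slots

section Divisibility

variable {R σ : Type*} [CommRing R]

theorem X_sub_X_dvd [DecidableEq σ] {a b : σ} {p : MvPolynomial σ R}
    (h : MvPolynomial.rename (Function.update id b a) p = 0) :
    (MvPolynomial.X a - MvPolynomial.X b : MvPolynomial σ R) ∣ p := by
  rw [← Ideal.mem_span_singleton, ← Ideal.Quotient.eq_zero_iff_mem]
  set I := Ideal.span {(MvPolynomial.X a - MvPolynomial.X b : MvPolynomial σ R)} with hI
  have key : (Ideal.Quotient.mkₐ R I).comp (MvPolynomial.rename (Function.update id b a))
      = Ideal.Quotient.mkₐ R I := by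
    ext c
    by_cases hc : c = b
    · subst hc
      simp only [AlgHom.comp_apply, MvPolynomial.rename_X, Function.update_self,
        Ideal.Quotient.mkₐ_eq_mk]
      rw [Ideal.Quotient.eq]
      exact Ideal.mem_span_singleton_self _
    · simp [Function.update_of_ne hc]
  have := congrArg (fun f => f p) key
  simp only [AlgHom.comp_apply, h, map_zero, Ideal.Quotient.mkₐ_eq_mk] at this
  exact this.symm

theorem irreducible_X_sub_X [IsDomain R] {a b : σ} (hab : a ≠ b) :
    Irreducible (MvPolynomial.X a - MvPolynomial.X b : MvPolynomial σ R) := by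
  classical
  have h := MvPolynomial.irreducible_sumSMulX (R := R)
    (Finsupp.single a 1 - Finsupp.single b 1 : σ →₀ R)
    ⟨a, by simp [hab.symm]⟩
    (fun r hr => isUnit_of_dvd_one (by simpa [Finsupp.single_apply, hab.symm] using hr a))
  simpa [MvPolynomial.sumSMulX, Finsupp.linearCombination_single] using h

theorem isRelPrime_X_sub_X [IsDomain R] {a b c d : σ} (hab : a ≠ b) (hcd : c ≠ d)
    (h₁ : ¬ (c = a ∧ d = b)) (h₂ : ¬ (c = b ∧ d = a)) :
    IsRelPrime (MvPolynomial.X a - MvPolynomial.X b : MvPolynomial σ R)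
      (MvPolynomial.X c - MvPolynomial.X d) := by
  classical
  rw [(irreducible_X_sub_X hab).isRelPrime_iff_not_dvd]
  rintro ⟨q, hq⟩
  have := congrArg (MvPolynomial.rename (Function.update id b a)) hq
  rw [map_mul, map_sub, map_sub, MvPolynomial.rename_X, MvPolynomial.rename_X,
    MvPolynomial.rename_X, MvPolynomial.rename_X, Function.update_self,
    Function.update_of_ne hab, id, sub_self, zero_mul, sub_eq_zero] at this
  have := MvPolynomial.X_injective this
  simp only [Function.update_apply, id] at this
  split_ifs at this <;> grind

theorem vand_dvd [IsDomain R] [UniqueFactorizationMonoid R] {n : ℕ} (e : Fin n → σ)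
    (he : Function.Injective e) (p : MvPolynomial σ R)
    (hp : ∀ i j : Fin n, i < j →
      (MvPolynomial.X (e j) - MvPolynomial.X (e i) : MvPolynomial σ R) ∣ p) :
    vand (fun i => (MvPolynomial.X (e i) : MvPolynomial σ R)) ∣ p := by
  rw [vand, Finset.prod_sigma']
  refine Finset.prod_dvd_of_isRelPrime ?_ ?_
  · rintro ⟨i, j⟩ hij ⟨k, l⟩ hkl hne
    simp only [Finset.coe_sigma, Set.mem_sigma_iff, Finset.mem_coe, Finset.mem_Ioi] at hij hkl
    refine isRelPrime_X_sub_X (he.ne hij.2.ne') (he.ne hkl.2.ne') ?_ ?_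
    · rintro ⟨h1, h2⟩
      have h1 := he h1
      have h2 := he h2
      exact hne (by simp_all)
    · rintro ⟨h1, h2⟩
      have h1 := he h1
      have h2 := he h2
      have h3 := hij.2
      have h4 := hkl.2
      subst h1 h2
      exact absurd h3 (lt_asymm h4)
  · rintro ⟨i, j⟩ hij
    simp only [Finset.mem_sigma, Finset.mem_Ioi] at hij
    exact hp i j hij.2

end Divisibility

section SymmetricPolynomials

/-- The ring `ℤ[ζ][v_0,…,v_{2n}]`. -/
abbrev PolyRing (n : ℕ) : Type := MvPolynomial (Fin (2 * n + 1)) ℤ[X]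

/-- The parameter `ζ` as an element of `ℤ[ζ][v_0,…,v_{2n}]`. -/
noncomputable abbrev zetaVar (n : ℕ) : PolyRing n := MvPolynomial.C Polynomial.X

/-- The list of the variables `(x_1,…,x_n,y_1,…,y_n,z)`. -/
noncomputable abbrev vars (n : ℕ) : Fin (2 * n + 1) → PolyRing n := MvPolynomial.X

theorem rename_numer (n : ℕ) (f : Fin (2 * n + 1) → Fin (2 * n + 1)) :
    MvPolynomial.rename f (numer (zetaVar n) (xs (vars n)) (ys (vars n)) (zl (vars n))) =
      numer (zetaVar n) (xs (vars n ∘ f)) (ys (vars n ∘ f)) (zl (vars n ∘ f)) := by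
  have := map_numer (MvPolynomial.rename (R := ℤ[X]) f).toRingHom (zetaVar n)
    (xs (vars n)) (ys (vars n)) (zl (vars n))
  simp only [AlgHom.toRingHom_eq_coe, RingHom.coe_coe, zetaVar, MvPolynomial.rename_C, xs, ys, zl,
    vars, MvPolynomial.rename_X] at this
  exact this

theorem exists_S (n : ℕ) : ∃ S : PolyRing n,
    vand (xs (vars n)) * vand (ys (vars n)) * S =
      numer (zetaVar n) (xs (vars n)) (ys (vars n)) (zl (vars n)) := by
  have hx : Function.Injective (fun i : Fin n => (⟨i, by omega⟩ : Fin (2 * n + 1))) := by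
    intro i j h
    simpa [Fin.ext_iff] using h
  have hy : Function.Injective (fun i : Fin n => (⟨n + i, by omega⟩ : Fin (2 * n + 1))) := by
    intro i j h
    simpa [Fin.ext_iff] using h
  have h1 : vand (xs (vars n)) ∣
      numer (zetaVar n) (xs (vars n)) (ys (vars n)) (zl (vars n)) := by
    refine vand_dvd _ hx _ fun i j hij => X_sub_X_dvd ?_
    rw [rename_numer]
    refine numer_eq_zero_left _ _ _ _ hij.ne ?_
    have : (⟨j, by omega⟩ : Fin (2 * n + 1)) ≠ ⟨i, by omega⟩ := hx.ne hij.ne'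
    simp [xs, Function.update_of_ne this]
  have h2 : vand (ys (vars n)) ∣
      numer (zetaVar n) (xs (vars n)) (ys (vars n)) (zl (vars n)) := by
    refine vand_dvd _ hy _ fun i j hij => X_sub_X_dvd ?_
    rw [rename_numer]
    refine numer_eq_zero_right _ _ _ _ hij.ne ?_
    have : (⟨n + j, by omega⟩ : Fin (2 * n + 1)) ≠ ⟨n + i, by omega⟩ := hy.ne hij.ne'
    simp [ys, Function.update_of_ne this]
  have h3 : IsRelPrime (vand (xs (vars n))) (vand (ys (vars n))) := by
    unfold vand
    refine IsRelPrime.prod_left fun i _ => IsRelPrime.prod_left fun j hj =>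
      IsRelPrime.prod_right fun k _ => IsRelPrime.prod_right fun l hl => ?_
    rw [Finset.mem_Ioi] at hj hl
    refine isRelPrime_X_sub_X (hx.ne hj.ne') (hy.ne hl.ne') ?_ ?_ <;>
    · simp only [Fin.mk.injEq]
      omega
  obtain ⟨S, hS⟩ := h3.mul_dvd h1 h2
  exact ⟨S, hS.symm⟩

/-- The polynomial
`S_n = ∏_{i,j} G(x_i,y_j) / ∏_{i<j} (x_j - x_i)(y_j - y_i) · det (F(x_i,y_j,z) / G(x_i,y_j))`
in the `2n+1` variables `(x_1,…,x_n,y_1,…,y_n,z)` and in `ζ`. -/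
noncomputable def S (n : ℕ) : PolyRing n := (exists_S n).choose

/-- The value of `S_n` at a list `v = (x_1,…,x_n,y_1,…,y_n,z)` of `2n+1` real numbers
and at a real number `ζ`. -/
noncomputable def evalS (n : ℕ) (ζ : ℝ) (v : Fin (2 * n + 1) → ℝ) : ℝ :=
  MvPolynomial.eval₂ (Polynomial.eval₂RingHom (Int.castRingHom ℝ) ζ) v (S n)

theorem evalS_eq (n : ℕ) (ζ : ℝ) (v : Fin (2 * n + 1) → ℝ)
    (hx : Function.Injective (xs v)) (hy : Function.Injective (ys v))
    (hG : ∀ i j, G ζ (xs v i) (ys v j) ≠ 0) :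
    evalS n ζ v = (∏ i, ∏ j, G ζ (xs v i) (ys v j)) / (vand (xs v) * vand (ys v)) *
      Matrix.det (Matrix.of fun i j => F ζ (xs v i) (ys v j) (zl v) / G ζ (xs v i) (ys v j)) := by
  have h := congrArg (MvPolynomial.eval₂Hom
    (Polynomial.eval₂RingHom (Int.castRingHom ℝ) ζ) v) (exists_S n).choose_spec
  rw [map_mul, map_mul, map_numer, map_vand, map_vand] at h
  simp only [xs, ys, zl, zetaVar, vars, MvPolynomial.coe_eval₂Hom, MvPolynomial.eval₂_X,
    MvPolynomial.eval₂_C, Polynomial.coe_eval₂RingHom, Polynomial.eval₂_X] at h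
  have hv : ∀ w : Fin n → ℝ, Function.Injective w → vand w ≠ 0 := by
    intro w hw
    refine Finset.prod_ne_zero_iff.2 fun i _ => Finset.prod_ne_zero_iff.2 fun j hj => ?_
    exact sub_ne_zero.2 (hw.ne (Finset.mem_Ioi.1 hj).ne')
  have h' : vand (xs v) * vand (ys v) * evalS n ζ v = numer ζ (xs v) (ys v) (zl v) := h
  rw [numer_eq _ _ _ _ hG] at h'
  have h1 := hv _ hx
  have h2 := hv _ hy
  field_simp
  linarith

end SymmetricPolynomials

section Specializations

/-- `δ_n = [n² / 4]`. -/
def delta (n : ℕ) : ℕ := n ^ 2 / 4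

/-- The polynomial `P(·,ζ)` in one variable obtained from a two-variable polynomial `P(x,ζ)`,
viewed as a polynomial in `x` whose coefficients are polynomials in `ζ`, by fixing the value
of `ζ`. -/
noncomputable def atZeta (P : ℝ[X][X]) (ζ : ℝ) : ℝ[X] := P.map (Polynomial.evalRingHom ζ)

/-- The identity that characterizes the polynomial `P_n(x,ζ)`; the argument of `S_n` is `x`
followed by `n` copies of `2ζ+1` and `n` copies of `ζ/(ζ+2)`. For `n = 0`, the exponent
`delta (n - 1)` is `δ_{-1} = [1/4] = 0`. -/
def IsBigP (n : ℕ) (P : ℝ[X][X]) : Prop :=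
  ∀ ζ x : ℝ, ζ ≠ -2 →
    (1 + ζ / 2) ^ (n ^ 2) *
        evalS n ζ (fun k => if (k : ℕ) = 0 then x else if (k : ℕ) ≤ n then 2 * ζ + 1
          else ζ / (ζ + 2)) =
      (-1) ^ ((n + 1).choose 2) * ζ ^ (n ^ 2) * (1 + ζ) ^ (n ^ 2) * (1 + 2 * ζ) ^ delta (n - 1) *
        (1 + ζ / 2) ^ delta (n - 1) * (atZeta P ζ).eval x

/-- The identity that characterizes the polynomial `p_n(ζ)`; the argument of `S_n` is
`n + 1` copies of `2ζ+1` followed by `n` copies of `ζ/(ζ+2)`. -/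
def IsSmallP (n : ℕ) (p : ℝ[X]) : Prop :=
  ∀ ζ : ℝ, ζ ≠ -2 →
    (1 + ζ / 2) ^ (n ^ 2) *
        evalS n ζ (fun k => if (k : ℕ) ≤ n then 2 * ζ + 1 else ζ / (ζ + 2)) =
      (-1) ^ ((n + 1).choose 2) * ζ ^ (n ^ 2) * (1 + ζ) ^ (n ^ 2) * (1 + 2 * ζ) ^ delta n *
        (1 + ζ / 2) ^ delta (n - 1) * p.eval ζ

theorem IsSmallP.unique {n : ℕ} {p q : ℝ[X]} (hp : IsSmallP n p) (hq : IsSmallP n q) :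
    p = q := by
  refine Polynomial.eq_of_infinite_eval_eq p q ((Set.Ioi_infinite (0 : ℝ)).mono ?_)
  intro ζ hζ
  have hζ : 0 < ζ := hζ
  have h := (hp ζ (by linarith)).symm.trans (hq ζ (by linarith))
  refine mul_left_cancel₀ ?_ h
  have : (-1 : ℝ) ^ ((n + 1).choose 2) ≠ 0 := pow_ne_zero _ (by norm_num)
  have : ζ ^ (n ^ 2) * (1 + ζ) ^ (n ^ 2) * (1 + 2 * ζ) ^ delta n *
    (1 + ζ / 2) ^ delta (n - 1) ≠ 0 := by positivity
  simp_all

theorem IsBigP.unique {n : ℕ} {P Q : ℝ[X][X]} (hP : IsBigP n P) (hQ : IsBigP n Q) :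
    P = Q := by
  have key : ∀ ζ : ℝ, 0 < ζ → atZeta P ζ = atZeta Q ζ := by
    intro ζ hζ
    refine Polynomial.funext fun x => ?_
    have h := (hP ζ x (by linarith)).symm.trans (hQ ζ x (by linarith))
    refine mul_left_cancel₀ ?_ h
    have : (-1 : ℝ) ^ ((n + 1).choose 2) ≠ 0 := pow_ne_zero _ (by norm_num)
    have : ζ ^ (n ^ 2) * (1 + ζ) ^ (n ^ 2) * (1 + 2 * ζ) ^ delta (n - 1) *
      (1 + ζ / 2) ^ delta (n - 1) ≠ 0 := by positivity
    simp_all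
  ext1 k
  refine Polynomial.eq_of_infinite_eval_eq _ _ ((Set.Ioi_infinite (0 : ℝ)).mono ?_)
  intro ζ hζ
  simpa [atZeta] using congrArg (fun f => f.coeff k) (key ζ hζ)

/-- The polynomial `P_n(x,ζ)`, as a polynomial in `x` whose coefficients are polynomials in `ζ`:
the unique polynomial with the property `IsBigP n`. -/
noncomputable def bigP (n : ℕ) : ℝ[X][X] := Classical.epsilon (IsBigP n)

/-- The polynomial `p_n(ζ)`: the unique polynomial with the property `IsSmallP n`. -/
noncomputable def smallP (n : ℕ) : ℝ[X] := Classical.epsilon (IsSmallP n)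

end Specializations

/-- The conjecture that no `p_n` vanishes in the interval `-2 < ζ < -1/2`. -/
def NonvanishingConjecture : Prop :=
  ∀ n : ℕ, ∀ ζ : ℝ, -2 < ζ → ζ < -1 / 2 → (smallP n).eval ζ ≠ 0

/-- The conjecture that each `p_n` has exactly `[(n+1)/2]` real zeroes (with multiplicity). -/
def RealZeroesConjecture : Prop :=
  ∀ n : ℕ, smallP n ≠ 0 ∧ (smallP n).roots.card = (n + 1) / 2

/-- The real zeroes of `Q` interlace those of `P`: the former are `c_0 < ⋯ < c_n`,
the latter are `b_0 < ⋯ < b_{n-1}`, and `c_0 < b_0 < c_1 < ⋯ < b_{n-1} < c_n`. -/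
def ZeroesInterlace (n : ℕ) (Q P : ℝ[X]) : Prop :=
  ∃ (c : Fin (n + 1) → ℝ) (b : Fin n → ℝ), StrictMono c ∧ StrictMono b ∧
    {x : ℝ | Q.eval x = 0} = Set.range c ∧ {x : ℝ | P.eval x = 0} = Set.range b ∧
    ∀ i : Fin n, c i.castSucc < b i ∧ b i < c i.succ

end ThreeColour

open Polynomial Filter Topology

namespace ThreeColour

/-! ### Identities by density of the nonvanishing set of an analytic function. -/

section Density

variable {E : Type*} [NormedAddCommGroup E] [NormedSpace ℝ E]

/-! Write `a = 2ζ+1`, `b = ζ/(ζ+2)`, let `T_n(x)` be the value of `S_n` at `x`, `n` copies of `a`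
and `n` copies of `b` (`valT`), and put `A_n = T_n(a)`, `B_n = T_n(b)`. For `ζ` in the given range,
`T_n` is a nonzero constant times `P_n(·,ζ)`, so the claim is about the zeroes of `T_n`. It follows
from a Sturm-type argument for the sequence `T_0, T_1, …`.

The Desnanot–Jacobi identity gives a quadratic relation between `S_{n+2}`, `S_{n+1}` and `S_n`
(`dodgson`). By induction this relation also forces `S_n` to be symmetric in all its `2n+1`
variables (`evalS_comp_perm`). Three instances of it at the special points then combine into a
three-term recurrence for the `T_n` (`valT_three_term`). At a zero `c > 0` of `T_{n+1}` the middle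
term drops out, and the recurrence gives `T_n(c) T_{n+2}(c) < 0` as long as `A_n B_n` and `A_{n+1}
B_{n+1}` are positive (`valT_mul_valT_neg`).

This positivity reproduces itself: if `T_{n+1}` has `n+1` positive zeroes, then it keeps its sign on
`(-∞,0]`, which contains both `a` and `b`, so `A_{n+1} B_{n+1} > 0`. Since `T_n` alternates in sign
at the zeroes of `T_{n+1}`, so does `T_{n+2}`, with opposite signs. Two more sign changes come from
the ends of the half-line. At `0` the polynomial `T_{n+2}` reduces to a multiple of `B_{n+1}`. At
infinity, the inversion `ζ ↦ 1/ζ`, `x ↦ 1/x` expresses the leading coefficient through the value at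
`0` for the parameter `1/ζ`, which lies in the same range. The intermediate value theorem then
yields `n+2` positive zeroes of `T_{n+2}` separated by those of `T_{n+1}`
(`Admissible.alternating_succ`).

The polynomial `P_n` is introduced by choice, so its existence has to be proved (`exists_isBigP`).
The required powers of `ζ`, `1+ζ`, `1+2ζ` and `1+ζ/2` are found by comparing the powers of a prime
in the numerator of `S_n` and in the Vandermonde products. -/

theorem dense_ne_zero {f : E → ℝ} (hf : AnalyticOnNhd ℝ f Set.univ) (h : ∃ e, f e ≠ 0) :
    Dense {e | f e ≠ 0} := by
  obtain ⟨e₁, he₁⟩ := h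
  have hi : interior {e | f e = 0} = ∅ := by
    by_contra hne
    obtain ⟨e₀, he₀⟩ := Set.nonempty_iff_ne_empty.2 hne
    exact he₁ (hf.eqOn_zero_of_preconnected_of_eventuallyEq_zero isPreconnected_univ
      (Set.mem_univ e₀) (mem_interior_iff_mem_nhds.1 he₀) (Set.mem_univ e₁))
  exact interior_eq_empty_iff_dense_compl.1 hi

theorem isOpen_ne_zero {f : E → ℝ} (hf : AnalyticOnNhd ℝ f Set.univ) :
    IsOpen {e | f e ≠ 0} :=
  isOpen_ne_fun (continuousOn_univ.1 hf.continuousOn) continuous_const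

theorem dense_ne_zero_inter {f : E → ℝ} {s : Set E} (hf : AnalyticOnNhd ℝ f Set.univ)
    (h : ∃ e, f e ≠ 0) (hs : Dense s) : Dense ({e | f e ≠ 0} ∩ s) :=
  (dense_ne_zero hf h).inter_of_isOpen_left hs (isOpen_ne_zero hf)

/-- Continuity is asked only at the point in question: the inversion formula involves `x⁻¹`, which
is discontinuous at `0`. -/
theorem eq_of_dense {X : Type*} [TopologicalSpace X] {s : Set X} (hs : Dense s) {f g : X → ℝ}
    (h : ∀ e ∈ s, f e = g e) {e : X} (hf : ContinuousAt f e) (hg : ContinuousAt g e) :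
    f e = g e := by
  refine tendsto_nhds_unique_of_frequently_eq hf hg ?_
  exact (mem_closure_iff_frequently.1 (hs e)).mono h

end Density

/-- The list `(x_1,…,x_n,y_1,…,y_n,z)`. -/
def slots {A : Type*} {n : ℕ} (x y : Fin n → A) (z : A) : Fin (2 * n + 1) → A := fun k =>
  if h : (k : ℕ) < n then x ⟨k, h⟩ else if h' : (k : ℕ) < 2 * n then y ⟨k - n, by omega⟩ else z

section Slots

variable {A : Type*} {n : ℕ} (x y : Fin n → A) (z : A)

@[simp] theorem xs_slots : xs (slots x y z) = x := by
  ext i; simp [xs, slots]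

@[simp] theorem ys_slots : ys (slots x y z) = y := by
  ext i
  have : n + (i : ℕ) < 2 * n := by omega
  simp [ys, slots, this]

@[simp] theorem zl_slots : zl (slots x y z) = z := by
  have : ¬ (2 * n < n) := by omega
  simp [zl, slots, this]

theorem slots_eta (v : Fin (2 * n + 1) → A) : slots (xs v) (ys v) (zl v) = v := by
  ext k
  simp only [slots, xs, ys, zl]
  split_ifs with h h'
  · rfl
  · congr 1; ext; simp; omega
  · congr 1; ext; simp; omega

end Slots

/-- The value of `S_n` at `(x_1,…,x_n,y_1,…,y_n,z)`. -/
noncomputable def valS (n : ℕ) (ζ : ℝ) (x y : Fin n → ℝ) (z : ℝ) : ℝ := evalS n ζ (slots x y z)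

/-- The denominator-free form of the definition of `S_n`, valid also where variables coincide or
values of `G` vanish. -/
theorem vand_mul_valS (n : ℕ) (ζ : ℝ) (x y : Fin n → ℝ) (z : ℝ) :
    vand x * vand y * valS n ζ x y z = numer ζ x y z := by
  have h := congrArg (MvPolynomial.eval₂Hom
    (Polynomial.eval₂RingHom (Int.castRingHom ℝ) ζ) (slots x y z)) (exists_S n).choose_spec
  rw [map_mul, map_mul, map_numer, map_vand, map_vand] at h
  simp only [xs, ys, zl, zetaVar, vars, MvPolynomial.coe_eval₂Hom, MvPolynomial.eval₂_X,
    MvPolynomial.eval₂_C, Polynomial.coe_eval₂RingHom, Polynomial.eval₂_X] at h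
  have h' : vand (xs (slots x y z)) * vand (ys (slots x y z)) * evalS n ζ (slots x y z) =
    numer ζ (xs (slots x y z)) (ys (slots x y z)) (zl (slots x y z)) := h
  simpa [valS] using h'

theorem vand_ne_zero {n : ℕ} {w : Fin n → ℝ} (hw : Function.Injective w) : vand w ≠ 0 :=
  Finset.prod_ne_zero_iff.2 fun _ _ => Finset.prod_ne_zero_iff.2 fun _ hj =>
    sub_ne_zero.2 (hw.ne (Finset.mem_Ioi.1 hj).ne')

theorem injective_of_vand_ne_zero {n : ℕ} {w : Fin n → ℝ} (hw : vand w ≠ 0) :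
    Function.Injective w := by
  intro i j hij
  by_contra hne
  wlog hlt : i < j generalizing i j
  · exact this hij.symm (Ne.symm hne) (lt_of_le_of_ne (not_lt.1 hlt) (Ne.symm hne))
  exact Finset.prod_ne_zero_iff.1 (Finset.prod_ne_zero_iff.1 hw i (Finset.mem_univ i)) j
    (Finset.mem_Ioi.2 hlt) (sub_eq_zero.2 hij.symm)

/-! ### Analyticity and continuity of `S_n` in its variables. -/

section Analytic

variable {E : Type*} [NormedAddCommGroup E] [NormedSpace ℝ E] {s : Set E}

theorem analyticOnNhd_evalS {n : ℕ} (ζ : ℝ) {v : E → Fin (2 * n + 1) → ℝ}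
    (hv : ∀ k, AnalyticOnNhd ℝ (fun e => v e k) s) :
    AnalyticOnNhd ℝ (fun e => evalS n ζ (v e)) s := by
  have h : ∀ p : PolyRing n, AnalyticOnNhd ℝ (fun e => MvPolynomial.eval₂
      (Polynomial.eval₂RingHom (Int.castRingHom ℝ) ζ) (v e) p) s := by
    intro p
    induction p using MvPolynomial.induction_on with
    | C c => simpa using analyticOnNhd_const
    | add p q hp hq => simp only [MvPolynomial.eval₂_add]; exact hp.add hq
    | mul_X p k hp => simp only [MvPolynomial.eval₂_mul, MvPolynomial.eval₂_X]; exact hp.mul (hv k)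
  exact h _

theorem analyticOnNhd_valS {n : ℕ} (ζ : ℝ) {x y : E → Fin n → ℝ} {z : E → ℝ}
    (hx : ∀ k, AnalyticOnNhd ℝ (fun e => x e k) s)
    (hy : ∀ k, AnalyticOnNhd ℝ (fun e => y e k) s)
    (hz : AnalyticOnNhd ℝ z s) :
    AnalyticOnNhd ℝ (fun e => valS n ζ (x e) (y e) (z e)) s := by
  refine analyticOnNhd_evalS ζ fun k => ?_
  simp only [slots]
  split_ifs with h h'
  · exact hx _
  · exact hy _
  · exact hz

theorem analyticOnNhd_vand {n : ℕ} {x : E → Fin n → ℝ}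
    (hx : ∀ k, AnalyticOnNhd ℝ (fun e => x e k) s) :
    AnalyticOnNhd ℝ (fun e => vand (x e)) s := by
  unfold vand
  exact Finset.analyticOnNhd_fun_prod _ fun i _ => Finset.analyticOnNhd_fun_prod _ fun j _ =>
    (hx j).sub (hx i)

theorem analyticOnNhd_prod_G {m n : ℕ} (ζ : ℝ) {x : E → Fin m → ℝ} {y : E → Fin n → ℝ}
    (hx : ∀ k, AnalyticOnNhd ℝ (fun e => x e k) s)
    (hy : ∀ k, AnalyticOnNhd ℝ (fun e => y e k) s) :
    AnalyticOnNhd ℝ (fun e => ∏ i, ∏ j, G ζ (x e i) (y e j)) s := by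
  refine Finset.analyticOnNhd_fun_prod _ fun i _ => Finset.analyticOnNhd_fun_prod _ fun j _ => ?_
  intro e he
  have h1 := hx i e he
  have h2 := hy j e he
  unfold G
  fun_prop

theorem continuous_evalS (n : ℕ) (ζ : ℝ) : Continuous (evalS n ζ) := by
  have h : AnalyticOnNhd ℝ (fun v : Fin (2 * n + 1) → ℝ => evalS n ζ v) Set.univ :=
    analyticOnNhd_evalS ζ fun k =>
      (ContinuousLinearMap.proj (R := ℝ) (φ := fun _ : Fin (2 * n + 1) => ℝ) k).analyticOnNhd _
  exact continuousOn_univ.1 h.continuousOn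

end Analytic

theorem G_comm {A : Type*} [CommRing A] (ζ x y : A) : G ζ x y = G ζ y x := by
  unfold G; ring

theorem F_comm {A : Type*} [CommRing A] (ζ x y z : A) : F ζ x y z = F ζ y x z := by
  unfold F; ring

theorem F_swap {A : Type*} [CommRing A] (ζ x y z : A) : F ζ x y z = F ζ x z y := by
  unfold F; ring

end ThreeColour

namespace ThreeColour

/-! ### The numerator of `S_n` at a zero of `G`. -/

section Reduction

variable {A : Type*} [CommRing A]

theorem G_left_special (ζ y : A) : G ζ (2 * ζ + 1) y = 2 * (ζ + 1) ^ 2 * y ^ 2 := by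
  unfold G; ring

theorem G_zero_left (ζ y : A) : G ζ 0 y = -ζ * y * (y - (2 * ζ + 1)) := by
  unfold G; ring

theorem prod_erase_succ_cons {n : ℕ} (f : A → A) (x₁ : A) (x : Fin n → A) (i : Fin n) :
    ∏ k ∈ Finset.univ.erase i.succ, f ((Fin.cons x₁ x : Fin (n + 1) → A) k) =
      f x₁ * ∏ k ∈ Finset.univ.erase i, f (x k) := by
  have h : (Finset.univ.erase i.succ : Finset (Fin (n + 1))) =
      Finset.cons 0 ((Finset.univ.erase i).map (Fin.succEmb n)) (by simp) := by
    ext k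
    refine Fin.cases ?_ (fun k => ?_) k
    · simp [(Fin.succ_ne_zero i).symm]
    · simp [Fin.succ_ne_zero]
  rw [h, Finset.prod_cons, Finset.prod_map]
  simp

theorem prod_erase_zero_cons {n : ℕ} (f : A → A) (x₁ : A) (x : Fin n → A) :
    ∏ k ∈ Finset.univ.erase 0, f ((Fin.cons x₁ x : Fin (n + 1) → A) k) = ∏ k, f (x k) := by
  have h : (Finset.univ.erase 0 : Finset (Fin (n + 1))) = Finset.univ.map (Fin.succEmb n) := by
    ext k
    refine Fin.cases ?_ (fun k => ?_) k
    · simp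
    · simp [Fin.succ_ne_zero]
  rw [h, Finset.prod_map]
  simp

/-- When `G(x_1,y_1) = 0`, the numerator of `S_{n+1}` is a multiple of the one of `S_n`. -/
theorem numer_cons_of_G_eq_zero {n : ℕ} (ζ x₁ y₁ : A) (x y : Fin n → A) (z : A)
    (h : G ζ x₁ y₁ = 0) :
    numer ζ (Fin.cons x₁ x : Fin (n + 1) → A) (Fin.cons y₁ y) z =
      F ζ x₁ y₁ z * (∏ k, G ζ (x k) y₁) * (∏ k, G ζ x₁ (y k)) * numer ζ x y z := by
  -- Each entry of the first column below the top one contains the factor `G(x₁,y₁) = 0`, so the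
  -- expansion along this column has a single term.
  rw [numer, Matrix.det_succ_column_zero, Finset.sum_eq_single 0]
  · have hm : ((Matrix.of fun i j : Fin (n + 1) =>
        F ζ ((Fin.cons x₁ x : Fin (n + 1) → A) i) ((Fin.cons y₁ y : Fin (n + 1) → A) j) z *
          ∏ k ∈ Finset.univ.erase i, G ζ ((Fin.cons x₁ x : Fin (n + 1) → A) k)
            ((Fin.cons y₁ y : Fin (n + 1) → A) j)).submatrix (Fin.succAbove 0) Fin.succ) =
        Matrix.of fun i j : Fin n => G ζ x₁ (y j) * (Matrix.of fun i j : Fin n =>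
          F ζ (x i) (y j) z * ∏ k ∈ Finset.univ.erase i, G ζ (x k) (y j)) i j := by
      ext i j
      simp only [Matrix.submatrix_apply, Matrix.of_apply, Fin.succAbove_zero, Fin.cons_succ]
      rw [prod_erase_succ_cons (fun t => G ζ t (y j))]
      ring
    rw [hm, Matrix.det_mul_row, numer]
    simp only [Matrix.of_apply, Fin.cons_zero, Fin.val_zero, pow_zero, one_mul]
    rw [prod_erase_zero_cons (fun t => G ζ t y₁)]
    ring
  · intro i _ hi
    obtain ⟨i, rfl⟩ := Fin.exists_succ_eq_of_ne_zero hi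
    simp only [Matrix.of_apply, Fin.cons_zero]
    rw [prod_erase_succ_cons (fun t => G ζ t y₁), h]
    ring
  · simp

theorem vand_cons {n : ℕ} (x₁ : A) (x : Fin n → A) :
    vand (Fin.cons x₁ x : Fin (n + 1) → A) = (∏ k, (x k - x₁)) * vand x := by
  have hs : ∀ (i : Fin n) (f : Fin (n + 1) → A),
      ∏ j ∈ Finset.Ioi i.succ, f j = ∏ j ∈ Finset.Ioi i, f j.succ := by
    intro i f
    rw [← Fin.map_succEmb_Ioi, Finset.prod_map]
    rfl
  have h0 : ∀ f : Fin (n + 1) → A, ∏ j ∈ Finset.Ioi 0, f j = ∏ j, f (Fin.succ j) := by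
    intro f
    rw [Fin.Ioi_zero_eq_map, Finset.prod_map]
    rfl
  rw [vand, Fin.prod_univ_succ, h0]
  simp only [hs, Fin.cons_zero, Fin.cons_succ, vand]

theorem vand_comp_perm {n : ℕ} (x : Fin n → A) (σ : Equiv.Perm (Fin n)) :
    vand (x ∘ σ) = (Equiv.Perm.sign σ : ℤ) * vand x := by
  have h : ∀ w : Fin n → A, vand w = (Matrix.vandermonde w).det :=
    fun w => (Matrix.det_vandermonde w).symm
  rw [h, h, ← Matrix.det_permute]
  rfl

end Reduction

/-! ### The Desnanot–Jacobi identity. -/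

section Dodgson

open scoped Matrix

variable {K : Type*} [Field K]

theorem det_bordered {m n : ℕ} (a : Matrix (Fin m) (Fin m) K) (b : Matrix (Fin m) (Fin n) K)
    (c : Matrix (Fin n) (Fin m) K) (d : Matrix (Fin n) (Fin n) K) (hd : d.det ≠ 0) :
    (Matrix.fromBlocks a b c d).det = d.det * (a - b * d⁻¹ * c).det := by
  have := d.invertibleOfIsUnitDet (isUnit_iff_ne_zero.2 hd)
  rw [Matrix.det_fromBlocks₂₂, Matrix.invOf_eq_nonsing_inv]

/-- The determinant with the entries `h (x i) (y j)`. -/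
def detOf {α : Type*} (h : α → α → K) {n : ℕ} (x y : Fin n → α) : K :=
  Matrix.det (Matrix.of fun i j => h (x i) (y j))

variable {α : Type*} (h : α → α → K) {n : ℕ} (x y : Fin n → α)

theorem detOf_append {m : ℕ} (u v : Fin m → α) :
    detOf h (Fin.append u x) (Fin.append v y) =
      (Matrix.fromBlocks (Matrix.of fun i j => h (u i) (v j)) (Matrix.of fun i j => h (u i) (y j))
        (Matrix.of fun i j => h (x i) (v j)) (Matrix.of fun i j => h (x i) (y j))).det := by
  rw [detOf, ← Matrix.det_submatrix_equiv_self finSumFinEquiv]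
  congr 1
  ext i j
  rcases i with i | i <;> rcases j with j | j <;> simp

theorem detOf_cast {m m' : ℕ} (e : m = m') (u v : Fin m' → α) :
    detOf h (u ∘ Fin.cast e) (v ∘ Fin.cast e) = detOf h u v := by
  subst e; rfl

theorem detOf_cons_eq (x₁ y₁ : α) :
    detOf h (Fin.cons x₁ x : Fin (n + 1) → α) (Fin.cons y₁ y) =
      detOf h (Fin.append ![x₁] x) (Fin.append ![y₁] y) := by
  have key : ∀ (w : Fin n → α) (w₁ : α), Fin.append ![w₁] w =
      (Fin.cons w₁ w : Fin (n + 1) → α) ∘ Fin.cast (Nat.add_comm 1 n) := by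
    intro w w₁
    have : (![w₁] : Fin 1 → α) = Fin.cons w₁ Fin.elim0 := by ext i; fin_cases i; rfl
    rw [this]
    exact Fin.append_left_eq_cons _ _
  rw [key, key, detOf_cast]

theorem detOf_cons_cons_eq (x₁ y₁ x₂ y₂ : α) :
    detOf h (Fin.cons x₁ (Fin.cons x₂ x) : Fin (n + 2) → α) (Fin.cons y₁ (Fin.cons y₂ y)) =
      detOf h (Fin.append ![x₁, x₂] x) (Fin.append ![y₁, y₂] y) := by
  have key : ∀ (w : Fin n → α) (w₁ w₂ : α), Fin.append ![w₁, w₂] w =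
      (Fin.cons w₁ (Fin.cons w₂ w) : Fin (n + 2) → α) ∘ Fin.cast (Nat.add_comm 2 n) := by
    intro w w₁ w₂
    ext i
    refine Fin.addCases (fun i => ?_) (fun i => ?_) i
    · fin_cases i
      · simp; rfl
      · simp; rfl
    · have e : Fin.cast (Nat.add_comm 2 n) (Fin.natAdd 2 i) = i.succ.succ := by
        ext; simp
      have h2 := Fin.append_right ![w₁, w₂] w i
      refine h2.trans ?_
      rw [Function.comp_apply]
      refine Eq.trans ?_ (congrArg (Fin.cons w₁ (Fin.cons w₂ w) : Fin (n + 2) → α) e).symm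
      rw [Fin.cons_succ, Fin.cons_succ]
  rw [key, key, detOf_cast]

/-- The Desnanot–Jacobi identity. -/
theorem detOf_cons_cons_mul (x₁ y₁ x₂ y₂ : α) (hd : detOf h x y ≠ 0) :
    detOf h (Fin.cons x₁ (Fin.cons x₂ x) : Fin (n + 2) → α) (Fin.cons y₁ (Fin.cons y₂ y)) *
        detOf h x y =
      detOf h (Fin.cons x₁ x : Fin (n + 1) → α) (Fin.cons y₁ y) *
          detOf h (Fin.cons x₂ x : Fin (n + 1) → α) (Fin.cons y₂ y) -
        detOf h (Fin.cons x₁ x : Fin (n + 1) → α) (Fin.cons y₂ y) *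
          detOf h (Fin.cons x₂ x : Fin (n + 1) → α) (Fin.cons y₁ y) := by
  -- One bordering row and column multiply the determinant by a scalar Schur complement. With two of
  -- each, the Schur complement is the 2×2 matrix of these scalars, so the identity becomes the
  -- formula for a 2×2 determinant.
  have hone : ∀ s t : α, detOf h (Fin.cons s x : Fin (n + 1) → α) (Fin.cons t y) =
      detOf h x y * (h s t - ((fun j => h s (y j)) ᵥ*
        (Matrix.of fun i j => h (x i) (y j))⁻¹) ⬝ᵥ (fun i => h (x i) t)) := by
    intro s t
    rw [detOf_cons_eq, detOf_append, det_bordered _ _ _ _ hd, Matrix.det_fin_one]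
    rfl
  rw [detOf_cons_cons_eq, detOf_append, det_bordered _ _ _ _ hd, Matrix.det_fin_two]
  simp only [hone]
  change detOf h x y * ((h x₁ y₁ - ((fun j => h x₁ (y j)) ᵥ*
        (Matrix.of fun i j => h (x i) (y j))⁻¹) ⬝ᵥ (fun i => h (x i) y₁)) *
        (h x₂ y₂ - ((fun j => h x₂ (y j)) ᵥ*
        (Matrix.of fun i j => h (x i) (y j))⁻¹) ⬝ᵥ (fun i => h (x i) y₂)) -
        (h x₁ y₂ - ((fun j => h x₁ (y j)) ᵥ*
        (Matrix.of fun i j => h (x i) (y j))⁻¹) ⬝ᵥ (fun i => h (x i) y₂)) *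
        (h x₂ y₁ - ((fun j => h x₂ (y j)) ᵥ*
        (Matrix.of fun i j => h (x i) (y j))⁻¹) ⬝ᵥ (fun i => h (x i) y₁))) * detOf h x y = _
  ring

end Dodgson

end ThreeColour

/-! ### Generic points, first symmetries and nonvanishing of `S_n`. -/

namespace ThreeColour

theorem valS_eq {n : ℕ} (ζ : ℝ) (x y : Fin n → ℝ) (z : ℝ) (hx : Function.Injective x)
    (hy : Function.Injective y) (hG : ∀ i j, G ζ (x i) (y j) ≠ 0) :
    valS n ζ x y z = (∏ i, ∏ j, G ζ (x i) (y j)) / (vand x * vand y) *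
      detOf (fun s t => F ζ s t z / G ζ s t) x y := by
  have h := evalS_eq n ζ (slots x y z) (by simpa using hx) (by simpa using hy) (by simpa using hG)
  simpa [valS, detOf] using h

/-- All differences and all values of `G` in the definition of `S_n` are nonzero. -/
def Generic {n : ℕ} (ζ : ℝ) (x y : Fin n → ℝ) : Prop :=
  Function.Injective x ∧ Function.Injective y ∧ ∀ i j, G ζ (x i) (y j) ≠ 0

/-- The space of lists `(x_1,…,x_n,y_1,…,y_n,z)`. -/
abbrev Pt (n : ℕ) : Type := (Fin n → ℝ) × (Fin n → ℝ) × ℝ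

section

variable {n : ℕ}

theorem analyticOnNhd_x (k : Fin n) :
    AnalyticOnNhd ℝ (fun e : Pt n => e.1 k) Set.univ :=
  ((ContinuousLinearMap.proj (R := ℝ) (φ := fun _ : Fin n => ℝ) k).comp
    (ContinuousLinearMap.fst ℝ (Fin n → ℝ) ((Fin n → ℝ) × ℝ))).analyticOnNhd _

theorem analyticOnNhd_y (k : Fin n) :
    AnalyticOnNhd ℝ (fun e : Pt n => e.2.1 k) Set.univ :=
  ((ContinuousLinearMap.proj (R := ℝ) (φ := fun _ : Fin n => ℝ) k).comp
    ((ContinuousLinearMap.fst ℝ (Fin n → ℝ) ℝ).comp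
      (ContinuousLinearMap.snd ℝ (Fin n → ℝ) ((Fin n → ℝ) × ℝ)))).analyticOnNhd _

theorem analyticOnNhd_z : AnalyticOnNhd ℝ (fun e : Pt n => e.2.2) Set.univ :=
  ((ContinuousLinearMap.snd ℝ (Fin n → ℝ) ℝ).comp
    (ContinuousLinearMap.snd ℝ (Fin n → ℝ) ((Fin n → ℝ) × ℝ))).analyticOnNhd _

theorem exists_vand_ne_zero (n : ℕ) : ∃ w : Fin n → ℝ, vand w ≠ 0 :=
  ⟨fun i => (i : ℕ), vand_ne_zero fun i j h => by simpa [Fin.ext_iff] using h⟩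

theorem dense_generic (n : ℕ) {ζ : ℝ} (hζ : ζ + 1 ≠ 0) :
    Dense {e : Pt n | Generic ζ e.1 e.2.1} := by
  obtain ⟨w, hw⟩ := exists_vand_ne_zero n
  have h1 : Dense ({e : Pt n | vand e.1 ≠ 0} ∩ ({e : Pt n | vand e.2.1 ≠ 0} ∩
      ({e : Pt n | ∏ i, ∏ j, G ζ (e.1 i) (e.2.1 j) ≠ 0}))) := by
    refine dense_ne_zero_inter (analyticOnNhd_vand analyticOnNhd_x) ⟨(w, 0, 0), hw⟩
      (dense_ne_zero_inter (analyticOnNhd_vand analyticOnNhd_y) ⟨(0, w, 0), hw⟩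
      (dense_ne_zero (analyticOnNhd_prod_G ζ analyticOnNhd_x analyticOnNhd_y)
        -- Here every factor is `G(2ζ+1, 1) = 2(ζ+1)²`.
        ⟨(fun _ => 2 * ζ + 1, fun _ => 1, 0), ?_⟩))
    simp only [G_left_special]
    simp [Finset.prod_const, hζ]
  refine h1.mono ?_
  rintro e ⟨hx, hy, hG⟩
  refine ⟨injective_of_vand_ne_zero hx, injective_of_vand_ne_zero hy, fun i j => ?_⟩
  exact Finset.prod_ne_zero_iff.1 (Finset.prod_ne_zero_iff.1 hG i (Finset.mem_univ i)) j
    (Finset.mem_univ j)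

theorem continuous_valS {X : Type*} [TopologicalSpace X] (ζ : ℝ) {x y : X → Fin n → ℝ} {z : X → ℝ}
    (hx : Continuous x) (hy : Continuous y) (hz : Continuous z) :
    Continuous fun e => valS n ζ (x e) (y e) (z e) := by
  refine (continuous_evalS n ζ).comp (continuous_pi fun k => ?_)
  simp only [slots]
  split_ifs with h h'
  · exact (continuous_apply _).comp hx
  · exact (continuous_apply _).comp hy
  · exact hz

/-- A continuous identity between points of `Pt n` only has to be checked on a dense set. -/
theorem eq_of_dense_pt {s : Set (Pt n)} (hs : Dense s) {f g : Pt n → ℝ} (hf : Continuous f)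
    (hg : Continuous g) (h : ∀ e ∈ s, f e = g e) (x y : Fin n → ℝ) (z : ℝ) :
    f (x, y, z) = g (x, y, z) :=
  eq_of_dense hs h hf.continuousAt hg.continuousAt

theorem valS_symm {ζ : ℝ} (hζ : ζ + 1 ≠ 0) (x y : Fin n → ℝ) (z : ℝ) :
    valS n ζ y x z = valS n ζ x y z := by
  refine eq_of_dense_pt (f := fun e => valS n ζ e.2.1 e.1 e.2.2)
    (g := fun e => valS n ζ e.1 e.2.1 e.2.2) (dense_generic n hζ)
    (continuous_valS ζ (by fun_prop) (by fun_prop) (by fun_prop))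
    (continuous_valS ζ (by fun_prop) (by fun_prop) (by fun_prop)) ?_ x y z
  rintro ⟨x, y, z⟩ ⟨hx, hy, hG⟩
  simp only at hx hy hG ⊢
  rw [valS_eq ζ x y z hx hy hG, valS_eq ζ y x z hy hx (fun i j => by rw [G_comm]; exact hG j i),
    Finset.prod_comm, mul_comm (vand y)]
  congr 1
  · simp_rw [G_comm ζ (y _) (x _)]
  · rw [detOf, ← Matrix.det_transpose, detOf]
    congr 1
    ext i j
    simp [F_comm ζ (y j), G_comm ζ (y j)]

/-- The sign of the permutation appears both in the determinant and in the Vandermonde product, and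
cancels. -/
theorem valS_perm_left {ζ : ℝ} (hζ : ζ + 1 ≠ 0) (σ : Equiv.Perm (Fin n)) (x y : Fin n → ℝ)
    (z : ℝ) : valS n ζ (x ∘ σ) y z = valS n ζ x y z := by
  refine eq_of_dense_pt (f := fun e => valS n ζ (e.1 ∘ σ) e.2.1 e.2.2)
    (g := fun e => valS n ζ e.1 e.2.1 e.2.2) (dense_generic n hζ)
    (continuous_valS ζ (continuous_pi fun k => by simp only [Function.comp_apply]; fun_prop)
      (by fun_prop) (by fun_prop))
    (continuous_valS ζ (by fun_prop) (by fun_prop) (by fun_prop)) ?_ x y z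
  rintro ⟨x, y, z⟩ ⟨hx, hy, hG⟩
  simp only at hx hy hG ⊢
  rw [valS_eq ζ x y z hx hy hG, valS_eq ζ (x ∘ σ) y z (hx.comp σ.injective) hy
    (fun i j => hG (σ i) j), vand_comp_perm]
  have h1 : ∏ i, ∏ j, G ζ ((x ∘ σ) i) (y j) = ∏ i, ∏ j, G ζ (x i) (y j) :=
    Equiv.prod_comp σ (fun i => ∏ j, G ζ (x i) (y j))
  have h2 : detOf (fun s t => F ζ s t z / G ζ s t) (x ∘ σ) y =
      (Equiv.Perm.sign σ : ℤ) * detOf (fun s t => F ζ s t z / G ζ s t) x y := by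
    rw [detOf, detOf, ← Matrix.det_permute]
    rfl
  have h3 : ((Equiv.Perm.sign σ : ℤ) : ℝ) * (Equiv.Perm.sign σ : ℤ) = 1 := by
    rcases Int.units_eq_one_or (Equiv.Perm.sign σ) with h | h <;> simp [h]
  have h4 : ((Equiv.Perm.sign σ : ℤ) : ℝ) ≠ 0 := left_ne_zero_of_mul_eq_one h3
  have hvx := vand_ne_zero hx
  have hvy := vand_ne_zero hy
  rw [h1, h2]
  field_simp

theorem valS_perm_right {ζ : ℝ} (hζ : ζ + 1 ≠ 0) (σ : Equiv.Perm (Fin n)) (x y : Fin n → ℝ)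
    (z : ℝ) : valS n ζ x (y ∘ σ) z = valS n ζ x y z := by
  rw [valS_symm hζ, valS_perm_left hζ, valS_symm hζ]

theorem valS_zero (ζ : ℝ) (x y : Fin 0 → ℝ) (z : ℝ) : valS 0 ζ x y z = 1 := by
  have := vand_mul_valS 0 ζ x y z
  simpa [vand, numer] using this

theorem valS_one (ζ : ℝ) (x y : Fin 1 → ℝ) (z : ℝ) : valS 1 ζ x y z = F ζ (x 0) (y 0) z := by
  have := vand_mul_valS 1 ζ x y z
  have h : (Finset.univ.erase (0 : Fin 1)) = ∅ := by decide
  have h' : (Finset.Ioi (0 : Fin 1)) = ∅ := by decide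
  simpa [vand, numer, h, h'] using this

/-- The reduction of `S_{n+1}` to `S_n` at `x_1 = 0`, `y_1 = 2ζ+1`. -/
theorem valS_cons_zero (ζ : ℝ) (x y : Fin n → ℝ) (z : ℝ) :
    valS (n + 1) ζ (Fin.cons 0 x) (Fin.cons (2 * ζ + 1) y) z =
      (-2 * ζ * (ζ + 1) * z) * (∏ k, (2 * (ζ + 1) ^ 2 * x k)) * (∏ k, (-ζ * y k)) *
        valS n ζ x y z := by
  obtain ⟨w, hw⟩ := exists_vand_ne_zero n
  have hd : Dense ({e : Pt n | vand e.1 ≠ 0} ∩ ({e : Pt n | vand e.2.1 ≠ 0} ∩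
      ({e : Pt n | ∏ k, e.1 k ≠ 0} ∩ {e : Pt n | ∏ k, (e.2.1 k - (2 * ζ + 1)) ≠ 0}))) := by
    refine dense_ne_zero_inter (analyticOnNhd_vand analyticOnNhd_x) ⟨(w, 0, 0), hw⟩
      (dense_ne_zero_inter (analyticOnNhd_vand analyticOnNhd_y) ⟨(0, w, 0), hw⟩
      (dense_ne_zero_inter (Finset.analyticOnNhd_fun_prod _ fun k _ => analyticOnNhd_x k)
        ⟨(1, 0, 0), by simp⟩
      (dense_ne_zero (Finset.analyticOnNhd_fun_prod _ fun k _ =>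
        (analyticOnNhd_y k).sub analyticOnNhd_const) ⟨(0, fun _ => 2 * ζ + 2, 0), ?_⟩)))
    exact Finset.prod_ne_zero_iff.2 fun k _ => by
      have : (2 * ζ + 2 : ℝ) - (2 * ζ + 1) = 1 := by ring
      exact ne_of_eq_of_ne this one_ne_zero
  refine eq_of_dense_pt
    (f := fun e => valS (n + 1) ζ (Fin.cons 0 e.1) (Fin.cons (2 * ζ + 1) e.2.1) e.2.2)
    (g := fun e => (-2 * ζ * (ζ + 1) * e.2.2) * (∏ k, (2 * (ζ + 1) ^ 2 * e.1 k)) *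
      (∏ k, (-ζ * e.2.1 k)) * valS n ζ e.1 e.2.1 e.2.2) hd
    (continuous_valS ζ (by fun_prop) (by fun_prop) (by fun_prop))
    (Continuous.mul (by fun_prop)
      (continuous_valS ζ (by fun_prop) (by fun_prop) (by fun_prop))) ?_ x y z
  rintro ⟨x, y, z⟩ ⟨hx, hy, hx0, hya⟩
  simp only [Set.mem_ofPred_eq] at hx hy hx0 hya ⊢
  have h1 := vand_mul_valS (n + 1) ζ (Fin.cons 0 x) (Fin.cons (2 * ζ + 1) y) z
  rw [numer_cons_of_G_eq_zero _ _ _ _ _ _ (by rw [G_zero_left]; ring), ← vand_mul_valS,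
    vand_cons, vand_cons] at h1
  have e1 : ∏ k, G ζ (x k) (2 * ζ + 1) = (∏ k, (2 * (ζ + 1) ^ 2 * x k)) * ∏ k, x k := by
    rw [← Finset.prod_mul_distrib]
    refine Finset.prod_congr rfl fun k _ => ?_
    rw [G_comm, G_left_special]; ring
  have e2 : ∏ k, G ζ 0 (y k) = (∏ k, (-ζ * y k)) * ∏ k, (y k - (2 * ζ + 1)) := by
    rw [← Finset.prod_mul_distrib]
    refine Finset.prod_congr rfl fun k _ => ?_
    rw [G_zero_left]
  have e3 : F ζ 0 (2 * ζ + 1) z = -2 * ζ * (ζ + 1) * z := by unfold F; ring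
  rw [e1, e2, e3] at h1
  simp only [sub_zero] at h1
  refine mul_left_cancel₀ (mul_ne_zero (mul_ne_zero hx0 hya) (mul_ne_zero hx hy)) ?_
  linear_combination h1

/-- The reduction at `x₁ = 0`, `y₁ = 2ζ+1` carries a nonzero value of `S_n` to one of `S_{n+1}`.
This is what allows a factor `S_n` to be cancelled from the quadratic relation on a dense set. -/
theorem exists_valS_ne_zero {ζ : ℝ} (h0 : ζ ≠ 0) (h1 : ζ + 1 ≠ 0) (n : ℕ) :
    ∃ e : Pt n, valS n ζ e.1 e.2.1 e.2.2 ≠ 0 := by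
  induction n with
  | zero => exact ⟨0, by rw [valS_zero]; exact one_ne_zero⟩
  | succ n ih =>
    have hd : Dense ({e : Pt n | e.2.2 ≠ 0} ∩ ({e : Pt n | ∏ k, e.1 k ≠ 0} ∩
        ({e : Pt n | ∏ k, e.2.1 k ≠ 0} ∩ {e : Pt n | valS n ζ e.1 e.2.1 e.2.2 ≠ 0}))) :=
      dense_ne_zero_inter analyticOnNhd_z ⟨(0, 0, 1), one_ne_zero⟩
      (dense_ne_zero_inter (Finset.analyticOnNhd_fun_prod _ fun k _ => analyticOnNhd_x k)
        ⟨(1, 0, 0), by simp⟩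
      (dense_ne_zero_inter (Finset.analyticOnNhd_fun_prod _ fun k _ => analyticOnNhd_y k)
        ⟨(0, 1, 0), by simp⟩
      (dense_ne_zero (analyticOnNhd_valS ζ analyticOnNhd_x analyticOnNhd_y analyticOnNhd_z) ih)))
    obtain ⟨⟨x, y, z⟩, hz, hx, hy, hv⟩ := hd.nonempty
    simp only [Set.mem_ofPred_eq] at hx hy hz hv
    refine ⟨(Fin.cons 0 x, Fin.cons (2 * ζ + 1) y, z), ?_⟩
    simp only [valS_cons_zero, Finset.prod_mul_distrib, Finset.prod_const]
    simp [h0, h1, hx, hy, hz, hv]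

end

end ThreeColour

/-! ### The quadratic relation for `S_n`. -/

namespace ThreeColour

variable {n : ℕ}

theorem prod_G_cons_cons (ζ x₁ y₁ : ℝ) (x y : Fin n → ℝ) :
    ∏ i, ∏ j, G ζ ((Fin.cons x₁ x : Fin (n + 1) → ℝ) i) ((Fin.cons y₁ y : Fin (n + 1) → ℝ) j) =
      G ζ x₁ y₁ * (∏ j, G ζ x₁ (y j)) * (∏ i, G ζ (x i) y₁) * ∏ i, ∏ j, G ζ (x i) (y j) := by
  simp only [Fin.prod_univ_succ, Fin.cons_zero, Fin.cons_succ, Finset.prod_mul_distrib]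
  ring

theorem Generic.cons_left {ζ : ℝ} {x₁ y₁ x₂ y₂ : ℝ} {x y : Fin n → ℝ}
    (h : Generic ζ (Fin.cons x₁ (Fin.cons x₂ x) : Fin (n + 2) → ℝ)
      (Fin.cons y₁ (Fin.cons y₂ y))) :
    Generic ζ (Fin.cons x₁ x : Fin (n + 1) → ℝ) (Fin.cons y₁ y) := by
  have key : ∀ (w₁ w₂ : ℝ) (w : Fin n → ℝ), (Fin.cons w₁ w : Fin (n + 1) → ℝ) =
      (Fin.cons w₁ (Fin.cons w₂ w) : Fin (n + 2) → ℝ) ∘ (Fin.succAbove 1) := by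
    intro w₁ w₂ w
    ext i
    refine Fin.cases rfl (fun i => ?_) i
    have : Fin.succAbove (1 : Fin (n + 2)) i.succ = i.succ.succ := by
      rw [← Fin.succ_zero_eq_one, Fin.succ_succAbove_succ, Fin.succAbove_zero]
    simp only [Function.comp_apply, this, Fin.cons_succ]
  rw [key x₁ x₂ x, key y₁ y₂ y]
  exact ⟨h.1.comp (Fin.succAbove_right_injective), h.2.1.comp (Fin.succAbove_right_injective),
    fun i j => h.2.2 _ _⟩

theorem Generic.tail {ζ : ℝ} {x₁ y₁ : ℝ} {x y : Fin n → ℝ}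
    (h : Generic ζ (Fin.cons x₁ x : Fin (n + 1) → ℝ) (Fin.cons y₁ y)) : Generic ζ x y :=
  ⟨fun i j hij => Fin.succ_injective _ (h.1 (by simpa using hij)),
    fun i j hij => Fin.succ_injective _ (h.2.1 (by simpa using hij)),
    fun i j => by simpa using h.2.2 i.succ j.succ⟩

theorem Generic.swap_left {ζ : ℝ} {x₁ x₂ : ℝ} {x : Fin n → ℝ} {y : Fin (n + 2) → ℝ}
    (h : Generic ζ (Fin.cons x₁ (Fin.cons x₂ x) : Fin (n + 2) → ℝ) y) :
    Generic ζ (Fin.cons x₂ (Fin.cons x₁ x) : Fin (n + 2) → ℝ) y := by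
  have key : (Fin.cons x₂ (Fin.cons x₁ x) : Fin (n + 2) → ℝ) =
      (Fin.cons x₁ (Fin.cons x₂ x) : Fin (n + 2) → ℝ) ∘ (Equiv.swap 0 1) := by
    ext i
    refine Fin.cases ?_ (fun i => Fin.cases ?_ (fun i => ?_) i) i
    · simp only [Function.comp_apply, Equiv.swap_apply_left]; rfl
    · simp only [Function.comp_apply, Fin.succ_zero_eq_one, Equiv.swap_apply_right]; rfl
    · rw [Function.comp_apply, Equiv.swap_apply_of_ne_of_ne (Fin.succ_ne_zero _)
        (by rw [← Fin.succ_zero_eq_one]; exact fun e => Fin.succ_ne_zero _ (Fin.succ_injective _ e))]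
      rfl
  rw [key]
  exact ⟨h.1.comp (Equiv.injective _), h.2.1, fun i j => h.2.2 _ _⟩

theorem Generic.symm {ζ : ℝ} {x y : Fin n → ℝ} (h : Generic ζ x y) : Generic ζ y x :=
  ⟨h.2.1, h.1, fun i j => by rw [G_comm]; exact h.2.2 j i⟩

theorem valS_eq_of_generic {ζ : ℝ} {x y : Fin n → ℝ} (h : Generic ζ x y) (z : ℝ) :
    valS n ζ x y z = (∏ i, ∏ j, G ζ (x i) (y j)) / (vand x * vand y) *
      detOf (fun s t => F ζ s t z / G ζ s t) x y :=
  valS_eq ζ x y z h.1 h.2.1 h.2.2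

/-- The Desnanot–Jacobi identity multiplied by products of values of `G` and divided by Vandermonde
products. Factors that involve at most one of the distinguished `x` and one of the distinguished `y`
are balanced, up to the displayed values of `G`. -/
theorem dodgson_of_generic {ζ : ℝ} {x₁ y₁ x₂ y₂ : ℝ} {x y : Fin n → ℝ} {z : ℝ}
    (h : Generic ζ (Fin.cons x₁ (Fin.cons x₂ x) : Fin (n + 2) → ℝ) (Fin.cons y₁ (Fin.cons y₂ y)))
    (hv : valS n ζ x y z ≠ 0) :
    (x₂ - x₁) * (y₂ - y₁) *
        valS (n + 2) ζ (Fin.cons x₁ (Fin.cons x₂ x)) (Fin.cons y₁ (Fin.cons y₂ y)) z *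
        valS n ζ x y z =
      G ζ x₁ y₂ * G ζ x₂ y₁ * valS (n + 1) ζ (Fin.cons x₁ x) (Fin.cons y₁ y) z *
          valS (n + 1) ζ (Fin.cons x₂ x) (Fin.cons y₂ y) z -
        G ζ x₁ y₁ * G ζ x₂ y₂ * valS (n + 1) ζ (Fin.cons x₁ x) (Fin.cons y₂ y) z *
          valS (n + 1) ζ (Fin.cons x₂ x) (Fin.cons y₁ y) z := by
  have h11 := h.cons_left
  have h21 := h.swap_left.cons_left
  have h12 := h.symm.swap_left.symm.cons_left
  have h22 := h.swap_left.symm.swap_left.symm.cons_left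
  have h0 := h11.tail
  have hd : detOf (fun s t => F ζ s t z / G ζ s t) x y ≠ 0 := by
    rw [valS_eq_of_generic h0] at hv
    exact right_ne_zero_of_mul hv
  have hJ := detOf_cons_cons_mul (fun s t => F ζ s t z / G ζ s t) x y x₁ y₁ x₂ y₂ hd
  have hvx := vand_ne_zero h.1
  have hvy := vand_ne_zero h.2.1
  rw [valS_eq_of_generic h, valS_eq_of_generic h11, valS_eq_of_generic h12,
    valS_eq_of_generic h21, valS_eq_of_generic h22, valS_eq_of_generic h0]
  simp only [prod_G_cons_cons, vand_cons] at hvx hvy ⊢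
  simp only [Fin.prod_univ_succ, Fin.cons_zero, Fin.cons_succ] at hvx hvy ⊢
  generalize detOf (fun s t => F ζ s t z / G ζ s t) x y = D0 at *
  generalize detOf (fun s t => F ζ s t z / G ζ s t) (Fin.cons x₁ (Fin.cons x₂ x))
    (Fin.cons y₁ (Fin.cons y₂ y)) = D2 at *
  generalize detOf (fun s t => F ζ s t z / G ζ s t) (Fin.cons x₁ x) (Fin.cons y₁ y) = D11 at *
  generalize detOf (fun s t => F ζ s t z / G ζ s t) (Fin.cons x₁ x) (Fin.cons y₂ y) = D12 at *
  generalize detOf (fun s t => F ζ s t z / G ζ s t) (Fin.cons x₂ x) (Fin.cons y₁ y) = D21 at *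
  generalize detOf (fun s t => F ζ s t z / G ζ s t) (Fin.cons x₂ x) (Fin.cons y₂ y) = D22 at *
  generalize G ζ x₁ y₁ = g11 at *
  generalize G ζ x₁ y₂ = g12 at *
  generalize G ζ x₂ y₁ = g21 at *
  generalize G ζ x₂ y₂ = g22 at *
  generalize ∏ j, G ζ x₁ (y j) = r1 at *
  generalize ∏ j, G ζ x₂ (y j) = r2 at *
  generalize ∏ i, G ζ (x i) y₁ = c1 at *
  generalize ∏ i, G ζ (x i) y₂ = c2 at *
  generalize ∏ i, ∏ j, G ζ (x i) (y j) = g0 at *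
  generalize ∏ k, (x k - x₁) = u1 at *
  generalize ∏ k, (x k - x₂) = u2 at *
  generalize ∏ k, (y k - y₁) = v1 at *
  generalize ∏ k, (y k - y₂) = v2 at *
  generalize vand x = vx at *
  generalize vand y = vy at *
  generalize x₂ - x₁ = dx at *
  generalize y₂ - y₁ = dy at *
  -- The Vandermonde products for `S_{n+2}` contain `x₂ - x₁` and `y₂ - y₁`; these are the only
  -- denominators that have to cancel against the left side.
  have e1 : dx * dx⁻¹ = 1 := mul_inv_cancel₀ (left_ne_zero_of_mul (left_ne_zero_of_mul hvx))
  have e2 : dy * dy⁻¹ = 1 := mul_inv_cancel₀ (left_ne_zero_of_mul (left_ne_zero_of_mul hvy))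
  linear_combination (g11 * g12 * g21 * g22 * r1 * r2 * c1 * c2 * g0 ^ 2 /
    (u1 * u2 * v1 * v2 * vx ^ 2 * vy ^ 2)) * (hJ + dy * dy⁻¹ * D2 * D0 * e1 + D2 * D0 * e2)

/-- The quadratic relation between `S_{n+2}`, `S_{n+1}` and `S_n`. -/
theorem dodgson {ζ : ℝ} (hζ0 : ζ ≠ 0) (hζ : ζ + 1 ≠ 0) (x₁ y₁ x₂ y₂ : ℝ) (x y : Fin n → ℝ)
    (z : ℝ) :
    (x₂ - x₁) * (y₂ - y₁) *
        valS (n + 2) ζ (Fin.cons x₁ (Fin.cons x₂ x)) (Fin.cons y₁ (Fin.cons y₂ y)) z *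
        valS n ζ x y z =
      G ζ x₁ y₂ * G ζ x₂ y₁ * valS (n + 1) ζ (Fin.cons x₁ x) (Fin.cons y₁ y) z *
          valS (n + 1) ζ (Fin.cons x₂ x) (Fin.cons y₂ y) z -
        G ζ x₁ y₁ * G ζ x₂ y₂ * valS (n + 1) ζ (Fin.cons x₁ x) (Fin.cons y₂ y) z *
          valS (n + 1) ζ (Fin.cons x₂ x) (Fin.cons y₁ y) z := by
  obtain ⟨e₀, he₀⟩ := exists_valS_ne_zero hζ0 hζ n
  have hd : Dense ({e : Pt (n + 2) | valS n ζ (fun i => e.1 i.succ.succ)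
      (fun i => e.2.1 i.succ.succ) e.2.2 ≠ 0} ∩ {e : Pt (n + 2) | Generic ζ e.1 e.2.1}) := by
    refine dense_ne_zero_inter (analyticOnNhd_valS ζ (fun k => analyticOnNhd_x _)
      (fun k => analyticOnNhd_y _) analyticOnNhd_z) ⟨(Fin.cons 0 (Fin.cons 0 e₀.1),
        Fin.cons 0 (Fin.cons 0 e₀.2.1), e₀.2.2), ?_⟩ (dense_generic _ hζ)
    simpa only [Fin.cons_succ] using he₀
  have hG : ∀ f g : Pt (n + 2) → ℝ, Continuous f → Continuous g →
      Continuous fun e => G ζ (f e) (g e) := by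
    intro f g hf hg
    unfold G
    fun_prop
  have hc : ∀ (f g : Pt (n + 2) → ℝ), Continuous f → Continuous g → Continuous fun e : Pt (n + 2) =>
      valS (n + 1) ζ (Fin.cons (f e) fun i => e.1 i.succ.succ)
        (Fin.cons (g e) fun i => e.2.1 i.succ.succ) e.2.2 := by
    intro f g hf hg
    exact continuous_valS ζ (by fun_prop) (by fun_prop) (by fun_prop)
  have := eq_of_dense_pt hd (f := fun e => (e.1 1 - e.1 0) * (e.2.1 1 - e.2.1 0) *
      valS (n + 2) ζ e.1 e.2.1 e.2.2 *
        valS n ζ (fun i => e.1 i.succ.succ) (fun i => e.2.1 i.succ.succ) e.2.2)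
    (g := fun e => G ζ (e.1 0) (e.2.1 1) * G ζ (e.1 1) (e.2.1 0) *
        valS (n + 1) ζ (Fin.cons (e.1 0) fun i => e.1 i.succ.succ)
          (Fin.cons (e.2.1 0) fun i => e.2.1 i.succ.succ) e.2.2 *
        valS (n + 1) ζ (Fin.cons (e.1 1) fun i => e.1 i.succ.succ)
          (Fin.cons (e.2.1 1) fun i => e.2.1 i.succ.succ) e.2.2 -
      G ζ (e.1 0) (e.2.1 0) * G ζ (e.1 1) (e.2.1 1) *
        valS (n + 1) ζ (Fin.cons (e.1 0) fun i => e.1 i.succ.succ)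
          (Fin.cons (e.2.1 1) fun i => e.2.1 i.succ.succ) e.2.2 *
        valS (n + 1) ζ (Fin.cons (e.1 1) fun i => e.1 i.succ.succ)
          (Fin.cons (e.2.1 0) fun i => e.2.1 i.succ.succ) e.2.2)
    (((by fun_prop : Continuous fun e : Pt (n + 2) => (e.1 1 - e.1 0) * (e.2.1 1 - e.2.1 0)).mul
      (continuous_valS ζ (by fun_prop) (by fun_prop) (by fun_prop))).mul
      (continuous_valS ζ (by fun_prop) (by fun_prop) (by fun_prop)))
    (((((hG _ _ (by fun_prop) (by fun_prop)).mul (hG _ _ (by fun_prop) (by fun_prop))).mul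
      (hc _ _ (by fun_prop) (by fun_prop))).mul (hc _ _ (by fun_prop) (by fun_prop))).sub
      ((((hG _ _ (by fun_prop) (by fun_prop)).mul (hG _ _ (by fun_prop) (by fun_prop))).mul
      (hc _ _ (by fun_prop) (by fun_prop))).mul (hc _ _ (by fun_prop) (by fun_prop))))
    ?_ (Fin.cons x₁ (Fin.cons x₂ x)) (Fin.cons y₁ (Fin.cons y₂ y)) z
  · exact this
  · rintro ⟨x, y, z⟩ ⟨hv, hg⟩
    have key : ∀ w : Fin (n + 2) → ℝ, w = Fin.cons (w 0) (Fin.cons (w 1) fun i => w i.succ.succ) := by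
      intro w
      ext i
      refine Fin.cases rfl (fun i => Fin.cases rfl (fun i => rfl) i) i
    simp only [Set.mem_ofPred_eq] at hv hg
    simp only
    have h2 : Generic ζ (Fin.cons (x 0) (Fin.cons (x 1) fun i => x i.succ.succ) : Fin (n + 2) → ℝ)
        (Fin.cons (y 0) (Fin.cons (y 1) fun i => y i.succ.succ)) := by
      rw [← key, ← key]; exact hg
    have h3 := dodgson_of_generic h2 hv
    rw [← key, ← key] at h3
    exact h3

end ThreeColour

/-! ### Symmetry of `S_n` in all variables. -/

namespace ThreeColour

variable {n : ℕ}

/-- The input for the symmetry of `S_2`: there the quadratic relation has only `S_1 = F` and `S_0 =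
1` besides `S_2`, and no variable left over on which to use induction. -/
theorem sub_mul_G_mul_F_cyclic (ζ x a b c : ℝ) :
    (b - c) * G ζ x a * F ζ x b c + (c - a) * G ζ x b * F ζ x c a +
      (a - b) * G ζ x c * F ζ x a b = 0 := by
  unfold F G; ring

theorem cons_cons_comp_swap {A : Type*} (w a : A) (y : Fin n → A) :
    (Fin.cons w (Fin.cons a y) : Fin (n + 2) → A) =
      (Fin.cons a (Fin.cons w y) : Fin (n + 2) → A) ∘ Equiv.swap 0 1 := by
  ext i
  refine Fin.cases ?_ (fun i => Fin.cases ?_ (fun i => ?_) i) i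
  · simp only [Function.comp_apply, Equiv.swap_apply_left]; rfl
  · simp only [Function.comp_apply, Fin.succ_zero_eq_one, Equiv.swap_apply_right]; rfl
  · rw [Function.comp_apply, Equiv.swap_apply_of_ne_of_ne (Fin.succ_ne_zero _)
      (by rw [← Fin.succ_zero_eq_one]; exact fun e => Fin.succ_ne_zero _ (Fin.succ_injective _ e))]
    rfl

theorem cons_cons_cons_comp_swap {A : Type*} (w a b : A) (y : Fin n → A) :
    (Fin.cons w (Fin.cons b (Fin.cons a y)) : Fin (n + 3) → A) =
      (Fin.cons a (Fin.cons b (Fin.cons w y)) : Fin (n + 3) → A) ∘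
        Equiv.swap 0 (Fin.succ (Fin.succ 0)) := by
  ext i
  refine Fin.cases ?_ (fun i => Fin.cases ?_ (fun i => Fin.cases ?_ (fun i => ?_) i) i) i
  · simp only [Function.comp_apply, Equiv.swap_apply_left]; rfl
  · rw [Function.comp_apply, Equiv.swap_apply_of_ne_of_ne (Fin.succ_ne_zero _)
      (fun e => (Fin.succ_ne_zero _) (Fin.succ_injective _ e).symm)]
    rfl
  · simp only [Function.comp_apply, Equiv.swap_apply_right]; rfl
  · rw [Function.comp_apply, Equiv.swap_apply_of_ne_of_ne (Fin.succ_ne_zero _)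
      (fun e => (Fin.succ_ne_zero _) (Fin.succ_injective _ (Fin.succ_injective _ e)))]
    rfl

section

variable {ζ : ℝ} (hζ0 : ζ ≠ 0) (hζ : ζ + 1 ≠ 0)
include hζ0 hζ

theorem valS_two_swap (x : Fin 2 → ℝ) (a w z : ℝ) :
    valS 2 ζ x (Fin.cons w (Fin.cons a Fin.elim0)) z =
      valS 2 ζ x (Fin.cons z (Fin.cons a Fin.elim0)) w := by
  have hd : Dense ({e : Pt 2 | e.1 1 - e.1 0 ≠ 0} ∩ ({e : Pt 2 | e.2.1 1 - e.2.1 0 ≠ 0} ∩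
      {e : Pt 2 | e.2.1 1 - e.2.2 ≠ 0})) :=
    dense_ne_zero_inter ((analyticOnNhd_x 1).sub (analyticOnNhd_x 0))
      ⟨(![0, 1], 0, 0), by simp⟩
    (dense_ne_zero_inter ((analyticOnNhd_y 1).sub (analyticOnNhd_y 0))
      ⟨(0, ![0, 1], 0), by simp⟩
    (dense_ne_zero ((analyticOnNhd_y 1).sub analyticOnNhd_z) ⟨(0, 0, 1), by simp⟩))
  refine eq_of_dense_pt (f := fun e => valS 2 ζ e.1 (Fin.cons (e.2.1 0) (Fin.cons (e.2.1 1)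
      Fin.elim0)) e.2.2)
    (g := fun e => valS 2 ζ e.1 (Fin.cons e.2.2 (Fin.cons (e.2.1 1) Fin.elim0)) (e.2.1 0)) hd
    (continuous_valS ζ (by fun_prop) (by fun_prop) (by fun_prop))
    (continuous_valS ζ (by fun_prop) (by fun_prop) (by fun_prop)) ?_ x
    (Fin.cons w (Fin.cons a Fin.elim0)) z
  rintro ⟨x, y, z⟩ ⟨hx, hy, hz⟩
  simp only [Set.mem_ofPred_eq] at hx hy hz
  simp only
  generalize y 0 = w at *
  generalize y 1 = a at *
  have hx' : x = Fin.cons (x 0) (Fin.cons (x 1) Fin.elim0) := by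
    ext i; fin_cases i <;> rfl
  have h1 := dodgson hζ0 hζ (x 0) w (x 1) a Fin.elim0 Fin.elim0 z
  have h2 := dodgson hζ0 hζ (x 0) z (x 1) a Fin.elim0 Fin.elim0 w
  simp only [← hx', valS_zero, valS_one, Fin.cons_zero, mul_one, Nat.reduceAdd] at h1 h2
  refine mul_left_cancel₀ (mul_ne_zero hx (mul_ne_zero hy hz)) ?_
  have c1 := sub_mul_G_mul_F_cyclic ζ (x 0) w a z
  have c2 := sub_mul_G_mul_F_cyclic ζ (x 1) w a z
  rw [F_swap ζ _ z w, F_swap ζ _ w a] at c1 c2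
  rw [F_swap ζ _ z w, F_swap ζ _ z w] at h2
  linear_combination (a - z) * h1 - (a - w) * h2 + G ζ (x 0) a * F ζ (x 0) w z * c2 -
    G ζ (x 1) a * F ζ (x 1) w z * c1

/-- Exchanging one `y` with `z` is the missing generator of the full symmetry. For `S_{n+3}`, apply
the quadratic relation with two other `y` distinguished: the factors `S_{n+2}` and `S_{n+1}` are
invariant under the exchange by induction, so `S_{n+3}` is invariant wherever `S_{n+1}` and the two
differences are nonzero, and everywhere by density. -/
theorem valS_cons_swap : ∀ (n : ℕ) (x : Fin (n + 1) → ℝ) (w : ℝ) (y : Fin n → ℝ) (z : ℝ),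
    valS (n + 1) ζ x (Fin.cons w y) z = valS (n + 1) ζ x (Fin.cons z y) w
  | 0, x, w, y, z => 
    (valS_one ζ x _ z).trans ((F_swap _ _ _ _).trans (valS_one ζ x (Fin.cons z y) w).symm)
  | 1, x, w, y, z => by
    have hy : y = Fin.cons (y 0) Fin.elim0 := by ext i; fin_cases i; rfl
    rw [hy]
    exact valS_two_swap hζ0 hζ x (y 0) w z
  | n + 2, x, w, y, z => by
    have ih1 := valS_cons_swap n
    have ih2 : ∀ (x : Fin (n + 1 + 1) → ℝ) (a w : ℝ) (y : Fin n → ℝ) (z : ℝ),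
        valS (n + 1 + 1) ζ x (Fin.cons a (Fin.cons w y)) z =
          valS (n + 1 + 1) ζ x (Fin.cons a (Fin.cons z y)) w := by
      intro x a w y z
      rw [cons_cons_comp_swap a w, cons_cons_comp_swap a z, valS_perm_right hζ,
        valS_perm_right hζ, valS_cons_swap (n + 1)]
    have hd : Dense ({e : Pt (n + 3) | e.1 1 - e.1 0 ≠ 0} ∩ ({e | e.2.1 1 - e.2.1 0 ≠ 0} ∩
        {e | valS (n + 1) ζ (fun i => e.1 i.succ.succ) (fun i => e.2.1 i.succ.succ) e.2.2 ≠ 0})) := by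
      obtain ⟨e₀, he₀⟩ := exists_valS_ne_zero hζ0 hζ (n + 1)
      refine dense_ne_zero_inter ((analyticOnNhd_x 1).sub (analyticOnNhd_x 0))
        ⟨(Fin.cons 0 fun _ => 1, 0, 0), ?_⟩
        (dense_ne_zero_inter ((analyticOnNhd_y 1).sub (analyticOnNhd_y 0))
        ⟨(0, Fin.cons 0 fun _ => 1, 0), ?_⟩
        (dense_ne_zero (analyticOnNhd_valS ζ (fun k => analyticOnNhd_x _)
          (fun k => analyticOnNhd_y _) analyticOnNhd_z) ⟨(Fin.cons 0 (Fin.cons 0 e₀.1),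
          Fin.cons 0 (Fin.cons 0 e₀.2.1), e₀.2.2), ?_⟩))
      · change (1 : ℝ) - 0 ≠ 0; norm_num
      · change (1 : ℝ) - 0 ≠ 0; norm_num
      · simpa only [Fin.cons_succ] using he₀
    have h3 : ∀ (x : Fin (n + 3) → ℝ) (a b w : ℝ) (y : Fin n → ℝ) (z : ℝ),
        valS (n + 3) ζ x (Fin.cons a (Fin.cons b (Fin.cons w y))) z =
          valS (n + 3) ζ x (Fin.cons a (Fin.cons b (Fin.cons z y))) w := by
      intro x a b w y z
      refine eq_of_dense_pt (f := fun e => valS (n + 3) ζ e.1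
        (Fin.cons (e.2.1 0) (Fin.cons (e.2.1 1) (Fin.cons (e.2.1 2)
          fun i => e.2.1 i.succ.succ.succ))) e.2.2)
        (g := fun e => valS (n + 3) ζ e.1 (Fin.cons (e.2.1 0) (Fin.cons (e.2.1 1)
          (Fin.cons e.2.2 fun i => e.2.1 i.succ.succ.succ))) (e.2.1 2)) hd
        (continuous_valS ζ (by fun_prop) (by fun_prop) (by fun_prop))
        (continuous_valS ζ (by fun_prop) (by fun_prop) (by fun_prop)) ?_ x
        (Fin.cons a (Fin.cons b (Fin.cons w y))) z
      rintro ⟨x, y, z⟩ ⟨hx, hy, hv⟩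
      simp only [Set.mem_ofPred_eq] at hx hy hv
      simp only
      have hx' : x = Fin.cons (x 0) (Fin.cons (x 1) fun i => x i.succ.succ) := by
        ext i
        refine Fin.cases rfl (fun i => Fin.cases rfl (fun i => rfl) i) i
      have hyt : (fun i : Fin (n + 1) => y i.succ.succ) =
          Fin.cons (y 2) fun i => y i.succ.succ.succ := by
        ext i
        refine Fin.cases rfl (fun i => rfl) i
      rw [hyt] at hv
      have hA := dodgson hζ0 hζ (x 0) (y 0) (x 1) (y 1) (fun i => x i.succ.succ)
        (Fin.cons (y 2) fun i => y i.succ.succ.succ) z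
      have hB := dodgson hζ0 hζ (x 0) (y 0) (x 1) (y 1) (fun i => x i.succ.succ)
        (Fin.cons z fun i => y i.succ.succ.succ) (y 2)
      rw [← hx'] at hA hB
      rw [ih2 _ (y 0) z _ (y 2), ih2 _ (y 1) z _ (y 2), ih2 _ (y 0) z _ (y 2),
        ih2 _ (y 1) z _ (y 2), ← hA, ih1 _ z _ (y 2)] at hB
      refine mul_left_cancel₀ (mul_ne_zero hx hy) (mul_right_cancel₀ hv hB.symm)
    have hy : y = Fin.cons (y 0) (Fin.cons (y 1) fun i => y i.succ.succ) := by
      ext i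
      refine Fin.cases rfl (fun i => Fin.cases rfl (fun i => rfl) i) i
    rw [hy, cons_cons_cons_comp_swap w, cons_cons_cons_comp_swap z, valS_perm_right hζ,
      valS_perm_right hζ]
    exact h3 _ _ _ _ _ _

theorem valS_update_right (x y : Fin n → ℝ) (z : ℝ) (j : Fin n) :
    valS n ζ x (Function.update y j z) (y j) = valS n ζ x y z := by
  obtain _ | n := n
  · exact j.elim0
  have h1 : y ∘ Equiv.swap 0 j = Fin.cons (y j) (Fin.tail (y ∘ Equiv.swap 0 j)) := by
    conv_lhs => rw [← Fin.cons_self_tail (y ∘ Equiv.swap 0 j)]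
    simp
  have h2 : Function.update y j z ∘ Equiv.swap 0 j =
      Fin.cons z (Fin.tail (y ∘ Equiv.swap 0 j)) := by
    ext i
    refine Fin.cases ?_ (fun i => ?_) i
    · simp
    · rw [Fin.cons_succ, Fin.tail, Function.comp_apply, Function.comp_apply,
        Function.update_of_ne]
      intro h
      rw [Equiv.swap_apply_eq_iff, Equiv.swap_apply_right] at h
      exact Fin.succ_ne_zero _ h
  rw [← valS_perm_right hζ (Equiv.swap 0 j) x (Function.update y j z), h2,
    ← valS_perm_right hζ (Equiv.swap 0 j) x y, h1]
  exact valS_cons_swap hζ0 hζ _ _ _ _ _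

theorem valS_update_left (x y : Fin n → ℝ) (z : ℝ) (j : Fin n) :
    valS n ζ (Function.update x j z) y (x j) = valS n ζ x y z := by
  rw [valS_symm hζ, valS_update_right hζ0 hζ, valS_symm hζ]

theorem evalS_comp_swap_last (v : Fin (2 * n + 1) → ℝ) (i : Fin (2 * n + 1)) :
    evalS n ζ (v ∘ Equiv.swap i (Fin.last (2 * n))) = evalS n ζ v := by
  have e : ∀ v, evalS n ζ v = valS n ζ (xs v) (ys v) (zl v) := fun v => by rw [valS, slots_eta]
  rw [e, e]
  by_cases h1 : (i : ℕ) < n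
  · rw [← valS_update_left hζ0 hζ (xs v) (ys v) (zl v) ⟨i, h1⟩]
    congr 1
    · ext k
      simp only [xs, Function.comp_apply, Function.update_apply, Fin.ext_iff]
      split_ifs with h
      · rw [show (⟨k, by omega⟩ : Fin (2 * n + 1)) = i from Fin.ext h, Equiv.swap_apply_left]; rfl
      · rw [Equiv.swap_apply_of_ne_of_ne]
        · simpa [Fin.ext_iff] using h
        · simp [Fin.ext_iff]; omega
    · ext k
      simp only [ys, Function.comp_apply]
      rw [Equiv.swap_apply_of_ne_of_ne]
      · simp [Fin.ext_iff]; omega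
      · simp [Fin.ext_iff]; omega
    · simp [zl, xs]
  by_cases h2 : (i : ℕ) < 2 * n
  · rw [← valS_update_right hζ0 hζ (xs v) (ys v) (zl v) ⟨i - n, by omega⟩]
    congr 1
    · ext k
      simp only [xs, Function.comp_apply]
      rw [Equiv.swap_apply_of_ne_of_ne]
      · simp [Fin.ext_iff]; omega
      · simp [Fin.ext_iff]; omega
    · ext k
      simp only [ys, Function.comp_apply, Function.update_apply, Fin.ext_iff]
      split_ifs with h
      · rw [show (⟨n + k, by omega⟩ : Fin (2 * n + 1)) = i from Fin.ext (by simp; omega),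
          Equiv.swap_apply_left]; rfl
      · rw [Equiv.swap_apply_of_ne_of_ne]
        · simp [Fin.ext_iff]; omega
        · simp [Fin.ext_iff]; omega
    · simp only [zl, ys, Function.comp_apply, Equiv.swap_apply_right]
      congr 1; ext; simp; omega
  · have : i = Fin.last (2 * n) := Fin.ext (by simp; omega)
    subst this
    simp

/-- `S_n` is symmetric in all its `2n+1` variables. -/
theorem evalS_comp_perm (σ : Equiv.Perm (Fin (2 * n + 1))) (v : Fin (2 * n + 1) → ℝ) :
    evalS n ζ (v ∘ σ) = evalS n ζ v := by
  induction σ using Equiv.Perm.swap_induction_on generalizing v with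
  | one => rfl
  | swap_mul f i j hij ih =>
    rw [Equiv.Perm.coe_mul, ← Function.comp_assoc, ih]
    by_cases hi : i = Fin.last (2 * n)
    · subst hi
      rw [Equiv.swap_comm, evalS_comp_swap_last hζ0 hζ]
    by_cases hj : j = Fin.last (2 * n)
    · subst hj
      rw [evalS_comp_swap_last hζ0 hζ]
    -- The transposition of `i` and `j` is conjugate, under the transposition of `i` and the last
    -- position, to that of `j` and the last position.
    have h := Equiv.swap_mul_swap_mul_swap (x := j) (y := Fin.last (2 * n)) (z := i) hj hij.symm
    rw [← h, Equiv.swap_comm _ i, Equiv.Perm.coe_mul, Equiv.Perm.coe_mul, ← Function.comp_assoc, ← Function.comp_assoc,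
      evalS_comp_swap_last hζ0 hζ, evalS_comp_swap_last hζ0 hζ, evalS_comp_swap_last hζ0 hζ]

end

end ThreeColour

/-! ### `S_n` as a function of multisets. -/

namespace ThreeColour

variable {n : ℕ}

theorem exists_perm_of_map_univ_eq {α β : Type*} [Fintype α] [DecidableEq β] {f g : α → β}
    (h : Finset.univ.val.map f = Finset.univ.val.map g) : ∃ σ : Equiv.Perm α, f = g ∘ σ := by
  have hc : ∀ b, Nonempty ({a // f a = b} ≃ {a // g a = b}) := by
    intro b
    refine Fintype.card_eq.1 ?_
    have := congrArg (Multiset.count b) h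
    rw [Multiset.count_map, Multiset.count_map] at this
    rw [Fintype.card_subtype, Fintype.card_subtype]
    simpa [Finset.card_def, Finset.filter_val, eq_comm] using this
  exact ⟨Equiv.ofFiberEquiv fun b => (hc b).some,
    funext fun a => (Equiv.ofFiberEquiv_map (fun b => (hc b).some) a).symm⟩

open Classical in
/-- The value of the symmetric polynomial `S_n` at a multiset with `2n+1` elements. -/
noncomputable def evalM (n : ℕ) (ζ : ℝ) (m : Multiset ℝ) : ℝ :=
  if h : ∃ v : Fin (2 * n + 1) → ℝ, Finset.univ.val.map v = m then evalS n ζ h.choose else 0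

/-- Two lists with the same multiset differ by a permutation, so the full symmetry makes the chosen
list irrelevant. -/
theorem evalM_map {ζ : ℝ} (hζ0 : ζ ≠ 0) (hζ : ζ + 1 ≠ 0) (v : Fin (2 * n + 1) → ℝ) :
    evalM n ζ (Finset.univ.val.map v) = evalS n ζ v := by
  have h : ∃ w : Fin (2 * n + 1) → ℝ, Finset.univ.val.map w = Finset.univ.val.map v := ⟨v, rfl⟩
  rw [evalM, dif_pos h]
  obtain ⟨σ, hσ⟩ := exists_perm_of_map_univ_eq h.choose_spec
  rw [hσ, evalS_comp_perm hζ0 hζ]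

theorem map_univ_slots (x y : Fin n → ℝ) (z : ℝ) :
    Finset.univ.val.map (slots x y z) =
      Finset.univ.val.map x + Finset.univ.val.map y + {z} := by
  have : List.ofFn (slots x y z) = List.ofFn x ++ List.ofFn y ++ [z] := by
    refine List.ext_getElem (by simp; omega) fun i h1 h2 => ?_
    simp only [List.getElem_ofFn, slots, List.getElem_append, List.length_append, List.length_ofFn,
      List.getElem_singleton]
    split_ifs <;> first | rfl | omega
  rw [Fin.univ_val_map, Fin.univ_val_map, Fin.univ_val_map, this]
  rfl

theorem map_univ_cons (a : ℝ) (x : Fin n → ℝ) :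
    Finset.univ.val.map (Fin.cons a x : Fin (n + 1) → ℝ) = a ::ₘ Finset.univ.val.map x := by
  rw [Fin.univ_val_map, Fin.univ_val_map, List.ofFn_cons]
  rfl

theorem evalM_slots {ζ : ℝ} (hζ0 : ζ ≠ 0) (hζ : ζ + 1 ≠ 0) (x y : Fin n → ℝ) (z : ℝ) :
    evalM n ζ (Finset.univ.val.map x + Finset.univ.val.map y + {z}) = valS n ζ x y z := by
  rw [← map_univ_slots, evalM_map hζ0 hζ, valS]

theorem exists_map_univ_eq {k : ℕ} (m : Multiset ℝ) (hm : m.card = k) :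
    ∃ v : Fin k → ℝ, Finset.univ.val.map v = m := by
  obtain ⟨l, rfl⟩ : ∃ l : List ℝ, (l : Multiset ℝ) = m := Quot.exists_rep m
  rw [Multiset.coe_card] at hm
  subst hm
  exact ⟨l.get, by rw [Fin.univ_val_map, List.ofFn_get]⟩

theorem exists_slots_eq (m : Multiset ℝ) (hm : m.card = 2 * n + 1) :
    ∃ (x y : Fin n → ℝ) (z : ℝ), m = Finset.univ.val.map x + Finset.univ.val.map y + {z} := by
  obtain ⟨v, rfl⟩ := exists_map_univ_eq m hm
  exact ⟨xs v, ys v, zl v, by rw [← map_univ_slots, slots_eta]⟩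

theorem evalM_dodgson {ζ : ℝ} (hζ0 : ζ ≠ 0) (hζ : ζ + 1 ≠ 0) (x₁ x₂ y₁ y₂ : ℝ) (m : Multiset ℝ)
    (hm : m.card = 2 * n + 1) :
    (x₂ - x₁) * (y₂ - y₁) * evalM (n + 2) ζ (x₁ ::ₘ x₂ ::ₘ y₁ ::ₘ y₂ ::ₘ m) * evalM n ζ m =
      G ζ x₁ y₂ * G ζ x₂ y₁ * evalM (n + 1) ζ (x₁ ::ₘ y₁ ::ₘ m) *
          evalM (n + 1) ζ (x₂ ::ₘ y₂ ::ₘ m) -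
        G ζ x₁ y₁ * G ζ x₂ y₂ * evalM (n + 1) ζ (x₁ ::ₘ y₂ ::ₘ m) *
          evalM (n + 1) ζ (x₂ ::ₘ y₁ ::ₘ m) := by
  obtain ⟨x, y, z, rfl⟩ := exists_slots_eq m hm
  have h1 : ∀ s t : ℝ, evalM (n + 1) ζ
      (s ::ₘ t ::ₘ (Finset.univ.val.map x + Finset.univ.val.map y + {z})) =
      valS (n + 1) ζ (Fin.cons s x) (Fin.cons t y) z := by
    intro s t
    rw [← evalM_slots hζ0 hζ, map_univ_cons, map_univ_cons]
    congr 1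
    simp only [← Multiset.singleton_add]
    abel
  have h2 : evalM (n + 2) ζ (x₁ ::ₘ x₂ ::ₘ y₁ ::ₘ y₂ ::ₘ
      (Finset.univ.val.map x + Finset.univ.val.map y + {z})) =
      valS (n + 2) ζ (Fin.cons x₁ (Fin.cons x₂ x)) (Fin.cons y₁ (Fin.cons y₂ y)) z := by
    rw [← evalM_slots hζ0 hζ, map_univ_cons, map_univ_cons, map_univ_cons, map_univ_cons]
    congr 1
    simp only [← Multiset.singleton_add]
    abel
  rw [h1, h1, h1, h1, h2, evalM_slots hζ0 hζ]
  exact dodgson hζ0 hζ _ _ _ _ _ _ _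

theorem evalM_zero_cons {ζ : ℝ} (hζ0 : ζ ≠ 0) (hζ : ζ + 1 ≠ 0) (m : Multiset ℝ)
    (hm : m.card = 2 * n + 1) :
    evalM (n + 1) ζ (0 ::ₘ (2 * ζ + 1) ::ₘ m) =
      (-2 * ζ) ^ (n + 1) * (ζ + 1) ^ (2 * n + 1) * m.prod * evalM n ζ m := by
  obtain ⟨x, y, z, rfl⟩ := exists_slots_eq m hm
  have h1 : ∀ s t : ℝ, evalM (n + 1) ζ
      (s ::ₘ t ::ₘ (Finset.univ.val.map x + Finset.univ.val.map y + {z})) =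
      valS (n + 1) ζ (Fin.cons s x) (Fin.cons t y) z := by
    intro s t
    rw [← evalM_slots hζ0 hζ, map_univ_cons, map_univ_cons]
    congr 1
    simp only [← Multiset.singleton_add]
    abel
  rw [h1, valS_cons_zero, evalM_slots hζ0 hζ]
  simp only [Finset.prod_mul_distrib, Finset.prod_const, Multiset.prod_add,
    Multiset.prod_singleton, Finset.card_univ, Fintype.card_fin, Finset.prod_map_val]
  have : (-2 * ζ) ^ n = (-ζ) ^ n * 2 ^ n := by rw [← mul_pow]; ring
  rw [pow_succ (-2 * ζ), this, pow_succ (ζ + 1) (2 * n), pow_mul]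
  ring

/-! ### The inversion `ζ ↦ 1/ζ`, `x ↦ 1/x`. -/

section Inversion

variable {ζ : ℝ}

theorem F_inv (hζ0 : ζ ≠ 0) {x y z : ℝ} (hx : x ≠ 0) (hy : y ≠ 0) (hz : z ≠ 0) :
    F ζ x y z = ζ ^ 2 * x * y * z * F ζ⁻¹ x⁻¹ y⁻¹ z⁻¹ := by
  unfold F; field_simp; ring

theorem G_inv (hζ0 : ζ ≠ 0) {x y : ℝ} (hx : x ≠ 0) (hy : y ≠ 0) :
    G ζ x y = ζ ^ 2 * x ^ 2 * y ^ 2 * G ζ⁻¹ x⁻¹ y⁻¹ := by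
  unfold G; field_simp; ring

theorem vand_inv : ∀ (n : ℕ) (x : Fin n → ℝ), (∀ i, x i ≠ 0) →
    (∏ i, x i) ^ (n - 1) * vand (fun i => (x i)⁻¹) = (-1) ^ n.choose 2 * vand x
  | 0, x, hx => by simp [vand]
  | n + 1, x, hx => by
    have ih := vand_inv n (fun i => x i.succ) fun i => hx _
    have e1 : x = Fin.cons (x 0) fun i => x i.succ := (Fin.cons_self_tail x).symm
    have e2 : (fun i => (x i)⁻¹) = (Fin.cons (x 0)⁻¹ fun i => (x i.succ)⁻¹ : Fin (n + 1) → ℝ) :=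
      (Fin.cons_self_tail fun i => (x i)⁻¹).symm
    rw [e2, vand_cons, e1, vand_cons, ← e1, Fin.prod_univ_succ, Nat.add_sub_cancel]
    have h3 : ∏ k : Fin n, ((x k.succ)⁻¹ - (x 0)⁻¹) * (x 0 * x k.succ) =
        ∏ k : Fin n, (-1) * (x k.succ - x 0) := by
      refine Finset.prod_congr rfl fun k _ => ?_
      have := hx 0
      have := hx k.succ
      field_simp
      ring
    simp only [Finset.prod_mul_distrib, Finset.prod_const, Finset.card_univ,
      Fintype.card_fin] at h3
    rw [Nat.choose_succ_succ' n 1, Nat.choose_one_right, pow_add]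
    rcases n with _ | n
    · simp [vand]
    · rw [Nat.add_sub_cancel] at ih
      rw [mul_pow, pow_succ (∏ i : Fin (n + 1), x i.succ)]
      linear_combination (∏ i : Fin (n + 1), x i.succ) ^ n *
        vand (fun i : Fin (n + 1) => (x i.succ)⁻¹) * h3 +
        (-1) ^ (n + 1) * (∏ k : Fin (n + 1), (x k.succ - x 0)) * ih

/-- Inversion multiplies each entry `F/G` by a factor `z/(xy)`, which leaves the determinant through
rows and columns; the product of the `G` and the Vandermonde products change by monomials and signs,
and the two signs cancel. -/
theorem valS_inv_of_generic (hζ0 : ζ ≠ 0) {x y : Fin n → ℝ} {z : ℝ} (h : Generic ζ x y)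
    (hx : ∀ i, x i ≠ 0) (hy : ∀ i, y i ≠ 0) (hz : z ≠ 0) :
    valS n ζ x y z = ζ ^ (2 * n ^ 2) * (∏ i, x i) ^ n * (∏ i, y i) ^ n * z ^ n *
      valS n ζ⁻¹ (fun i => (x i)⁻¹) (fun i => (y i)⁻¹) z⁻¹ := by
  have hg : Generic ζ⁻¹ (fun i => (x i)⁻¹) (fun i => (y i)⁻¹) := by
    refine ⟨inv_injective.comp h.1, inv_injective.comp h.2.1, fun i j h0 => h.2.2 i j ?_⟩
    rw [G_inv hζ0 (hx i) (hy j), h0, mul_zero]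
  by_cases hn : n = 0
  · subst hn; simp [valS_zero]
  have hX : ∏ i, x i ≠ 0 := Finset.prod_ne_zero_iff.2 fun i _ => hx i
  have hY : ∏ i, y i ≠ 0 := Finset.prod_ne_zero_iff.2 fun i _ => hy i
  rw [valS_eq_of_generic h, valS_eq_of_generic hg]
  have h1 : ∏ i, ∏ j, G ζ (x i) (y j) = ζ ^ (2 * n ^ 2) * (∏ i, x i) ^ (2 * n) *
      (∏ i, y i) ^ (2 * n) * ∏ i, ∏ j, G ζ⁻¹ (x i)⁻¹ (y j)⁻¹ := by
    simp only [fun i j => G_inv hζ0 (hx i) (hy j), Finset.prod_mul_distrib, Finset.prod_const,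
      Finset.card_univ, Fintype.card_fin, Finset.prod_pow]
    ring
  have h2 : (∏ i, x i) * (∏ i, y i) * detOf (fun s t => F ζ s t z / G ζ s t) x y =
      z ^ n * detOf (fun s t => F ζ⁻¹ s t z⁻¹ / G ζ⁻¹ s t) (fun i => (x i)⁻¹)
        (fun i => (y i)⁻¹) := by
    have e : (Matrix.of fun i j : Fin n => F ζ (x i) (y j) z / G ζ (x i) (y j)) =
        z • Matrix.of fun i j : Fin n => (x i)⁻¹ * (Matrix.of fun i j : Fin n => (y j)⁻¹ *
          (Matrix.of fun i j : Fin n => F ζ⁻¹ (x i)⁻¹ (y j)⁻¹ z⁻¹ / G ζ⁻¹ (x i)⁻¹ (y j)⁻¹) i j)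
          i j := by
      ext i j
      have hgij := hg.2.2 i j
      have hxi := hx i
      have hyj := hy j
      simp only [Matrix.smul_apply, Matrix.of_apply, smul_eq_mul]
      rw [F_inv hζ0 hxi hyj hz, G_inv hζ0 hxi hyj]
      field_simp
    rw [detOf, e, Matrix.det_smul, Matrix.det_mul_column, Matrix.det_mul_row, detOf,
      Fintype.card_fin, Finset.prod_inv_distrib, Finset.prod_inv_distrib]
    field_simp
  have h3 := vand_inv n x hx
  have h4 := vand_inv n y hy
  have hvx := vand_ne_zero h.1
  have hvy := vand_ne_zero h.2.1
  have hvx' := vand_ne_zero hg.1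
  have hvy' := vand_ne_zero hg.2.1
  generalize vand (fun i => (x i)⁻¹) = vx' at *
  generalize vand (fun i => (y i)⁻¹) = vy' at *
  have hs : ((-1 : ℝ) ^ n.choose 2) * (-1) ^ n.choose 2 = 1 := by
    rw [← pow_add, ← two_mul, pow_mul]; simp
  have h5 : vand x * vand y = (∏ i, x i) ^ (n - 1) * (∏ i, y i) ^ (n - 1) * (vx' * vy') := by
    linear_combination (-(vand x * vand y)) * hs - (-1) ^ n.choose 2 * vand y * h3 -
      (∏ i, x i) ^ (n - 1) * vx' * h4
  rw [h5, h1]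
  generalize detOf (fun s t => F ζ s t z / G ζ s t) x y = D at *
  generalize detOf (fun s t => F ζ⁻¹ s t z⁻¹ / G ζ⁻¹ s t) (fun i => (x i)⁻¹)
        (fun i => (y i)⁻¹) = D' at *
  generalize ∏ i, ∏ j, G ζ⁻¹ (x i)⁻¹ (y j)⁻¹ = g at *
  generalize ∏ i, x i = X at *
  generalize ∏ i, y i = Y at *
  obtain ⟨m, hm⟩ : ∃ m, n = m + 1 := ⟨n - 1, by omega⟩
  rw [hm] at h2
  rw [hm, Nat.add_sub_cancel]
  field_simp
  linear_combination (g * X ^ (2 * m + 1) * Y ^ (2 * m + 1)) * h2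

theorem valS_inv (hζ0 : ζ ≠ 0) (hζ : ζ + 1 ≠ 0) {x y : Fin n → ℝ} {z : ℝ}
    (hx : ∀ i, x i ≠ 0) (hy : ∀ i, y i ≠ 0) (hz : z ≠ 0) :
    valS n ζ x y z = ζ ^ (2 * n ^ 2) * (∏ i, x i) ^ n * (∏ i, y i) ^ n * z ^ n *
      valS n ζ⁻¹ (fun i => (x i)⁻¹) (fun i => (y i)⁻¹) z⁻¹ := by
  have hd : Dense ({e : Pt n | ∏ k, e.1 k ≠ 0} ∩ ({e : Pt n | ∏ k, e.2.1 k ≠ 0} ∩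
      ({e : Pt n | e.2.2 ≠ 0} ∩ {e : Pt n | Generic ζ e.1 e.2.1}))) :=
    dense_ne_zero_inter (Finset.analyticOnNhd_fun_prod _ fun k _ => analyticOnNhd_x k)
      ⟨(1, 0, 0), by simp⟩
    (dense_ne_zero_inter (Finset.analyticOnNhd_fun_prod _ fun k _ => analyticOnNhd_y k)
      ⟨(0, 1, 0), by simp⟩
    (dense_ne_zero_inter analyticOnNhd_z ⟨(0, 0, 1), one_ne_zero⟩ (dense_generic n hζ)))
  refine eq_of_dense (X := Pt n) (f := fun e => valS n ζ e.1 e.2.1 e.2.2)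
    (g := fun e => ζ ^ (2 * n ^ 2) * (∏ i, e.1 i) ^ n * (∏ i, e.2.1 i) ^ n * e.2.2 ^ n *
      valS n ζ⁻¹ (fun i => (e.1 i)⁻¹) (fun i => (e.2.1 i)⁻¹) e.2.2⁻¹) (e := (x, y, z)) hd ?_
    (continuous_valS ζ (by fun_prop) (by fun_prop) (by fun_prop)).continuousAt ?_
  · rintro ⟨x, y, z⟩ ⟨hx, hy, hz, hg⟩
    simp only [Set.mem_ofPred_eq, Finset.prod_ne_zero_iff, Finset.mem_univ, true_imp_iff]
      at hx hy hz hg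
    exact valS_inv_of_generic hζ0 hg hx hy hz
  · refine ContinuousAt.mul (Continuous.continuousAt (by fun_prop)) ?_
    refine (continuous_evalS n ζ⁻¹).continuousAt.comp (continuousAt_pi.2 fun k => ?_)
    simp only [slots]
    split_ifs with h h'
    · exact ContinuousAt.inv₀ (Continuous.continuousAt (by fun_prop)) (hx _)
    · exact ContinuousAt.inv₀ (Continuous.continuousAt (by fun_prop)) (hy _)
    · exact ContinuousAt.inv₀ (Continuous.continuousAt (by fun_prop)) hz

theorem evalM_inv (hζ0 : ζ ≠ 0) (hζ : ζ + 1 ≠ 0) (m : Multiset ℝ) (hm : m.card = 2 * n + 1)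
    (h0 : (0 : ℝ) ∉ m) :
    evalM n ζ m = ζ ^ (2 * n ^ 2) * m.prod ^ n * evalM n ζ⁻¹ (m.map fun t => t⁻¹) := by
  have hζ' : ζ⁻¹ + 1 ≠ 0 := by
    intro h
    apply hζ
    field_simp at h
    linarith
  obtain ⟨x, y, z, rfl⟩ := exists_slots_eq m hm
  simp only [Multiset.mem_add, Multiset.mem_map, Multiset.mem_singleton, not_or, not_exists,
    not_and] at h0
  obtain ⟨⟨hx, hy⟩, hz⟩ := h0
  rw [evalM_slots hζ0 hζ, valS_inv hζ0 hζ (fun i => hx i (Finset.mem_univ i))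
    (fun i => hy i (Finset.mem_univ i)) (Ne.symm hz), Multiset.map_add, Multiset.map_add,
    Multiset.map_map, Multiset.map_map, Multiset.map_singleton]
  have h := evalM_slots (inv_ne_zero hζ0) hζ' (fun i => (x i)⁻¹) (fun i => (y i)⁻¹) z⁻¹
  simp only [Function.comp_def]
  rw [h]
  simp only [Multiset.prod_add, Multiset.prod_singleton, Finset.prod_map_val]
  ring

end Inversion

end ThreeColour

/-! ### Special values and the three-term recurrence. -/

namespace ThreeColour

variable {n : ℕ}

/-- The multiset consisting of `i` copies of `2ζ+1` and `j` copies of `ζ/(ζ+2)`. -/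
noncomputable def specials (ζ : ℝ) (i j : ℕ) : Multiset ℝ :=
  Multiset.replicate i (2 * ζ + 1) + Multiset.replicate j (ζ / (ζ + 2))

theorem card_specials (ζ : ℝ) (i j : ℕ) : (specials ζ i j).card = i + j := by
  simp [specials]

theorem prod_specials (ζ : ℝ) (i j : ℕ) :
    (specials ζ i j).prod = (2 * ζ + 1) ^ i * (ζ / (ζ + 2)) ^ j := by
  simp [specials]

theorem cons_specials_left (ζ : ℝ) (i j : ℕ) :
    (2 * ζ + 1) ::ₘ specials ζ i j = specials ζ (i + 1) j := by
  simp [specials, Multiset.replicate_succ]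

theorem cons_specials_right (ζ : ℝ) (i j : ℕ) :
    (ζ / (ζ + 2)) ::ₘ specials ζ i j = specials ζ i (j + 1) := by
  simp [specials, Multiset.replicate_succ]

theorem map_inv_specials {ζ : ℝ} (hζ0 : ζ ≠ 0) (h1 : 2 * ζ + 1 ≠ 0) (i j : ℕ) :
    (specials ζ i j).map (fun t => t⁻¹) = specials ζ⁻¹ j i := by
  have e1 : (2 * ζ + 1)⁻¹ = ζ⁻¹ / (ζ⁻¹ + 2) := by
    have : 1 + 2 * ζ ≠ 0 := by rwa [add_comm]
    have e : ζ⁻¹ + 2 = (1 + 2 * ζ) / ζ := by field_simp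
    rw [e, add_comm]
    field_simp
  have e2 : (ζ / (ζ + 2))⁻¹ = 2 * ζ⁻¹ + 1 := by
    field_simp
    ring
  rw [specials, Multiset.map_add, Multiset.map_replicate, Multiset.map_replicate, e1, e2, specials,
    add_comm]

theorem not_mem_specials {ζ : ℝ} (hζ0 : ζ ≠ 0) (h2 : ζ + 2 ≠ 0) (h1 : 2 * ζ + 1 ≠ 0)
    (i j : ℕ) :
    (0 : ℝ) ∉ specials ζ i j := by
  intro h
  rcases Multiset.mem_add.1 h with h | h
  · exact h1 (Multiset.eq_of_mem_replicate h).symm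
  · exact div_ne_zero hζ0 h2 (Multiset.eq_of_mem_replicate h).symm

/-- The value of `S_n` at `x`, `n` copies of `2ζ+1` and `n` copies of `ζ/(ζ+2)`. -/
noncomputable def valT (n : ℕ) (ζ x : ℝ) : ℝ := evalM n ζ (x ::ₘ specials ζ n n)

/-- The value of `S_n` at `n+1` copies of `2ζ+1` and `n` copies of `ζ/(ζ+2)`. -/
noncomputable def valA (n : ℕ) (ζ : ℝ) : ℝ := evalM n ζ (specials ζ (n + 1) n)

/-- The value of `S_n` at `n` copies of `2ζ+1` and `n+1` copies of `ζ/(ζ+2)`. -/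
noncomputable def valB (n : ℕ) (ζ : ℝ) : ℝ := evalM n ζ (specials ζ n (n + 1))

theorem valT_left (n : ℕ) (ζ : ℝ) : valT n ζ (2 * ζ + 1) = valA n ζ := by
  rw [valT, cons_specials_left, valA]

theorem valT_right (n : ℕ) (ζ : ℝ) : valT n ζ (ζ / (ζ + 2)) = valB n ζ := by
  rw [valT, cons_specials_right, valB]

theorem G_special_right {ζ : ℝ} (h2 : ζ + 2 ≠ 0) (y : ℝ) :
    G ζ (ζ / (ζ + 2)) y = 2 * (ζ + 1) ^ 2 * (ζ / (ζ + 2)) ^ 2 := by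
  unfold G; field_simp; ring

section

variable {ζ : ℝ} (hζ0 : ζ ≠ 0) (hζ : ζ + 1 ≠ 0)
include hζ0 hζ

theorem analyticOnNhd_evalM_cons (m : Multiset ℝ) (hm : m.card = 2 * n) :
    AnalyticOnNhd ℝ (fun x => evalM n ζ (x ::ₘ m)) Set.univ := by
  obtain ⟨w, rfl⟩ := exists_map_univ_eq m hm
  have h : ∀ x : ℝ, evalM n ζ (x ::ₘ Finset.univ.val.map w) =
      evalS n ζ (Fin.cons x w : Fin (2 * n + 1) → ℝ) := by
    intro x
    rw [← evalM_map hζ0 hζ, map_univ_cons]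
  simp only [h]
  refine analyticOnNhd_evalS ζ fun k => ?_
  refine Fin.cases ?_ (fun k => ?_) k
  · exact analyticOnNhd_id
  · simpa only [Fin.cons_succ] using analyticOnNhd_const

theorem analyticOnNhd_valT (n : ℕ) : AnalyticOnNhd ℝ (valT n ζ) Set.univ :=
  analyticOnNhd_evalM_cons hζ0 hζ _ (by rw [card_specials]; ring)

theorem continuous_valT (n : ℕ) : Continuous (valT n ζ) :=
  continuousOn_univ.1 (analyticOnNhd_valT hζ0 hζ n).continuousOn

theorem valT_zero (x : ℝ) : valT 0 ζ x = 1 := by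
  have h := evalM_slots hζ0 hζ (Fin.elim0 : Fin 0 → ℝ) Fin.elim0 x
  rw [valS_zero] at h
  simpa [valT, specials] using h

theorem valT_one (h2 : ζ + 2 ≠ 0) (x : ℝ) :
    valT 1 ζ x = -2 * ζ * (ζ + 1) / (ζ + 2) * (x + ζ) := by
  have h := evalM_slots hζ0 hζ (fun _ : Fin 1 => 2 * ζ + 1) (fun _ => ζ / (ζ + 2)) x
  rw [valS_one] at h
  have e : (Finset.univ.val.map (fun _ : Fin 1 => 2 * ζ + 1) +
      Finset.univ.val.map (fun _ : Fin 1 => ζ / (ζ + 2)) + {x} : Multiset ℝ) =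
      x ::ₘ specials ζ 1 1 := by
    rw [add_comm, Multiset.singleton_add]
    simp [specials]
  rw [valT, ← e, h]
  unfold F
  field_simp
  ring

theorem valT_succ_zero (n : ℕ) :
    valT (n + 1) ζ 0 = (-2 * ζ) ^ (n + 1) * (ζ + 1) ^ (2 * n + 1) *
      ((2 * ζ + 1) ^ n * (ζ / (ζ + 2)) ^ (n + 1)) * valB n ζ := by
  rw [valT, ← cons_specials_left, evalM_zero_cons hζ0 hζ _ (by rw [card_specials]; ring),
    prod_specials, valB]

theorem valT_inv (h2 : ζ + 2 ≠ 0) (h1 : 2 * ζ + 1 ≠ 0) (n : ℕ) {x : ℝ} (hx : x ≠ 0) :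
    valT n ζ x = ζ ^ (2 * n ^ 2) * (x * ((2 * ζ + 1) ^ n * (ζ / (ζ + 2)) ^ n)) ^ n *
      valT n ζ⁻¹ x⁻¹ := by
  rw [valT, evalM_inv hζ0 hζ, Multiset.prod_cons, prod_specials, Multiset.map_cons,
    map_inv_specials hζ0 h1, valT]
  · rw [Multiset.card_cons, card_specials]; ring
  · rw [Multiset.mem_cons, not_or]
    exact ⟨hx.symm, not_mem_specials hζ0 h2 h1 n n⟩

theorem valA_inv (h2 : ζ + 2 ≠ 0) (h1 : 2 * ζ + 1 ≠ 0) (n : ℕ) :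
    valA n ζ = ζ ^ (2 * n ^ 2) * ((2 * ζ + 1) ^ (n + 1) * (ζ / (ζ + 2)) ^ n) ^ n *
      valB n ζ⁻¹ := by
  rw [valA, evalM_inv hζ0 hζ, prod_specials, map_inv_specials hζ0 h1, valB]
  · rw [card_specials]; ring
  · exact not_mem_specials hζ0 h2 h1 _ _

/-- Let `U` and `V` be the values of `S_{n+1}` at `x` together with `a` repeated `n+2` times and `b`
repeated `n` times, or the reverse. The first instance of the quadratic relation contains `UV`, the
second contains `V` and the third `U`, both linearly. Eliminating `U` and `V` also removes the terms
with `T_{n+1}²`, and `T_{n+2}(x)` becomes a common factor. -/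
theorem valT_three_term_mul (h2 : ζ + 2 ≠ 0) (n : ℕ) (x a b κ : ℝ) (ha : a = 2 * ζ + 1)
    (hb : b = ζ / (ζ + 2)) (hκ : κ = 2 * (ζ + 1) ^ 2) :
    ((b - a) ^ 2 * κ ^ 2 * b ^ 2 * x ^ 2 * valA (n + 1) ζ * valB (n + 1) ζ * valT n ζ x) *
        valT (n + 2) ζ x =
      (-(x - a) * (x - b) * (b - a) ^ 2 * valA n ζ * valB n ζ * valT (n + 2) ζ x +
        κ ^ 2 * b ^ 2 * (b - a) * ((x - a) * valB n ζ * x ^ 2 * valA (n + 1) ζ -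
          (x - b) * valA n ζ * a ^ 2 * valB (n + 1) ζ) * valT (n + 1) ζ x) *
        valT (n + 2) ζ x := by
  have Ga : ∀ y, G ζ a y = κ * y ^ 2 := fun y => by rw [ha, hκ, G_left_special]
  have Gb : ∀ y, G ζ b y = κ * b ^ 2 := fun y => by rw [hb, hκ, G_special_right h2]
  have Gxa : G ζ x a = κ * x ^ 2 := by rw [G_comm, Ga]
  have Gxb : G ζ x b = κ * b ^ 2 := by rw [G_comm, Gb]
  have ca : ∀ i j, a ::ₘ specials ζ i j = specials ζ (i + 1) j := by
    rw [ha]; exact cons_specials_left ζ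
  have cb : ∀ i j, b ::ₘ specials ζ i j = specials ζ i (j + 1) := by
    rw [hb]; exact cons_specials_right ζ
  have xa : ∀ s : Multiset ℝ, a ::ₘ x ::ₘ s = x ::ₘ a ::ₘ s := fun s => Multiset.cons_swap _ _ _
  have xb : ∀ s : Multiset ℝ, b ::ₘ x ::ₘ s = x ::ₘ b ::ₘ s := fun s => Multiset.cons_swap _ _ _
  have e0 := evalM_dodgson (n := n) hζ0 hζ a b a b (x ::ₘ specials ζ n n)
    (by rw [Multiset.card_cons, card_specials]; ring)
  have e1 := evalM_dodgson (n := n) hζ0 hζ a x a b (specials ζ n (n + 1))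
    (by rw [card_specials]; ring)
  have e2 := evalM_dodgson (n := n) hζ0 hζ b x b a (specials ζ (n + 1) n)
    (by rw [card_specials]; ring)
  simp only [xa, xb, ca, cb] at e0 e1 e2
  rw [Ga, Gb, Ga, Gb] at e0
  rw [Ga, Gxa, Ga, Gxb] at e1
  rw [Gb, Gxb, Gb, Gxa] at e2
  change _ * valT (n + 2) ζ x * valT n ζ x = _ * _ * _ - _ * valT (n + 1) ζ x * valT (n + 1) ζ x
    at e0
  change _ * valT (n + 2) ζ x * valB n ζ = _ * valA (n + 1) ζ * _ -
    _ * valB (n + 1) ζ * valT (n + 1) ζ x at e1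
  change _ * valT (n + 2) ζ x * valA n ζ = _ * valB (n + 1) ζ * _ -
    _ * valA (n + 1) ζ * valT (n + 1) ζ x at e2
  generalize evalM (n + 1) ζ (x ::ₘ specials ζ (n + 2) n) = U at *
  generalize evalM (n + 1) ζ (x ::ₘ specials ζ n (n + 2)) = V at *
  linear_combination κ ^ 2 * b ^ 2 * x ^ 2 * valA (n + 1) ζ * valB (n + 1) ζ * e0 -
    κ ^ 2 * b ^ 4 * valB (n + 1) ζ * U * e1 -
    ((x - a) * (b - a) * valT (n + 2) ζ x * valB n ζ +
      κ ^ 2 * b ^ 2 * a ^ 2 * valB (n + 1) ζ * valT (n + 1) ζ x) * e2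

theorem valT_three_term (h2 : ζ + 2 ≠ 0) (h1 : 2 * ζ + 1 ≠ 0) (n : ℕ) (hB : valB (n + 1) ζ ≠ 0)
    (x a b κ : ℝ) (ha : a = 2 * ζ + 1) (hb : b = ζ / (ζ + 2)) (hκ : κ = 2 * (ζ + 1) ^ 2) :
    (b - a) ^ 2 * κ ^ 2 * b ^ 2 * x ^ 2 * valA (n + 1) ζ * valB (n + 1) ζ * valT n ζ x =
      -(x - a) * (x - b) * (b - a) ^ 2 * valA n ζ * valB n ζ * valT (n + 2) ζ x +
        κ ^ 2 * b ^ 2 * (b - a) * ((x - a) * valB n ζ * x ^ 2 * valA (n + 1) ζ -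
          (x - b) * valA n ζ * a ^ 2 * valB (n + 1) ζ) * valT (n + 1) ζ x := by
  have hc := continuous_valT hζ0 hζ
  -- To cancel the common factor `T_{n+2}`, it suffices that it is not identically zero; its value
  -- at `0` is a nonzero multiple of `B_{n+1}`.
  have hd : Dense {x | valT (n + 2) ζ x ≠ 0} := by
    refine dense_ne_zero (analyticOnNhd_valT hζ0 hζ (n + 2)) ⟨0, ?_⟩
    rw [valT_succ_zero hζ0 hζ]
    have := div_ne_zero hζ0 h2
    simp [hζ0, hζ, h1, h2, hB]
  exact eq_of_dense hd (e := x)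
    (f := fun x => (b - a) ^ 2 * κ ^ 2 * b ^ 2 * x ^ 2 * valA (n + 1) ζ * valB (n + 1) ζ *
      valT n ζ x)
    (g := fun x => -(x - a) * (x - b) * (b - a) ^ 2 * valA n ζ * valB n ζ * valT (n + 2) ζ x +
        κ ^ 2 * b ^ 2 * (b - a) * ((x - a) * valB n ζ * x ^ 2 * valA (n + 1) ζ -
          (x - b) * valA n ζ * a ^ 2 * valB (n + 1) ζ) * valT (n + 1) ζ x)
    (fun x hx => mul_right_cancel₀ hx (valT_three_term_mul hζ0 hζ h2 n x a b κ ha hb hκ))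
    (Continuous.continuousAt (by fun_prop)) (Continuous.continuousAt (by fun_prop))

end

end ThreeColour

/-! ### Prime powers dividing `S_n` after scaling its variables. -/

namespace ThreeColour

variable {n : ℕ}

/-- The ring `ℝ[ζ][v_0,…,v_{2n}]`. -/
abbrev RealRing (n : ℕ) : Type := MvPolynomial (Fin (2 * n + 1)) ℝ[X]

/-- Substitution of polynomials for the variables of `S_n`. -/
noncomputable def substHom (n : ℕ) (w : Fin (2 * n + 1) → RealRing n) : PolyRing n →+* RealRing n :=
  MvPolynomial.eval₂Hom (MvPolynomial.C.comp (Polynomial.mapRingHom (Int.castRingHom ℝ))) w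

/-- Evaluation at a real number `ζ` and a list of `2n+1` real numbers. -/
noncomputable def evalHom (n : ℕ) (ζ : ℝ) (u : Fin (2 * n + 1) → ℝ) : RealRing n →+* ℝ :=
  MvPolynomial.eval₂Hom (Polynomial.evalRingHom ζ) u

theorem evalHom_substHom (ζ : ℝ) (u : Fin (2 * n + 1) → ℝ) (w : Fin (2 * n + 1) → RealRing n) :
    evalHom n ζ u (substHom n w (S n)) = evalS n ζ fun k => evalHom n ζ u (w k) := by
  have h : (evalHom n ζ u).comp (substHom n w) = MvPolynomial.eval₂Hom
      (Polynomial.eval₂RingHom (Int.castRingHom ℝ) ζ) (fun k => evalHom n ζ u (w k)) := by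
    refine MvPolynomial.ringHom_ext (fun c => ?_) fun k => ?_
    · simp [evalHom, substHom, Polynomial.eval_map]
    · simp [substHom]
  exact congrArg (fun f => f (S n)) h

theorem vand_mul_substHom (w : Fin (2 * n + 1) → RealRing n) :
    vand (xs w) * vand (ys w) * substHom n w (S n) =
      numer (MvPolynomial.C X) (xs w) (ys w) (zl w) := by
  have h := congrArg (substHom n w) (exists_S n).choose_spec
  rw [map_mul, map_mul, map_numer, map_vand, map_vand] at h
  have e : ∀ k, substHom n w (MvPolynomial.X k) = w k := fun k => by simp [substHom]
  have e' : substHom n w (zetaVar n) = MvPolynomial.C X := by simp [substHom]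
  simp only [xs, ys, zl, vars, e, e'] at h
  exact h

theorem continuousAt_evalHom {u : ℝ → Fin (2 * n + 1) → ℝ} {ζ₀ : ℝ}
    (hu : ∀ k, ContinuousAt (fun ζ => u ζ k) ζ₀) (Q : RealRing n) :
    ContinuousAt (fun ζ => evalHom n ζ (u ζ) Q) ζ₀ := by
  induction Q using MvPolynomial.induction_on with
  | C c =>
    simp only [evalHom, MvPolynomial.coe_eval₂Hom, MvPolynomial.eval₂_C, Polynomial.coe_evalRingHom]
    exact c.continuous.continuousAt
  | add p q hp hq => simp only [map_add]; exact hp.add hq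
  | mul_X p k hp =>
    simp only [map_mul]
    refine hp.mul ?_
    simpa [evalHom] using hu k

theorem prime_C_X_sub_C (r : ℝ) : Prime (MvPolynomial.C (X - C r) : RealRing n) :=
  (MvPolynomial.prime_C_iff _).2 (Polynomial.prime_X_sub_C r)

theorem not_C_dvd_X_sub {p c : ℝ[X]} (hp : ¬ IsUnit p) {i j : Fin (2 * n + 1)} (hij : i ≠ j) :
    ¬ (MvPolynomial.C p : RealRing n) ∣ MvPolynomial.X j - MvPolynomial.C c * MvPolynomial.X i := by
  intro h
  have := (MvPolynomial.C_dvd_iff_dvd_coeff _ _).1 h (Finsupp.single j 1)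
  have hne : ¬ Finsupp.single i 1 = (Finsupp.single j 1 : Fin (2 * n + 1) →₀ ℕ) := by
    intro h
    exact hij (Finsupp.single_left_injective one_ne_zero h)
  rw [MvPolynomial.coeff_sub, MvPolynomial.coeff_C_mul, MvPolynomial.coeff_X,
    MvPolynomial.coeff_X, if_neg hne, mul_zero, sub_zero, if_pos rfl] at this
  exact hp (isUnit_of_dvd_one this)

/-- Here `V` is what remains of the Vandermonde products once their powers of `π` are removed. -/
theorem pow_dvd_of_pow_mul_eq {R : Type*} [CommRing R] [IsDomain R] {π V s d : R} (hπ : Prime π)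
    (hV : ¬ π ∣ V) {A e : ℕ} (h : π ^ A * (V * s) = π ^ (A + e) * d) : π ^ e ∣ s := by
  rw [pow_add, mul_assoc] at h
  have h' := mul_left_cancel₀ (pow_ne_zero A hπ.ne_zero) h
  exact hπ.pow_dvd_of_dvd_mul_left e hV ⟨d, h'⟩

theorem prod_prod_ite {R : Type*} [CommRing R] (π : R) {k : ℕ} (hk : k ≤ n) :
    ∏ i : Fin n, ∏ j ∈ Finset.Ioi i, (if (j : ℕ) < k then π else 1) =
      π ^ (∑ j ∈ Finset.range k, j) := by
  rw [Finset.prod_comm' (t' := Finset.univ) (s' := fun j => Finset.Iio j) (by simp)]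
  have h : ∀ j : Fin n, ∏ _i ∈ Finset.Iio j, (if (j : ℕ) < k then π else 1) =
      (fun j : ℕ => if j < k then π ^ j else 1) j := by
    intro j
    rw [Finset.prod_const, Fin.card_Iio]
    by_cases hj : (j : ℕ) < k <;> simp [hj]
  simp only [h]
  rw [Fin.prod_univ_eq_prod_range (fun j : ℕ => if j < k then π ^ j else 1) n,
    ← Finset.prod_pow_eq_pow_sum]
  rw [← Finset.prod_subset (Finset.range_subset_range.2 hk)]
  · exact Finset.prod_congr rfl fun j hj => if_pos (Finset.mem_range.1 hj)
  · intro j _ hj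
    exact if_neg (by simpa using hj)

/-- The power of a prime constant that divides a Vandermonde product in which the first `k`
variables are multiplied by this prime. -/
theorem vand_scaled (r : ℝ) (e : Fin n → Fin (2 * n + 1)) (he : Function.Injective e)
    (α : RealRing n) {k : ℕ} (hk : k ≤ n) (hα : α = 0 ∨ k = n) :
    ∃ V : RealRing n, ¬ MvPolynomial.C (X - C r) ∣ V ∧
      vand (fun i => if (i : ℕ) < k then α + MvPolynomial.C (X - C r) * MvPolynomial.X (e i)
        else MvPolynomial.X (e i)) =
      MvPolynomial.C (X - C r) ^ (∑ j ∈ Finset.range k, j) * V := by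
  have hp := prime_C_X_sub_C (n := n) r
  -- A difference of two scaled variables loses one factor `π`, so each `j < k` contributes `π^j`. A
  -- mixed difference `X_j - π X_i`, which occurs only when `α = 0`, contributes none. The
  -- coefficient of `X_j` in each remaining factor is `1`, so `π` divides none of them.
  refine ⟨∏ i : Fin n, ∏ j ∈ Finset.Ioi i, (MvPolynomial.X (e j) -
    MvPolynomial.C (if (j : ℕ) < k then 1 else if (i : ℕ) < k then X - C r else 1) *
      MvPolynomial.X (e i)), ?_, ?_⟩
  · rw [hp.dvd_finsetProd_iff]
    rintro ⟨i, _, hi⟩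
    rw [hp.dvd_finsetProd_iff] at hi
    obtain ⟨j, hj, hij⟩ := hi
    have hne : i ≠ j := (Finset.mem_Ioi.1 hj).ne
    exact not_C_dvd_X_sub (Polynomial.not_isUnit_X_sub_C r) (he.ne hne) hij
  · rw [← prod_prod_ite _ hk, ← Finset.prod_mul_distrib, vand]
    refine Finset.prod_congr rfl fun i _ => ?_
    rw [← Finset.prod_mul_distrib]
    refine Finset.prod_congr rfl fun j hj => ?_
    have hij : (i : ℕ) < j := Fin.lt_def.1 (Finset.mem_Ioi.1 hj)
    by_cases h1 : (j : ℕ) < k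
    · have h2 : (i : ℕ) < k := hij.trans h1
      simp only [h1, h2, if_true, map_one]
      ring
    · rcases hα with rfl | rfl
      · by_cases h2 : (i : ℕ) < k
        · simp only [h1, h2, if_true, if_false]
          ring
        · simp only [h1, h2, if_false, map_one]
          ring
      · exact absurd j.2 h1

/-- If `x_i = α + π X_i`, `y_j = γ + π Y_j`, where `G(x_i,y_j)` is divisible by `π²` and
`F(x_i,y_j,z)` by `π`, then `S_n` is divisible by `π^{n²}`. -/
theorem pow_sq_dvd_substHom (r : ℝ) (α γ : RealRing n)
    (hG : ∀ s t : RealRing n, ∃ g, G (MvPolynomial.C X) (α + MvPolynomial.C (X - C r) * s)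
      (γ + MvPolynomial.C (X - C r) * t) = MvPolynomial.C (X - C r) ^ 2 * g)
    (hF : ∀ s t z : RealRing n, ∃ f, F (MvPolynomial.C X) (α + MvPolynomial.C (X - C r) * s)
      (γ + MvPolynomial.C (X - C r) * t) z = MvPolynomial.C (X - C r) * f) :
    MvPolynomial.C (X - C r) ^ (n ^ 2) ∣ substHom n
      (slots (fun i => α + MvPolynomial.C (X - C r) * MvPolynomial.X ⟨i, by omega⟩)
        (fun j => γ + MvPolynomial.C (X - C r) * MvPolynomial.X ⟨n + j, by omega⟩)
        (MvPolynomial.X (Fin.last (2 * n)))) (S n) := by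
  have hp := prime_C_X_sub_C (n := n) r
  obtain ⟨V₁, hV₁, e₁⟩ := vand_scaled r (fun i : Fin n => (⟨i, by omega⟩ : Fin (2 * n + 1)))
    (fun i j h => by simpa [Fin.ext_iff] using h) α le_rfl (Or.inr rfl)
  obtain ⟨V₂, hV₂, e₂⟩ := vand_scaled r (fun i : Fin n => (⟨n + i, by omega⟩ : Fin (2 * n + 1)))
    (fun i j h => by simpa [Fin.ext_iff] using h) γ le_rfl (Or.inr rfl)
  simp only [Fin.is_lt, if_true] at e₁ e₂
  have h := vand_mul_substHom
    (slots (fun i : Fin n => α + MvPolynomial.C (X - C r) * MvPolynomial.X ⟨i, by omega⟩)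
        (fun j : Fin n => γ + MvPolynomial.C (X - C r) * MvPolynomial.X ⟨n + j, by omega⟩)
        (MvPolynomial.X (Fin.last (2 * n)) : RealRing n))
  rw [xs_slots, ys_slots, zl_slots, e₁, e₂] at h
  choose g hg using hG
  choose f hf using hF
  set π : RealRing n := MvPolynomial.C (X - C r) with hπ
  have hn : ∃ d, numer (MvPolynomial.C X)
      (fun i : Fin n => α + π * MvPolynomial.X ⟨i, by omega⟩)
      (fun j : Fin n => γ + π * MvPolynomial.X ⟨n + j, by omega⟩)
      (MvPolynomial.X (Fin.last (2 * n))) = (π ^ (1 + 2 * (n - 1))) ^ n * d := by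
    let N : Matrix (Fin n) (Fin n) (RealRing n) := Matrix.of fun i j : Fin n =>
      f (MvPolynomial.X ⟨i, by omega⟩) (MvPolynomial.X ⟨n + j, by omega⟩)
        (MvPolynomial.X (Fin.last (2 * n))) *
      ∏ k ∈ Finset.univ.erase i, g (MvPolynomial.X ⟨k, by omega⟩)
        (MvPolynomial.X ⟨n + j, by omega⟩)
    have hdet := Matrix.det_smul N (π ^ (1 + 2 * (n - 1)))
    rw [Fintype.card_fin] at hdet
    refine ⟨N.det, ?_⟩
    rw [← hdet, numer]
    congr 1
    ext1 i j
    simp only [N, Matrix.of_apply, Matrix.smul_apply, smul_eq_mul, hg, hf, Finset.prod_mul_distrib,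
      Finset.prod_const, Finset.card_erase_of_mem (Finset.mem_univ i), Finset.card_univ,
      Fintype.card_fin]
    rw [pow_add, pow_one, pow_mul]
    ring
  obtain ⟨d, hd⟩ := hn
  rw [hd] at h
  refine pow_dvd_of_pow_mul_eq (V := V₁ * V₂) (d := d) hp
    (A := 2 * ∑ j ∈ Finset.range n, j) (fun h => (hp.dvd_or_dvd h).elim hV₁ hV₂) ?_
  -- Each of the `n` columns gives one `π` from `F` and `2(n-1)` from the values of `G`; the two
  -- Vandermonde products account for `n(n-1)`, which leaves `n²`.
  have hexp : 2 * (∑ j ∈ Finset.range n, j) + n ^ 2 = (1 + 2 * (n - 1)) * n := by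
    rw [mul_comm 2, Finset.sum_range_id_mul_two]
    rcases n with _ | n
    · rfl
    · rw [Nat.add_sub_cancel]; ring
  rw [hexp]
  linear_combination h

end ThreeColour

/-! ### Orders of vanishing of `T_n` in `ζ`. -/

namespace ThreeColour

variable {n : ℕ}

/-- Multiplying the first `k` variables `x_i` and the first `l` variables `y_j` by `π = ζ + 1/2`
makes `S_n` divisible by a power of `π`. -/
theorem pow_dvd_substHom_half {k l e : ℕ} (hk : k ≤ n) (hl : l ≤ n)
    (he : 2 * k + (∑ j ∈ Finset.range k, j) + (∑ j ∈ Finset.range l, j) + e = 2 * k * l) :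
    MvPolynomial.C (X - C (-1 / 2)) ^ e ∣ substHom n
      (slots (fun i => if (i : ℕ) < k then 0 + MvPolynomial.C (X - C (-1 / 2)) *
          MvPolynomial.X ⟨i, by omega⟩ else MvPolynomial.X ⟨i, by omega⟩)
        (fun j => if (j : ℕ) < l then 0 + MvPolynomial.C (X - C (-1 / 2)) *
          MvPolynomial.X ⟨n + j, by omega⟩ else MvPolynomial.X ⟨n + j, by omega⟩)
        (MvPolynomial.X (Fin.last (2 * n)))) (S n) := by
  have hp := prime_C_X_sub_C (n := n) (-1 / 2)
  obtain ⟨V₁, hV₁, e₁⟩ := vand_scaled (-1 / 2)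
    (fun i : Fin n => (⟨i, by omega⟩ : Fin (2 * n + 1)))
    (fun i j h => by simpa [Fin.ext_iff] using h) 0 hk (Or.inl rfl)
  obtain ⟨V₂, hV₂, e₂⟩ := vand_scaled (-1 / 2)
    (fun i : Fin n => (⟨n + i, by omega⟩ : Fin (2 * n + 1)))
    (fun i j h => by simpa [Fin.ext_iff] using h) 0 hl (Or.inl rfl)
  have hG : ∀ s t : RealRing n, ∃ g, G (MvPolynomial.C X)
      (0 + MvPolynomial.C (X - C (-1 / 2)) * s) (0 + MvPolynomial.C (X - C (-1 / 2)) * t) =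
      MvPolynomial.C (X - C (-1 / 2)) ^ 2 * g := by
    intro s t
    refine ⟨(MvPolynomial.C X + 2) * MvPolynomial.C (X - C (-1 / 2)) * s * t * (s + t) -
      MvPolynomial.C X * (s ^ 2 + t ^ 2) - 2 * (MvPolynomial.C X ^ 2 + 3 * MvPolynomial.C X + 1) *
        s * t + 2 * MvPolynomial.C X * (s + t), ?_⟩
    have h2 : (2 * MvPolynomial.C X + 1 : RealRing n) = 2 * MvPolynomial.C (X - C (-1 / 2)) := by
      have : (2 : RealRing n) * MvPolynomial.C (C (1 / 2)) = 1 := by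
        rw [← map_ofNat (MvPolynomial.C.comp (Polynomial.C (R := ℝ))) 2]
        simp only [RingHom.comp_apply]
        rw [← map_mul, ← map_mul]
        norm_num
      rw [neg_div, map_neg, sub_neg_eq_add, map_add, mul_add, this]
    unfold G
    rw [h2]
    ring
  have h := vand_mul_substHom
    (slots (fun i : Fin n => if (i : ℕ) < k then 0 + MvPolynomial.C (X - C (-1 / 2)) *
          MvPolynomial.X ⟨i, by omega⟩ else MvPolynomial.X ⟨i, by omega⟩)
        (fun j : Fin n => if (j : ℕ) < l then 0 + MvPolynomial.C (X - C (-1 / 2)) *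
          MvPolynomial.X ⟨n + j, by omega⟩ else MvPolynomial.X ⟨n + j, by omega⟩)
        (MvPolynomial.X (Fin.last (2 * n)) : RealRing n))
  rw [xs_slots, ys_slots, zl_slots, e₁, e₂] at h
  choose g hg using hG
  set π : RealRing n := MvPolynomial.C (X - C (-1 / 2)) with hπ
  generalize (MvPolynomial.X (Fin.last (2 * n)) : RealRing n) = z at *
  set x : Fin n → RealRing n := fun i => if (i : ℕ) < k then 0 + π *
    MvPolynomial.X ⟨i, by omega⟩ else MvPolynomial.X ⟨i, by omega⟩ with hx
  set y : Fin n → RealRing n := fun j => if (j : ℕ) < l then 0 + π *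
    MvPolynomial.X ⟨n + j, by omega⟩ else MvPolynomial.X ⟨n + j, by omega⟩ with hy
  have hcard : ∀ m : ℕ, m ≤ n → (Finset.univ.filter fun i : Fin n => (i : ℕ) < m).card = m := by
    intro m hm
    rw [Fin.card_filter_val_lt, min_eq_right hm]
  -- The entry in row `i` lacks the factor `G(x_i,y_j)`. Multiplying the first `k` rows by `π²`
  -- compensates for this, and makes each of the first `l` columns divisible by `π^{2k}`.
  have hprod : ∀ j : Fin n, (j : ℕ) < l →
      ∀ i : Fin n, (if (i : ℕ) < k then π ^ 2 else 1) * (F (MvPolynomial.C X) (x i) (y j) z *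
        ∏ t ∈ Finset.univ.erase i, G (MvPolynomial.C X) (x t) (y j)) ∈
        Ideal.span {π ^ (2 * k)} := by
    intro j hj i
    have hGt : ∀ t : Fin n, (if (t : ℕ) < k then π ^ 2 else 1) ∣
        G (MvPolynomial.C X) (x t) (y j) := by
      intro t
      by_cases ht : (t : ℕ) < k
      · rw [if_pos ht]
        simp only [hx, hy, if_pos ht, if_pos hj, hg]
        exact dvd_mul_right _ _
      · rw [if_neg ht]; exact one_dvd _
    have hall : ∏ t : Fin n, (if (t : ℕ) < k then π ^ 2 else 1) = π ^ (2 * k) := by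
      rw [Finset.prod_ite, Finset.prod_const, Finset.prod_const_one, mul_one, hcard k hk, pow_mul]
    rw [Ideal.mem_span_singleton, ← hall,
      ← Finset.mul_prod_erase Finset.univ (fun t : Fin n => if (t : ℕ) < k then π ^ 2 else 1)
        (Finset.mem_univ i)]
    refine mul_dvd_mul_left _ (Dvd.dvd.mul_left ?_ _)
    exact Finset.prod_dvd_prod_of_dvd _ _ fun t _ => hGt t
  have hn : ∃ d, π ^ (2 * k) * numer (MvPolynomial.C X) x y z = π ^ (2 * k * l) * d := by
    have hent : ∀ i j : Fin n, ∃ c, (if (i : ℕ) < k then π ^ 2 else 1) *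
        (F (MvPolynomial.C X) (x i) (y j) z *
          ∏ t ∈ Finset.univ.erase i, G (MvPolynomial.C X) (x t) (y j)) =
        (if (j : ℕ) < l then π ^ (2 * k) else 1) * c := by
      intro i j
      by_cases hj : (j : ℕ) < l
      · obtain ⟨c, hc⟩ := Ideal.mem_span_singleton.1 (hprod j hj i)
        exact ⟨c, by rw [hc, if_pos hj]⟩
      · exact ⟨_, by rw [if_neg hj, one_mul]⟩
    choose c hc using hent
    refine ⟨(Matrix.of c).det, ?_⟩
    have h1 : ∏ t : Fin n, (if (t : ℕ) < k then π ^ 2 else 1) = π ^ (2 * k) := by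
      rw [Finset.prod_ite, Finset.prod_const, Finset.prod_const_one, mul_one, hcard k hk, pow_mul]
    have h2 : ∏ t : Fin n, (if (t : ℕ) < l then π ^ (2 * k) else 1) = π ^ (2 * k * l) := by
      rw [Finset.prod_ite, Finset.prod_const, Finset.prod_const_one, mul_one, hcard l hl]
      exact (pow_mul _ _ _).symm
    rw [← h1, ← h2, numer, ← Matrix.det_mul_column, ← Matrix.det_mul_row]
    congr 1
    ext1 i j
    exact hc i j
  obtain ⟨d, hd⟩ := hn
  refine pow_dvd_of_pow_mul_eq (V := V₁ * V₂) (d := d) hp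
    (A := 2 * k + (∑ j ∈ Finset.range k, j) + (∑ j ∈ Finset.range l, j))
    (fun h => (hp.dvd_or_dvd h).elim hV₁ hV₂) ?_
  rw [he, ← hd, ← h, pow_add, pow_add]
  ring

/-- The power of `ζ + 1/2` in `S_n` at the special point. -/
theorem exponent_half (n : ℕ) :
    2 * (n / 2) + (∑ j ∈ Finset.range (n / 2), j) + (∑ j ∈ Finset.range (n - n / 2), j) +
      delta (n - 1) = 2 * (n / 2) * (n - n / 2) := by
  have h := Finset.sum_range_id_mul_two
  rcases Nat.even_or_odd' n with ⟨m, rfl | rfl⟩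
  · rcases m with _ | m
    · simp [delta]
    have e1 : 2 * (m + 1) / 2 = m + 1 := by omega
    have e2 : 2 * (m + 1) - (m + 1) = m + 1 := by omega
    have e3 : delta (2 * (m + 1) - 1) = m * (m + 1) := by
      have : (2 * (m + 1) - 1) ^ 2 = 4 * (m * (m + 1)) + 1 := by
        rw [show 2 * (m + 1) - 1 = 2 * m + 1 by omega]; ring
      rw [delta, this]; omega
    rw [e1, e2, e3]
    have := h (m + 1)
    rw [Nat.add_sub_cancel] at this
    linarith [this]
  · have e1 : (2 * m + 1) / 2 = m := by omega
    have e2 : 2 * m + 1 - m = m + 1 := by omega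
    have e3 : delta (2 * m + 1 - 1) = m * m := by
      have : (2 * m + 1 - 1) ^ 2 = 4 * (m * m) := by
        rw [Nat.add_sub_cancel]; ring
      rw [delta, this]; omega
    rw [e1, e2, e3]
    have h1 := h (m + 1)
    have h2 := h m
    rw [Nat.add_sub_cancel] at h1
    rw [Finset.sum_range_succ] at h1 ⊢
    linarith [h1]

theorem map_univ_const (n : ℕ) (a : ℝ) :
    Finset.univ.val.map (fun _ : Fin n => a) = Multiset.replicate n a := by
  rw [Multiset.map_const', Finset.card_val, Finset.card_univ, Fintype.card_fin]

theorem map_univ_ite {k : ℕ} (hk : k ≤ n) (a b : ℝ) :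
    Finset.univ.val.map (fun i : Fin n => if (i : ℕ) < k then a else b) =
      Multiset.replicate k a + Multiset.replicate (n - k) b := by
  have : List.ofFn (fun i : Fin n => if (i : ℕ) < k then a else b) =
      List.replicate k a ++ List.replicate (n - k) b := by
    refine List.ext_getElem (by simp [hk]) fun i h1 h2 => ?_
    simp only [List.getElem_ofFn, List.getElem_append, List.length_replicate,
      List.getElem_replicate]
    split_ifs <;> rfl
  rw [Fin.univ_val_map, this, ← Multiset.coe_add]
  rfl

theorem evalHom_X (ζ : ℝ) (u : Fin (2 * n + 1) → ℝ) (k : Fin (2 * n + 1)) :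
    evalHom n ζ u (MvPolynomial.X k) = u k := by simp [evalHom]

theorem evalHom_C (ζ : ℝ) (u : Fin (2 * n + 1) → ℝ) (c : ℝ[X]) :
    evalHom n ζ u (MvPolynomial.C c) = c.eval ζ := by simp [evalHom]

theorem eval_slots {A : Type*} (f : A → ℝ) (x y : Fin n → A) (z : A) :
    (fun k => f (slots x y z k)) = slots (fun i => f (x i)) (fun j => f (y j)) (f z) := by
  ext k
  simp only [slots]
  split_ifs <;> rfl

theorem slots_left (x y : Fin n → ℝ) (z : ℝ) (i : Fin n) :
    slots x y z ⟨i, by omega⟩ = x i := congrFun (xs_slots x y z) i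

theorem slots_right (x y : Fin n → ℝ) (z : ℝ) (i : Fin n) :
    slots x y z ⟨n + i, by omega⟩ = y i := congrFun (ys_slots x y z) i

theorem slots_last (x y : Fin n → ℝ) (z : ℝ) : slots x y z (Fin.last (2 * n)) = z :=
  zl_slots x y z

theorem continuousAt_slots {x y : ℝ → Fin n → ℝ} {z : ℝ → ℝ} {t : ℝ}
    (hx : ∀ i, ContinuousAt (fun s => x s i) t) (hy : ∀ i, ContinuousAt (fun s => y s i) t)
    (hz : ContinuousAt z t) (k : Fin (2 * n + 1)) :
    ContinuousAt (fun s => slots (x s) (y s) (z s) k) t := by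
  simp only [slots]
  split_ifs with h h'
  · exact hx _
  · exact hy _
  · exact hz

/-- The cofactor is only asked to be continuous at the point; `C_pow_dvd_of_eventually_eq` turns
such a factorization for many `x` into a divisibility of polynomials. -/
theorem valT_eq_at_zero (n : ℕ) (x : ℝ) : ∃ h : ℝ → ℝ, ContinuousAt h 0 ∧
    ∀ ζ : ℝ, ζ ≠ 0 → ζ + 1 ≠ 0 → ζ + 2 ≠ 0 → valT n ζ x = (ζ - 0) ^ (n ^ 2) * h ζ := by
  have hX : (MvPolynomial.C (X - C 0) : RealRing n) = MvPolynomial.C X := by simp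
  obtain ⟨Q, hQ⟩ := pow_sq_dvd_substHom (n := n) 0 1 0
    (fun s t => by
      rw [hX]
      generalize (MvPolynomial.C X : RealRing n) = π
      refine ⟨t * (1 + π * (s + (s + t)) + π ^ 2 * (s * (s + t))) +
        2 * t * (s + (s + t) + π * (s * (s + t))) - (2 * s + π * s ^ 2 + π * t ^ 2) -
        2 * t * ((π + 3) * (1 + π * s) + s) + 2 * (1 + π * (s + t)) + (s + t), ?_⟩
      unfold G; ring)
    (fun s t z => by
      rw [hX]
      generalize (MvPolynomial.C X : RealRing n) = π
      refine ⟨(π + 2) * (1 + π * s) * t * z - ((1 + π * s) * (π * t) + π * t * z +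
        (1 + π * s) * z + 1 + π * s + π * t + z) + 2 * π + 1, ?_⟩
      unfold F; ring)
  -- Chosen so that `1 + ζ·2 = 2ζ+1` and `0 + ζ·(1/(ζ+2)) = ζ/(ζ+2)`.
  let u : ℝ → Fin (2 * n + 1) → ℝ := fun ζ => slots (fun _ => 2) (fun _ => 1 / (ζ + 2)) x
  refine ⟨fun ζ => evalHom n ζ (u ζ) Q, continuousAt_evalHom (continuousAt_slots
    (fun _ => continuousAt_const) (fun _ => ?_) continuousAt_const) Q, fun ζ h0 h1 h2 => ?_⟩
  · exact ContinuousAt.div continuousAt_const (by fun_prop) (by norm_num)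
  have h := congrArg (evalHom n ζ (u ζ)) hQ
  rw [evalHom_substHom, eval_slots, map_mul, map_pow] at h
  simp only [map_add, map_mul, map_one, map_zero, evalHom_X, evalHom_C, u, slots_left, slots_right,
    slots_last, Polynomial.eval_sub, Polynomial.eval_X, Polynomial.eval_zero] at h
  refine Eq.trans ?_ h
  have ea : 1 + (ζ - 0) * 2 = 2 * ζ + 1 := by ring
  have eb : 0 + (ζ - 0) * (1 / (ζ + 2)) = ζ / (ζ + 2) := by field_simp; ring
  rw [ea, eb, valT, ← evalM_map h0 h1, map_univ_slots, map_univ_const, map_univ_const, specials,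
    ← Multiset.singleton_add, add_comm ({x} : Multiset ℝ)]

theorem valT_eq_at_neg_one (n : ℕ) (x : ℝ) : ∃ h : ℝ → ℝ, ContinuousAt h (-1) ∧
    ∀ ζ : ℝ, ζ ≠ 0 → ζ + 1 ≠ 0 → ζ + 2 ≠ 0 → valT n ζ x = (ζ - -1) ^ (n ^ 2) * h ζ := by
  have hX : (MvPolynomial.C X : RealRing n) = MvPolynomial.C (X - C (-1)) - 1 := by simp
  obtain ⟨Q, hQ⟩ := pow_sq_dvd_substHom (n := n) (-1) (-1) (-1)
    (fun s t => by
      rw [hX]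
      generalize (MvPolynomial.C (X - C (-1)) : RealRing n) = π
      refine ⟨3 * (s + t) - ((s + t) ^ 2 + 2 * (s * t)) +
        π * (s * t * (s + t) - ((s + t) ^ 2 + 2 * (s * t))) + π ^ 2 * (s * t * (s + t)) +
        2 * (s + t) + (1 - π) * ((s + t) ^ 2 - 2 * (s * t)) -
        2 * ((1 - (s + t) - s * t) + π * (s * t - (s + t)) + π ^ 2 * (s * t)) -
        4 - 3 * (s + t) + 2 * π * (s + t), ?_⟩
      unfold G; ring)
    (fun s t z => by
      rw [hX]
      generalize (MvPolynomial.C (X - C (-1)) : RealRing n) = π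
      refine ⟨z + (π + 1) * z * (-(s + t) + π * (s * t)) + 1 + z -
        (π - 1) * (π * (s * t) + (s + t) * z) + 2 * π - 3, ?_⟩
      unfold F; ring)
  -- At `ζ = -1` both special values equal `-1`: `-1 + (ζ+1)·2 = 2ζ+1` and `-1 + (ζ+1)·2/(ζ+2) =
  -- ζ/(ζ+2)`.
  let u : ℝ → Fin (2 * n + 1) → ℝ := fun ζ => slots (fun _ => 2) (fun _ => 2 / (ζ + 2)) x
  refine ⟨fun ζ => evalHom n ζ (u ζ) Q, continuousAt_evalHom (continuousAt_slots
    (fun _ => continuousAt_const) (fun _ => ?_) continuousAt_const) Q, fun ζ h0 h1 h2 => ?_⟩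
  · exact ContinuousAt.div continuousAt_const (by fun_prop) (by norm_num)
  have h := congrArg (evalHom n ζ (u ζ)) hQ
  rw [evalHom_substHom, eval_slots, map_mul, map_pow] at h
  simp only [map_add, map_mul, map_one, map_neg, evalHom_X, evalHom_C, u, slots_left, slots_right,
    slots_last, Polynomial.eval_sub, Polynomial.eval_X, Polynomial.eval_neg,
    Polynomial.eval_one] at h
  refine Eq.trans ?_ h
  have ea : -1 + (ζ - -1) * 2 = 2 * ζ + 1 := by ring
  have eb : -1 + (ζ - -1) * (2 / (ζ + 2)) = ζ / (ζ + 2) := by field_simp; ring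
  rw [ea, eb, valT, ← evalM_map h0 h1, map_univ_slots, map_univ_const, map_univ_const, specials,
    ← Multiset.singleton_add, add_comm ({x} : Multiset ℝ)]

theorem valT_eq_at_half (n : ℕ) (x : ℝ) : ∃ h : ℝ → ℝ, ContinuousAt h (-1 / 2) ∧
    ∀ ζ : ℝ, ζ ≠ 0 → ζ + 1 ≠ 0 → ζ + 2 ≠ 0 →
      valT n ζ x = (ζ - -1 / 2) ^ delta (n - 1) * h ζ := by
  -- By symmetry the `n` copies of `2ζ+1` may be shared between the `x` and the `y` slots. With `k =
  -- ⌊n/2⌋` and `l = n - k`, the exponent `2kl - 2k - k(k-1)/2 - l(l-1)/2` is `δ_{n-1}`.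
  have hk : n / 2 ≤ n := by omega
  have hl : n - n / 2 ≤ n := by omega
  obtain ⟨Q, hQ⟩ := pow_dvd_substHom_half hk hl (exponent_half n)
  let u : ℝ → Fin (2 * n + 1) → ℝ := fun ζ => slots
    (fun i => if (i : ℕ) < n / 2 then 2 else ζ / (ζ + 2))
    (fun i => if (i : ℕ) < n - n / 2 then 2 else ζ / (ζ + 2)) x
  have hc : ContinuousAt (fun ζ : ℝ => ζ / (ζ + 2)) (-1 / 2) :=
    ContinuousAt.div continuousAt_id (by fun_prop) (by norm_num)
  refine ⟨fun ζ => evalHom n ζ (u ζ) Q, continuousAt_evalHom (continuousAt_slots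
    (fun i => ?_) (fun i => ?_) continuousAt_const) Q, fun ζ h0 h1 h2 => ?_⟩
  · split_ifs
    · exact continuousAt_const
    · exact hc
  · split_ifs
    · exact continuousAt_const
    · exact hc
  have h := congrArg (evalHom n ζ (u ζ)) hQ
  rw [evalHom_substHom, eval_slots, map_mul, map_pow] at h
  simp only [apply_ite (evalHom n ζ (u ζ)), map_add, map_mul, map_zero, evalHom_X, evalHom_C, u,
    slots_left, slots_right, slots_last, Polynomial.eval_sub, Polynomial.eval_X,
    Polynomial.eval_C] at h
  refine Eq.trans ?_ h
  have e : ∀ m : ℕ, (fun i : Fin n => if (i : ℕ) < m then 0 + (ζ - -1 / 2) *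
      (if (i : ℕ) < m then 2 else ζ / (ζ + 2)) else if (i : ℕ) < m then 2 else ζ / (ζ + 2)) =
      fun i : Fin n => if (i : ℕ) < m then 2 * ζ + 1 else ζ / (ζ + 2) := by
    intro m
    ext i
    split_ifs
    · ring
    · rfl
  rw [e, e, valT, ← evalM_map h0 h1, map_univ_slots, map_univ_ite hk, map_univ_ite hl, specials]
  congr 1
  have e1 : Multiset.replicate n (2 * ζ + 1) = Multiset.replicate (n / 2) (2 * ζ + 1) +
      Multiset.replicate (n - n / 2) (2 * ζ + 1) := by
    rw [← Multiset.replicate_add]; congr 1; omega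
  have e2 : Multiset.replicate n (ζ / (ζ + 2)) = Multiset.replicate (n - n / 2) (ζ / (ζ + 2)) +
      Multiset.replicate (n - (n - n / 2)) (ζ / (ζ + 2)) := by
    rw [← Multiset.replicate_add]; congr 1; omega
  rw [e1, e2, ← Multiset.singleton_add]
  abel

/-- Inversion carries `ζ = -2` to `-1/2`, and requires `x ≠ 0`. The prefactor contains
`(ζ/(ζ+2))^{n²}`, whence the power on the left. -/
theorem valT_eq_at_neg_two (n : ℕ) (x : ℝ) (hx : x ≠ 0) : ∃ h : ℝ → ℝ, ContinuousAt h (-2) ∧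
    ∀ᶠ ζ in 𝓝[≠] (-2 : ℝ), (ζ - -2) ^ (n ^ 2) * valT n ζ x =
      (ζ - -2) ^ delta (n - 1) * h ζ := by
  obtain ⟨h, hc, hh⟩ := valT_eq_at_half n x⁻¹
  have e2 : (-2 : ℝ)⁻¹ = -1 / 2 := by norm_num
  refine ⟨fun ζ => ζ ^ (2 * n ^ 2) * (x * (2 * ζ + 1) ^ n) ^ n * ζ ^ (n ^ 2) *
    (2 * ζ)⁻¹ ^ delta (n - 1) * h ζ⁻¹, ?_, ?_⟩
  · refine ContinuousAt.mul (ContinuousAt.mul (Continuous.continuousAt (by fun_prop)) ?_) ?_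
    · exact (ContinuousAt.inv₀ (Continuous.continuousAt (by fun_prop)) (by norm_num)).pow _
    · refine ContinuousAt.comp (g := h) (by rw [e2]; exact hc)
        (continuousAt_id.inv₀ (by norm_num))
  · have hne : ∀ c : ℝ, c ≠ -2 → ∀ᶠ ζ in 𝓝[≠] (-2 : ℝ), ζ ≠ c := fun c hc' =>
      (isOpen_ne.eventually_mem hc'.symm).filter_mono nhdsWithin_le_nhds
    filter_upwards [self_mem_nhdsWithin, hne 0 (by norm_num), hne (-1) (by norm_num),
      hne (-1 / 2) (by norm_num)] with ζ hz2 h0 hz1 hzh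
    have h2 : ζ + 2 ≠ 0 := fun h => hz2 (by simp; linarith)
    have h1 : ζ + 1 ≠ 0 := fun h => hz1 (by linarith)
    have hh1 : 2 * ζ + 1 ≠ 0 := fun h => hzh (by linarith)
    have h1' : ζ⁻¹ + 1 ≠ 0 := by
      intro h; apply h1; field_simp at h; linarith
    have h2' : ζ⁻¹ + 2 ≠ 0 := by
      intro h; apply hh1; field_simp at h; linarith
    have e : ζ⁻¹ - -1 / 2 = (ζ + 2) * (2 * ζ)⁻¹ := by field_simp; ring
    rw [valT_inv h0 h1 h2 hh1 n hx, hh _ (inv_ne_zero h0) h1' h2', e, mul_pow (ζ + 2)]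
    have e3 : (ζ - -2) ^ (n ^ 2) * (x * ((2 * ζ + 1) ^ n * (ζ / (ζ + 2)) ^ n)) ^ n =
        (x * (2 * ζ + 1) ^ n) ^ n * ζ ^ (n ^ 2) := by
      have : ((ζ / (ζ + 2)) ^ n) ^ n * (ζ + 2) ^ (n ^ 2) = ζ ^ (n ^ 2) := by
        rw [← pow_mul, ← sq, ← mul_pow, div_mul_cancel₀ _ h2]
      rw [sub_neg_eq_add, ← this]
      ring
    have e4 : ζ + 2 = ζ - -2 := by ring
    rw [← e4] at e3 ⊢
    linear_combination (ζ ^ (2 * n ^ 2) * (ζ + 2) ^ delta (n - 1) * (2 * ζ)⁻¹ ^ delta (n - 1) *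
      h ζ⁻¹) * e3

end ThreeColour

/-! ### Existence of `P_n`. -/

namespace ThreeColour

variable {n : ℕ}

theorem eval_atZeta (W : ℝ[X][X]) (ζ x : ℝ) :
    (atZeta W ζ).eval x = (W.eval (C x)).eval ζ := by
  rw [atZeta, Polynomial.eval_map]
  have := Polynomial.hom_eval₂ W (RingHom.id ℝ[X]) (Polynomial.evalRingHom ζ) (C x)
  simpa using this.symm

theorem eval_atZeta_mul (V W : ℝ[X][X]) (ζ x : ℝ) :
    (atZeta (V * W) ζ).eval x = (atZeta V ζ).eval x * (atZeta W ζ).eval x := by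
  simp [eval_atZeta]

theorem eval_atZeta_C (c : ℝ[X]) (ζ x : ℝ) : (atZeta (C c) ζ).eval x = c.eval ζ := by
  simp [eval_atZeta]

/-- The list consisting of `x`, `n` copies of `2ζ+1` and `n` copies of `ζ/(ζ+2)`. -/
noncomputable def bigList (n : ℕ) (ζ x : ℝ) (k : Fin (2 * n + 1)) : ℝ :=
  if (k : ℕ) = 0 then x else if (k : ℕ) ≤ n then 2 * ζ + 1 else ζ / (ζ + 2)

theorem evalS_bigList {ζ : ℝ} (hζ0 : ζ ≠ 0) (hζ : ζ + 1 ≠ 0) (x : ℝ) :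
    evalS n ζ (bigList n ζ x) = valT n ζ x := by
  have h : bigList n ζ x = (Fin.cons x (fun i : Fin (2 * n) => if (i : ℕ) < n then 2 * ζ + 1
      else ζ / (ζ + 2)) : Fin (2 * n + 1) → ℝ) := by
    ext k
    refine Fin.cases ?_ (fun i => ?_) k
    · simp [bigList]
    · simp [bigList]
  rw [← evalM_map hζ0 hζ, h, map_univ_cons, map_univ_ite (by omega : n ≤ 2 * n), valT, specials,
    show 2 * n - n = n by omega]

theorem exists_clear_denominators (p : PolyRing n) : ∃ (M : ℕ) (W : ℝ[X][X]), ∀ ζ x : ℝ,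
    ζ + 2 ≠ 0 → (ζ + 2) ^ M * MvPolynomial.eval₂
      (Polynomial.eval₂RingHom (Int.castRingHom ℝ) ζ) (bigList n ζ x) p = (atZeta W ζ).eval x := by
  induction p using MvPolynomial.induction_on with
  | C c =>
    refine ⟨0, C (c.map (Int.castRingHom ℝ)), fun ζ x _ => ?_⟩
    rw [eval_atZeta_C, Polynomial.eval_map]
    simp
  | add p q hp hq =>
    obtain ⟨M₁, W₁, h₁⟩ := hp
    obtain ⟨M₂, W₂, h₂⟩ := hq
    refine ⟨M₁ + M₂, W₁ * C ((X + 2) ^ M₂) + W₂ * C ((X + 2) ^ M₁), fun ζ x h => ?_⟩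
    have e : (atZeta (W₁ * C ((X + 2) ^ M₂) + W₂ * C ((X + 2) ^ M₁)) ζ).eval x =
        (atZeta W₁ ζ).eval x * (ζ + 2) ^ M₂ + (atZeta W₂ ζ).eval x * (ζ + 2) ^ M₁ := by
      simp [eval_atZeta]
    rw [e, ← h₁ ζ x h, ← h₂ ζ x h, MvPolynomial.eval₂_add, pow_add]
    ring
  | mul_X p k hp =>
    obtain ⟨M, W, hW⟩ := hp
    by_cases hk : (k : ℕ) = 0
    · refine ⟨M, W * X, fun ζ x h => ?_⟩
      rw [MvPolynomial.eval₂_mul, MvPolynomial.eval₂_X, ← mul_assoc, hW ζ x h, bigList, if_pos hk]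
      simp [eval_atZeta]
    by_cases hk' : (k : ℕ) ≤ n
    · refine ⟨M, W * C (2 * X + 1), fun ζ x h => ?_⟩
      rw [MvPolynomial.eval₂_mul, MvPolynomial.eval₂_X, ← mul_assoc, hW ζ x h, bigList, if_neg hk,
        if_pos hk']
      simp [eval_atZeta]
    · refine ⟨M + 1, W * C X, fun ζ x h => ?_⟩
      rw [MvPolynomial.eval₂_mul, MvPolynomial.eval₂_X, eval_atZeta_mul, ← hW ζ x h, bigList,
        if_neg hk, if_neg hk', eval_atZeta_C, Polynomial.eval_X, pow_succ]
      field_simp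

/-- Letting `ζ` tend to `ζ₀` shows that the polynomial in `x` at `ζ₀` vanishes for infinitely many
`x`, so every coefficient has the root `ζ₀`. One factor `ζ - ζ₀` is then cancelled and the argument
repeated. -/
theorem C_pow_dvd_of_eventually_eq (ζ₀ : ℝ) : ∀ (k : ℕ) (W : ℝ[X][X]),
    (∀ x : ℝ, x ≠ 0 → ∃ h : ℝ → ℝ, ContinuousAt h ζ₀ ∧
      ∀ᶠ ζ in 𝓝[≠] ζ₀, (atZeta W ζ).eval x = (ζ - ζ₀) ^ k * h ζ) →
    (C ((X - C ζ₀) ^ k) : ℝ[X][X]) ∣ W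
  | 0, W, _ => by simp
  | k + 1, W, hW => by
    have hz : atZeta W ζ₀ = 0 := by
      refine Polynomial.eq_zero_of_infinite_isRoot _ ((Set.Ioi_infinite (0 : ℝ)).mono ?_)
      intro x hx
      obtain ⟨h, hc, he⟩ := hW x (ne_of_gt hx)
      have h1 : Tendsto (fun ζ => (atZeta W ζ).eval x) (𝓝[≠] ζ₀) (𝓝 ((atZeta W ζ₀).eval x)) := by
        simp only [eval_atZeta]
        exact ((W.eval (C x)).continuous.tendsto ζ₀).mono_left nhdsWithin_le_nhds
      have h2 : Tendsto (fun ζ => (ζ - ζ₀) ^ (k + 1) * h ζ) (𝓝[≠] ζ₀)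
          (𝓝 ((ζ₀ - ζ₀) ^ (k + 1) * h ζ₀)) :=
        (ContinuousAt.mul (f := fun ζ => (ζ - ζ₀) ^ (k + 1))
          (Continuous.continuousAt (by fun_prop)) hc).tendsto.mono_left nhdsWithin_le_nhds
      have h3 := tendsto_nhds_unique (h1.congr' he) h2
      rw [sub_self, zero_pow (Nat.succ_ne_zero k), zero_mul] at h3
      exact h3
    have hd : (C (X - C ζ₀) : ℝ[X][X]) ∣ W := by
      rw [Polynomial.C_dvd_iff_dvd_coeff]
      intro i
      rw [Polynomial.dvd_iff_isRoot]
      have := congrArg (fun p => p.coeff i) hz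
      simpa [atZeta] using this
    obtain ⟨V, rfl⟩ := hd
    rw [pow_succ', C_mul]
    refine mul_dvd_mul_left _ (C_pow_dvd_of_eventually_eq ζ₀ k V fun x hx => ?_)
    obtain ⟨h, hc, he⟩ := hW x hx
    refine ⟨h, hc, ?_⟩
    filter_upwards [he, self_mem_nhdsWithin] with ζ h1 h2
    rw [eval_atZeta_mul, eval_atZeta_C, pow_succ', mul_assoc] at h1
    simp only [Polynomial.eval_sub, Polynomial.eval_X, Polynomial.eval_C] at h1
    exact mul_left_cancel₀ (sub_ne_zero.2 h2) h1

theorem C_mul_dvd {p q : ℝ[X]} {W : ℝ[X][X]} (h : IsCoprime p q) (hp : C p ∣ W) (hq : C q ∣ W) :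
    C (p * q) ∣ W := by
  rw [Polynomial.C_dvd_iff_dvd_coeff] at *
  exact fun i => h.mul_dvd (hp i) (hq i)

theorem isCoprime_X_sub_C_pow {r s : ℝ} (h : r ≠ s) (i j : ℕ) :
    IsCoprime ((X - C r) ^ i : ℝ[X]) ((X - C s) ^ j) :=
  (Polynomial.pairwise_coprime_X_sub_C (fun _ _ => id) h).pow

theorem exists_isBigP (n : ℕ) : ∃ P, IsBigP n P := by
  obtain ⟨M, W, hW⟩ := exists_clear_denominators (S n)
  change ∀ ζ x : ℝ, ζ + 2 ≠ 0 → (ζ + 2) ^ M * evalS n ζ (bigList n ζ x) = _ at hW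
  set δ := delta (n - 1)
  set V : ℝ[X][X] := W * C ((X + 2) ^ (n ^ 2)) with hV
  have hVe : ∀ ζ x : ℝ, ζ + 2 ≠ 0 → (atZeta V ζ).eval x =
      (ζ + 2) ^ (M + n ^ 2) * evalS n ζ (bigList n ζ x) := by
    intro ζ x h
    rw [hV, eval_atZeta_mul, eval_atZeta_C, ← hW ζ x h, pow_add]
    simp only [Polynomial.eval_pow, Polynomial.eval_add, Polynomial.eval_X, Polynomial.eval_ofNat]
    ring
  have hne : ∀ {a c : ℝ}, a ≠ c → ∀ᶠ ζ in 𝓝[≠] a, ζ ≠ c := fun {a c} hc =>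
    (isOpen_ne.eventually_mem hc).filter_mono nhdsWithin_le_nhds
  have hev : ∀ {a : ℝ} (P : ℝ → Prop), (∀ᶠ ζ in 𝓝[≠] a, ζ ≠ 0) → (∀ᶠ ζ in 𝓝[≠] a, ζ ≠ -1) →
      (∀ᶠ ζ in 𝓝[≠] a, ζ ≠ -2) → (∀ ζ, ζ ≠ 0 → ζ + 1 ≠ 0 → ζ + 2 ≠ 0 → P ζ) →
      ∀ᶠ ζ in 𝓝[≠] a, P ζ := by
    intro a P h0 h1 h2 h
    filter_upwards [h0, h1, h2] with ζ h0 h1 h2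
    exact h ζ h0 (fun h => h1 (by linarith)) (fun h => h2 (by linarith))
  have key : ∀ {a : ℝ} {e : ℕ}, (∀ᶠ ζ in 𝓝[≠] a, ζ ≠ 0) → (∀ᶠ ζ in 𝓝[≠] a, ζ ≠ -1) →
      (∀ᶠ ζ in 𝓝[≠] a, ζ ≠ -2) → (∀ x : ℝ, ∃ h : ℝ → ℝ, ContinuousAt h a ∧ ∀ ζ : ℝ, ζ ≠ 0 →
      ζ + 1 ≠ 0 → ζ + 2 ≠ 0 → valT n ζ x = (ζ - a) ^ e * h ζ) → C ((X - C a) ^ e) ∣ V := by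
    intro a e h0 h1 h2 hT
    refine C_pow_dvd_of_eventually_eq a e V fun x _ => ?_
    obtain ⟨h, hc, he⟩ := hT x
    refine ⟨fun ζ => (ζ + 2) ^ (M + n ^ 2) * h ζ,
      ContinuousAt.mul (Continuous.continuousAt (by fun_prop)) hc,
      hev _ h0 h1 h2 fun ζ h0 h1 h2 => ?_⟩
    rw [hVe ζ x h2, evalS_bigList h0 h1, he ζ h0 h1 h2]
    ring
  have d0 : C ((X - C 0) ^ (n ^ 2)) ∣ V := key self_mem_nhdsWithin (hne (by norm_num))
    (hne (by norm_num)) (valT_eq_at_zero n)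
  have d1 : C ((X - C (-1)) ^ (n ^ 2)) ∣ V := key (hne (by norm_num)) self_mem_nhdsWithin
    (hne (by norm_num)) (valT_eq_at_neg_one n)
  have dh : C ((X - C (-1 / 2)) ^ δ) ∣ V := key (hne (by norm_num)) (hne (by norm_num))
    (hne (by norm_num)) (valT_eq_at_half n)
  -- The `M` factors that cleared the denominators are recovered here together with `δ` further
  -- ones.
  have d2 : C ((X - C (-2)) ^ (M + δ)) ∣ V := by
    refine C_pow_dvd_of_eventually_eq _ _ V fun x hx => ?_
    obtain ⟨h, hc, he⟩ := valT_eq_at_neg_two n x hx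
    refine ⟨h, hc, ?_⟩
    filter_upwards [he, hne (show (-2 : ℝ) ≠ 0 by norm_num),
      hne (show (-2 : ℝ) ≠ -1 by norm_num), self_mem_nhdsWithin] with ζ he h0 h1 h2
    have h1' : ζ + 1 ≠ 0 := fun h => h1 (by linarith)
    have h2' : ζ + 2 ≠ 0 := fun h => h2 (by simp; linarith)
    rw [hVe ζ x h2', evalS_bigList h0 h1', pow_add _ M, pow_add _ M, mul_assoc _ _ (h ζ), ← he,
      sub_neg_eq_add]
    ring
  obtain ⟨P, hP⟩ := C_mul_dvd
    ((isCoprime_X_sub_C_pow (by norm_num) _ _).mul_left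
      ((isCoprime_X_sub_C_pow (by norm_num) _ _).mul_left
        (isCoprime_X_sub_C_pow (by norm_num) _ _)))
    (C_mul_dvd ((isCoprime_X_sub_C_pow (by norm_num) _ _).mul_right
      (isCoprime_X_sub_C_pow (by norm_num) _ _)) d0
      (C_mul_dvd (isCoprime_X_sub_C_pow (by norm_num) _ _) d1 dh)) d2
  -- The sign is its own inverse, and `(1/2)^{n²}` turns `(ζ+2)^{n²}` into `(1+ζ/2)^{n²}`. The
  -- powers of two in `(1+2ζ)^δ (1+ζ/2)^δ` cancel each other.
  refine ⟨C (C ((-1) ^ ((n + 1).choose 2) * (1 / 2) ^ (n ^ 2))) * P, fun ζ x hζ => ?_⟩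
  have h2 : ζ + 2 ≠ 0 := fun h => hζ (by linarith)
  have h := congrArg (fun Q => (atZeta Q ζ).eval x) hP
  rw [hVe ζ x h2, eval_atZeta_mul, eval_atZeta_C, pow_add] at h
  simp only [Polynomial.eval_mul, Polynomial.eval_pow, Polynomial.eval_sub, Polynomial.eval_X,
    Polynomial.eval_C, sub_neg_eq_add, sub_zero] at h
  have h' : (ζ + 2) ^ (n ^ 2) * evalS n ζ (bigList n ζ x) = ζ ^ (n ^ 2) * (ζ + 1) ^ (n ^ 2) *
      ((ζ - -1 / 2) ^ δ * (ζ + 2) ^ δ) * (atZeta P ζ).eval x := by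
    refine mul_left_cancel₀ (pow_ne_zero M h2) ?_
    rw [pow_add] at h
    linear_combination h
  have e1 : (1 + ζ / 2) ^ (n ^ 2) = (1 / 2) ^ (n ^ 2) * (ζ + 2) ^ (n ^ 2) := by
    rw [← mul_pow]; ring
  have e2 : (1 + 2 * ζ) ^ δ * (1 + ζ / 2) ^ δ = (ζ - -1 / 2) ^ δ * (ζ + 2) ^ δ := by
    rw [← mul_pow, ← mul_pow]; ring
  have e3 : (-1 : ℝ) ^ ((n + 1).choose 2) * (-1) ^ ((n + 1).choose 2) = 1 := by
    rw [← pow_add, ← two_mul, pow_mul]; simp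
  change (1 + ζ / 2) ^ (n ^ 2) * evalS n ζ (bigList n ζ x) = _
  rw [eval_atZeta_mul, eval_atZeta_C, Polynomial.eval_C, e1, mul_assoc _ _ (evalS _ _ _), h',
    mul_assoc (_ * _ * _) ((1 + 2 * ζ) ^ δ), e2, add_comm 1 ζ]
  linear_combination (-((1 / 2) ^ (n ^ 2) * ζ ^ (n ^ 2) * (ζ + 1) ^ (n ^ 2) *
    ((ζ - -1 / 2) ^ δ * (ζ + 2) ^ δ) * (atZeta P ζ).eval x)) * e3

theorem isBigP_bigP (n : ℕ) : IsBigP n (bigP n) := Classical.epsilon_spec (exists_isBigP n)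

end ThreeColour

/-! ### Real zeroes, signs and degrees. -/

namespace ThreeColour

theorem exists_eq_C_mul_prod {m : ℕ} {p : ℝ[X]} (hdeg : p.natDegree ≤ m) {c : Fin m → ℝ}
    (hc : Function.Injective c) (h : ∀ i, p.eval (c i) = 0) :
    ∃ L : ℝ, p = C L * ∏ i, (X - C (c i)) := by
  obtain ⟨q, hq⟩ : ∏ i, (X - C (c i)) ∣ p :=
    Fintype.prod_dvd_of_coprime (Polynomial.pairwise_coprime_X_sub_C hc)
      fun i => Polynomial.dvd_iff_isRoot.2 (h i)
  by_cases hq0 : q = 0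
  · exact ⟨0, by rw [hq, hq0, mul_zero, C_0, zero_mul]⟩
  have hm : (∏ i, (X - C (c i))).Monic := Polynomial.monic_prod_of_monic _ _
    fun i _ => Polynomial.monic_X_sub_C _
  have h1 := hm.natDegree_mul' hq0
  rw [← hq, Polynomial.natDegree_finsetProd_X_sub_C_eq_card, Finset.card_univ,
    Fintype.card_fin] at h1
  refine ⟨q.coeff 0, ?_⟩
  rw [← Polynomial.eq_C_of_natDegree_eq_zero (by omega : q.natDegree = 0), mul_comm, ← hq]

/-- Exactly `m - k` factors are negative, and `(-1)^m (-1)^k` is the sign `(-1)^{m-k}`. -/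
theorem prod_sub_sign {m : ℕ} (c : Fin m → ℝ) (x : ℝ) (k : ℕ)
    (h1 : ∀ i : Fin m, (i : ℕ) < k → c i < x) (h2 : ∀ i : Fin m, k ≤ i → x < c i) (hk : k ≤ m) :
    0 < (-1) ^ m * (-1) ^ k * ∏ i, (x - c i) := by
  have e : ∏ i : Fin m, (if (i : ℕ) < k then (1 : ℝ) else -1) = (-1) ^ m * (-1) ^ k := by
    rw [Fin.prod_univ_eq_prod_range (fun i => if i < k then (1 : ℝ) else -1) m,
      ← Nat.add_sub_cancel' hk, Finset.prod_range_add,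
      Finset.prod_congr rfl fun i hi => if_pos (Finset.mem_range.1 hi)]
    simp only [Finset.prod_const_one, Nat.not_lt.2 (Nat.le_add_right _ _), if_false,
      Finset.prod_const, Finset.card_range, one_mul]
    rw [pow_add, mul_right_comm, ← pow_add, ← two_mul, pow_mul]
    simp
  rw [← e, ← Finset.prod_mul_distrib]
  refine Finset.prod_pos fun i _ => ?_
  split_ifs with h
  · have := h1 i h
    linarith
  · have := h2 i (not_lt.1 h)
    linarith

theorem exists_zeros_of_alternating {m : ℕ} {p : Fin (m + 1) → ℝ} (hp : StrictMono p) {f : ℝ → ℝ}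
    (hf : Continuous f) (h : ∀ j : Fin (m + 1), 0 < (-1) ^ (j : ℕ) * f (p j)) :
    ∃ d : Fin m → ℝ, StrictMono d ∧ ∀ j, p j.castSucc < d j ∧ d j < p j.succ ∧ f (d j) = 0 := by
  have hd : ∀ j : Fin m, ∃ x, p j.castSucc < x ∧ x < p j.succ ∧ f x = 0 := by
    intro j
    have hlt : p j.castSucc < p j.succ := hp j.castSucc_lt_succ
    have h1 := h j.castSucc
    have h2 := h j.succ
    rw [Fin.val_succ, pow_succ] at h2
    rw [Fin.val_castSucc] at h1
    obtain ⟨x, hx, hx0⟩ := intermediate_value_Ioo' hlt.le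
      (f := fun x => (-1) ^ (j : ℕ) * f x) (by fun_prop)
      (show (0 : ℝ) ∈ _ from ⟨by linarith, h1⟩)
    exact ⟨x, hx.1, hx.2, (mul_eq_zero.1 hx0).resolve_left (pow_ne_zero _ (by norm_num))⟩
  choose d hd1 hd2 hd3 using hd
  refine ⟨d, fun i j hij => ?_, fun j => ⟨hd1 j, hd2 j, hd3 j⟩⟩
  exact (hd2 i).trans_le ((hp.monotone (Fin.succ_le_castSucc_iff.2 hij)).trans (hd1 j).le)

theorem natDegree_le_of_tendsto_div {p : ℝ[X]} {n : ℕ} {L : ℝ}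
    (h : Tendsto (fun x => p.eval x / x ^ n) atTop (𝓝 L)) : p.natDegree ≤ n := by
  by_contra! hn
  have h1 := Polynomial.abs_div_tendsto_atTop_atTop_of_degree_gt p (X ^ n)
    (Polynomial.degree_lt_degree (by rwa [Polynomial.natDegree_X_pow]))
    (pow_ne_zero _ X_ne_zero)
  simp only [Polynomial.eval_pow, Polynomial.eval_X] at h1
  exact not_tendsto_nhds_of_tendsto_atTop h1 _ h.abs

theorem mul_pos_trans {x y z : ℝ} (h1 : 0 < x * y) (h2 : 0 < y * z) : 0 < x * z := by
  have h3 : 0 < (x * z) * (y * y) := by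
    have := mul_pos h1 h2
    linarith
  exact pos_of_mul_pos_left h3 (mul_self_nonneg y)

theorem mul_pos_symm {x y : ℝ} (h : 0 < x * y) : 0 < y * x := by rwa [mul_comm]

end ThreeColour

/-! ### The sign induction for admissible `ζ`. -/

namespace ThreeColour

/-- The range of the parameter for which the polynomials have real zeroes. -/
def Admissible (ζ : ℝ) : Prop := -2 < ζ ∧ ζ < -1 / 2 ∧ ζ ≠ -1

namespace Admissible

variable {ζ : ℝ}

theorem neg (h : Admissible ζ) : ζ < 0 := by linarith [h.2.1]

theorem ne_zero (h : Admissible ζ) : ζ ≠ 0 := h.neg.ne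

theorem add_one_ne (h : Admissible ζ) : ζ + 1 ≠ 0 := fun h' => h.2.2 (by linarith)

theorem add_two_pos (h : Admissible ζ) : 0 < ζ + 2 := by linarith [h.1]

theorem left_neg (h : Admissible ζ) : 2 * ζ + 1 < 0 := by linarith [h.2.1]

theorem right_neg (h : Admissible ζ) : ζ / (ζ + 2) < 0 := div_neg_of_neg_of_pos h.neg h.add_two_pos

theorem inv (h : Admissible ζ) : Admissible ζ⁻¹ := by
  have h0 := h.neg
  refine ⟨?_, ?_, fun h' => h.2.2 (by rw [← inv_inv ζ, h']; norm_num)⟩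
  · rw [lt_inv_of_neg (by norm_num) h0]
    linarith [h.2.1]
  · rw [inv_lt_of_neg h0 (by norm_num)]
    linarith [h.1]

/-- Inversion exchanges the two halves `(-2,-1)` and `(-1,-1/2)` of the range. This change of sign
provides the additional sign change at infinity. -/
theorem inv_add_one_mul_neg (h : Admissible ζ) : (ζ⁻¹ + 1) * (ζ + 1) < 0 := by
  have e : (ζ⁻¹ + 1) * (ζ + 1) = (ζ + 1) ^ 2 * ζ⁻¹ := by
    have := h.ne_zero
    field_simp
    ring
  rw [e]
  have := h.add_one_ne
  exact mul_neg_of_pos_of_neg (by positivity) (inv_lt_zero.2 h.neg)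

/-- What matters is that the sign of the factor, that of `-(ζ+1)`, does not depend on `n`. -/
theorem valT_zero_sign (h : Admissible ζ) (n : ℕ) : ∃ K : ℝ, 0 < -(ζ + 1) * K ∧
    valT (n + 1) ζ 0 = K * valB n ζ := by
  refine ⟨_, ?_, valT_succ_zero h.ne_zero h.add_one_ne n⟩
  have h1 : 0 < (-2 * ζ) ^ (n + 1) := pow_pos (by linarith [h.neg]) _
  have h2 : 0 < (ζ + 1) ^ (2 * n + 2) := by
    have := h.add_one_ne
    rw [show 2 * n + 2 = (n + 1) * 2 by ring, pow_mul]
    positivity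
  have h3 : 0 < ((2 * ζ + 1) * (ζ / (ζ + 2))) ^ n :=
    pow_pos (mul_pos_of_neg_of_neg h.left_neg h.right_neg) n
  rw [mul_pow] at h3
  have := mul_neg_of_pos_of_neg (mul_pos (mul_pos h1 h2) h3) h.right_neg
  rw [neg_mul, neg_pos]
  calc _ = _ := by ring
    _ < 0 := this

theorem valA_inv_sign (h : Admissible ζ) (n : ℕ) : ∃ K : ℝ, 0 < (-1) ^ n * K ∧
    valA n ζ = K * valB n ζ⁻¹ := by
  refine ⟨_, ?_, valA_inv h.ne_zero h.add_one_ne h.add_two_pos.ne' h.left_neg.ne n⟩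
  have h3 : 0 < ((2 * ζ + 1) * (ζ / (ζ + 2))) ^ n :=
    pow_pos (mul_pos_of_neg_of_neg h.left_neg h.right_neg) n
  have h4 : 0 < -(2 * ζ + 1) := by linarith [h.left_neg]
  have h5 : 0 < ζ ^ (2 * n ^ 2) := by
    have := h.ne_zero
    rw [pow_mul]
    positivity
  have := mul_pos h5 (pow_pos (mul_pos h4 h3) n)
  rw [mul_pow (2 * ζ + 1), show -(2 * ζ + 1) * ((2 * ζ + 1) ^ n * (ζ / (ζ + 2)) ^ n) =
    -1 * ((2 * ζ + 1) ^ (n + 1) * (ζ / (ζ + 2)) ^ n) by ring, mul_pow (-1)] at this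
  rwa [mul_left_comm]

/-- By inversion, the behaviour of `T_n` at infinity is its behaviour near `0` for the parameter
`1/ζ`. This gives both the degree bound and the sign for large `x`. -/
theorem tendsto_valT_div (h : Admissible ζ) (n : ℕ) : ∃ K : ℝ, 0 < K ∧
    Tendsto (fun x => valT n ζ x / x ^ n) atTop (𝓝 (K * valT n ζ⁻¹ 0)) := by
  refine ⟨ζ ^ (2 * n ^ 2) * ((2 * ζ + 1) ^ n * (ζ / (ζ + 2)) ^ n) ^ n, ?_, ?_⟩
  · have := h.ne_zero
    have h3 : 0 < ((2 * ζ + 1) * (ζ / (ζ + 2))) ^ n :=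
      pow_pos (mul_pos_of_neg_of_neg h.left_neg h.right_neg) n
    rw [mul_pow] at h3
    rw [pow_mul]
    positivity
  · have hc : Tendsto (fun x : ℝ => valT n ζ⁻¹ x⁻¹) atTop (𝓝 (valT n ζ⁻¹ 0)) :=
      ((continuous_valT h.inv.ne_zero h.inv.add_one_ne n).tendsto 0).comp tendsto_inv_atTop_zero
    refine (hc.const_mul _).congr' ?_
    filter_upwards [eventually_gt_atTop 0] with x hx
    rw [valT_inv h.ne_zero h.add_one_ne h.add_two_pos.ne' h.left_neg.ne n hx.ne', mul_pow x]
    field_simp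

theorem eventually_valT_sign (h : Admissible ζ) (n : ℕ) (h0 : valT n ζ⁻¹ 0 ≠ 0) :
    ∀ᶠ x in atTop, 0 < valT n ζ⁻¹ 0 * valT n ζ x := by
  obtain ⟨K, hK, ht⟩ := h.tendsto_valT_div n
  have h1 : 0 < valT n ζ⁻¹ 0 * (K * valT n ζ⁻¹ 0) := by
    have := mul_pos hK (mul_self_pos.2 h0)
    linarith
  filter_upwards [(ht.const_mul (valT n ζ⁻¹ 0)).eventually_const_lt h1, eventually_gt_atTop 0]
    with x hx hx0
  have := mul_pos hx (pow_pos hx0 n)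
  rwa [mul_assoc, div_mul_cancel₀ _ (pow_pos hx0 n).ne'] at this

theorem exists_valT_eq (h : Admissible ζ) (n : ℕ) : ∃ k : ℝ, k ≠ 0 ∧
    ∀ x, valT n ζ x = k * (atZeta (bigP n) ζ).eval x := by
  have h2 := h.add_two_pos
  have e1 : (1 + ζ / 2) ≠ 0 := by linarith
  have e2 : 1 + 2 * ζ ≠ 0 := by linarith [h.left_neg]
  have e3 : 1 + ζ ≠ 0 := by rw [add_comm]; exact h.add_one_ne
  have e4 := h.ne_zero
  refine ⟨(-1) ^ ((n + 1).choose 2) * ζ ^ (n ^ 2) * (1 + ζ) ^ (n ^ 2) *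
    (1 + 2 * ζ) ^ delta (n - 1) * (1 + ζ / 2) ^ delta (n - 1) / (1 + ζ / 2) ^ (n ^ 2), ?_, fun x => ?_⟩
  · have : (-1 : ℝ) ^ ((n + 1).choose 2) ≠ 0 := pow_ne_zero _ (by norm_num)
    simp_all
  · have := isBigP_bigP n ζ x (by linarith)
    change (1 + ζ / 2) ^ (n ^ 2) * evalS n ζ (bigList n ζ x) = _ at this
    rw [evalS_bigList h.ne_zero h.add_one_ne] at this
    rw [div_mul_eq_mul_div, ← this, mul_div_cancel_left₀ _ (pow_ne_zero _ e1)]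

theorem natDegree_bigP_le (h : Admissible ζ) (n : ℕ) : (atZeta (bigP n) ζ).natDegree ≤ n := by
  obtain ⟨k, hk, hT⟩ := h.exists_valT_eq n
  obtain ⟨K, _, ht⟩ := h.tendsto_valT_div n
  refine natDegree_le_of_tendsto_div ((ht.const_mul k⁻¹).congr fun x => ?_)
  rw [hT]
  field_simp

theorem exists_valT_eq_prod (h : Admissible ζ) {n : ℕ} {c : Fin n → ℝ} (hc : Function.Injective c)
    (h0 : ∀ i, valT n ζ (c i) = 0) : ∃ L : ℝ, ∀ x, valT n ζ x = L * ∏ i, (x - c i) := by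
  obtain ⟨k, hk, hT⟩ := h.exists_valT_eq n
  obtain ⟨L, hL⟩ := exists_eq_C_mul_prod (h.natDegree_bigP_le n) hc
    fun i => (mul_eq_zero.1 ((hT _).symm.trans (h0 i))).resolve_left hk
  refine ⟨k * L, fun x => ?_⟩
  rw [hT, hL, Polynomial.eval_mul, Polynomial.eval_C, Polynomial.eval_prod, mul_assoc]
  simp

/-- At a zero of `T_{n+1}` the recurrence equates a positive multiple of `T_n(c)` with a negative
multiple of `T_{n+2}(c)`; since `a` and `b` are negative, `(c-a)(c-b) > 0`. -/
theorem valT_mul_valT_neg (h : Admissible ζ) {n : ℕ} (h0 : 0 < valA n ζ * valB n ζ)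
    (h1 : 0 < valA (n + 1) ζ * valB (n + 1) ζ) {c : ℝ} (hc : 0 < c) (hc0 : valT (n + 1) ζ c = 0)
    (hne : valT n ζ c ≠ 0) : valT n ζ c * valT (n + 2) ζ c < 0 := by
  have ht := valT_three_term h.ne_zero h.add_one_ne h.add_two_pos.ne' h.left_neg.ne n
    (right_ne_zero_of_mul h1.ne') c _ _ _ rfl rfl rfl
  have ha := h.left_neg
  have hb := h.right_neg
  have hab : ζ / (ζ + 2) - (2 * ζ + 1) ≠ 0 := by
    have e : ζ / (ζ + 2) - (2 * ζ + 1) = -2 * (ζ + 1) ^ 2 / (ζ + 2) := by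
      have := h.add_two_pos.ne'
      field_simp
      ring
    rw [e]
    have := h.add_one_ne
    have := h.add_two_pos.ne'
    simp_all
  have hκ : 2 * (ζ + 1) ^ 2 ≠ 0 := by
    have := h.add_one_ne
    simp_all
  generalize 2 * (ζ + 1) ^ 2 = κ at *
  generalize ζ / (ζ + 2) = b at *
  generalize 2 * ζ + 1 = a at *
  rw [hc0, mul_zero, add_zero] at ht
  have hp1 : 0 < (b - a) ^ 2 * κ ^ 2 * b ^ 2 * c ^ 2 * (valA (n + 1) ζ * valB (n + 1) ζ) *
      valT n ζ c ^ 2 := by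
    have := hb.ne
    positivity
  have hp2 : 0 < (c - a) * (c - b) * (b - a) ^ 2 * (valA n ζ * valB n ζ) := by
    have : 0 < c - a := by linarith
    have : 0 < c - b := by linarith
    positivity
  by_contra! hcon
  have := mul_nonneg hp2.le hcon
  have e := congrArg (fun t => t * valT n ζ c) ht
  nlinarith

/-- The zeroes of `S_{n+1}` at the special points, as a function of one variable, are positive
and simple, and `S_n` has alternating signs at them. -/
def Alternating (ζ : ℝ) (n : ℕ) : Prop :=
  0 < valA n ζ * valB n ζ ∧ 0 < valA n ζ * valT n ζ 0 ∧
    ∃ c : Fin (n + 1) → ℝ, StrictMono c ∧ ∀ i, 0 < c i ∧ valT (n + 1) ζ (c i) = 0 ∧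
      0 < (-1) ^ (i : ℕ) * (valA n ζ * valT n ζ (c i))

theorem alternating_zero (h : Admissible ζ) : Alternating ζ 0 := by
  have h0 := valT_zero h.ne_zero h.add_one_ne
  rw [Alternating, ← valT_left, ← valT_right, h0, h0, h0]
  -- `T_0 = 1`, and `T_1` is a multiple of `x + ζ`.
  refine ⟨by norm_num, by norm_num, fun _ => -ζ, Subsingleton.strictMono (α := Fin 1) _, fun i => ?_⟩
  rw [h0, valT_one h.ne_zero h.add_one_ne h.add_two_pos.ne']
  refine ⟨by linarith [h.neg], by ring, ?_⟩
  rw [Fin.val_eq_zero]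
  norm_num

theorem alternating_succ (h : Admissible ζ) {n : ℕ} (hn : Alternating ζ n) :
    Alternating ζ (n + 1) := by
  obtain ⟨hAB, hA0, c, hc, hci⟩ := hn
  obtain ⟨L, hL⟩ := h.exists_valT_eq_prod hc.injective fun i => (hci i).2.1
  obtain ⟨K, hK, hTK⟩ := h.valT_zero_sign n
  obtain ⟨K', hK', hTK'⟩ := h.valT_zero_sign (n + 1)
  obtain ⟨J, hJ, hTJ⟩ := h.inv.valT_zero_sign (n + 1)
  obtain ⟨I, hI, hTI⟩ := h.valA_inv_sign (n + 1)
  have hL0 : L ≠ 0 := by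
    rintro rfl
    have := hL 0
    rw [hTK, zero_mul] at this
    exact (mul_ne_zero (right_ne_zero_of_mul hK.ne') (right_ne_zero_of_mul hAB.ne')) this
  have hprod : ∀ x ≤ 0, 0 < (-1) ^ (n + 1) * ∏ i, (x - c i) := by
    intro x hx
    have := prod_sub_sign c x 0 (fun i hi => absurd hi (Nat.not_lt_zero _))
      (fun i _ => hx.trans_lt (hci i).1) (Nat.zero_le _)
    simpa using this
  have hneg : ∀ x ≤ 0, ∀ y ≤ 0, 0 < valT (n + 1) ζ x * valT (n + 1) ζ y := by
    intro x hx y hy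
    have h1 := mul_pos (mul_self_pos.2 hL0) (mul_pos (hprod x hx) (hprod y hy))
    have e : (-1 : ℝ) ^ (n + 1) * (-1) ^ (n + 1) = 1 := by
      rw [← pow_add, ← two_mul, pow_mul]; simp
    rw [hL, hL]
    calc 0 < _ := h1
      _ = (L * L * ((∏ i, (x - c i)) * ∏ i, (y - c i))) * ((-1) ^ (n + 1) * (-1) ^ (n + 1)) := by
        ring
      _ = _ := by rw [e]; ring
  -- The zeroes `c i` exhaust the degree and are positive, so `T_{n+1}` has one sign on `(-∞,0]`,
  -- where `2ζ+1` and `ζ/(ζ+2)` lie.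
  have hA1B1 : 0 < valA (n + 1) ζ * valB (n + 1) ζ := by
    rw [← valT_left, ← valT_right]
    exact hneg _ h.left_neg.le _ h.right_neg.le
  have hA1T : 0 < valA (n + 1) ζ * valT (n + 1) ζ 0 := by
    rw [← valT_left]
    exact hneg _ h.left_neg.le _ le_rfl
  have hKK : 0 < K' * K := mul_pos_trans (mul_pos_symm hK') hK
  have hKJ : 0 < K * -J := by
    have h1 : 0 < (ζ + 1) * -(ζ⁻¹ + 1) := by linarith [h.inv_add_one_mul_neg]
    have := mul_pos_trans h1 hJ
    exact mul_pos_trans (mul_pos_symm hK) (by linarith)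
  -- `T_{n+1}(0)` and `T_{n+2}(0)` are multiples of `B_n` and `B_{n+1}` by factors of the same sign,
  -- and `B_{n+1}` has the sign of `T_{n+1}(0)`.
  have hf0 : 0 < valA n ζ * valT (n + 2) ζ 0 := by
    have hB1T := mul_pos_trans (mul_pos_symm hA1B1) hA1T
    rw [hTK] at hB1T
    refine mul_pos_trans hAB ?_
    rw [hTK']
    refine pos_of_mul_pos_left (b := K * K) ?_ (mul_self_nonneg K)
    have := mul_pos hB1T hKK
    linarith
  -- The sign of the leading coefficient of `T_{n+2}`: through `B_{n+1}` at `1/ζ` it is related to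
  -- `A_{n+1}` at `ζ`, with `(-1)^{n+1}` from `I` and one more sign from `J`.
  have hAI : 0 < valT (n + 2) ζ⁻¹ 0 * ((-1) ^ (n + 2) * valA n ζ) := by
    rw [hTI, hTK] at hA1T
    rw [hTJ]
    refine pos_of_mul_pos_left (b := (I * K * valB n ζ) * (I * K * valB n ζ)) ?_
      (mul_self_nonneg _)
    have := mul_pos (mul_pos hA1T hI) (mul_pos hKJ hAB)
    rw [pow_succ _ (n + 1)]
    linarith
  obtain ⟨R, hR, hcR⟩ := ((h.eventually_valT_sign (n + 2) (left_ne_zero_of_mul hAI.ne')).and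
    (eventually_gt_atTop (c (Fin.last n)))).exists
  have hfR := mul_pos_trans (mul_pos_symm hAI) hR
  have hfc : ∀ i : Fin (n + 1), 0 < (-1) ^ ((i : ℕ) + 1) * (valA n ζ * valT (n + 2) ζ (c i)) := by
    intro i
    obtain ⟨h1, h2, h3⟩ := hci i
    have hne := right_ne_zero_of_mul (right_ne_zero_of_mul h3.ne')
    have h4 := h.valT_mul_valT_neg hAB hA1B1 h1 h2 hne
    have h5 : 0 < valT n ζ (c i) * -valT (n + 2) ζ (c i) := by linarith
    rw [← mul_assoc] at h3
    have := mul_pos_trans h3 h5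
    rw [pow_succ]
    linarith
  have hg : StrictMono (Fin.snoc c R : Fin (n + 2) → ℝ) := by
    refine Fin.strictMono_iff_lt_succ.2 fun i => ?_
    refine Fin.lastCases ?_ (fun j => ?_) i
    · rw [Fin.succ_last, Fin.snoc_castSucc (α := fun _ => ℝ), Fin.snoc_last (α := fun _ => ℝ)]
      exact hcR
    · rw [Fin.succ_castSucc, Fin.snoc_castSucc (α := fun _ => ℝ),
        Fin.snoc_castSucc (α := fun _ => ℝ)]
      exact hc j.castSucc_lt_succ
  -- At the `n+3` points `0 < c_0 < ⋯ < c_n < R` the function `A_n T_{n+2}` alternates in sign,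
  -- starting with a positive value.
  let p : Fin (n + 3) → ℝ := Fin.cons 0 (Fin.snoc c R : Fin (n + 2) → ℝ)
  have hpc : ∀ i : Fin (n + 1), p i.castSucc.succ = c i := fun i => by
    simp only [p, Fin.cons_succ, Fin.snoc_castSucc (α := fun _ => ℝ)]
  have hp : StrictMono p := by
    refine Fin.strictMono_iff_lt_succ.2 fun i => ?_
    refine Fin.cases ?_ (fun j => ?_) i
    · have := hpc 0
      rw [Fin.castSucc_zero] at this
      rw [this]
      exact (hci 0).1
    · simp only [p, ← Fin.succ_castSucc, Fin.cons_succ]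
      exact hg j.castSucc_lt_succ
  obtain ⟨d, hd, hdj⟩ := exists_zeros_of_alternating hp
    (f := fun x => valA n ζ * valT (n + 2) ζ x)
    ((continuous_valT h.ne_zero h.add_one_ne (n + 2)).const_mul _) (fun j => by
      refine Fin.cases ?_ (fun j => ?_) j
      · simpa [p] using hf0
      · refine Fin.lastCases ?_ (fun i => ?_) j
        · simp only [p, Fin.cons_succ, Fin.snoc_last (α := fun _ => ℝ), Fin.val_succ, Fin.val_last]
          linarith
        · rw [hpc]
          exact hfc i)
  have hA : valA n ζ ≠ 0 := left_ne_zero_of_mul hAB.ne'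
  refine ⟨hA1B1, hA1T, d, hd, fun j => ?_⟩
  obtain ⟨h1, h2, h3⟩ := hdj j
  refine ⟨lt_of_le_of_lt ?_ h1, (mul_eq_zero.1 h3).resolve_left hA, ?_⟩
  · exact hp.monotone (Fin.zero_le j.castSucc)
  -- Exactly `c_0, …, c_{j-1}` lie below `d_j`. The factorization of `T_{n+1}` gives its sign at
  -- `d_j`, to be compared with its sign at `2ζ+1`, which lies below all zeroes.
  · have hs := prod_sub_sign c (d j) j
      (fun i hi => by
        rw [← hpc i]
        refine lt_of_le_of_lt (hp.monotone ?_) h1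
        rw [Fin.le_def, Fin.val_succ, Fin.val_castSucc, Fin.val_castSucc]
        omega)
      (fun i hi => by
        rw [← hpc i]
        refine lt_of_lt_of_le h2 (hp.monotone ?_)
        rw [Fin.le_def, Fin.val_succ, Fin.val_succ, Fin.val_castSucc]
        omega) (by omega)
    have hb := hprod _ h.left_neg.le
    rw [← valT_left, hL, hL]
    have := mul_pos (mul_self_pos.2 hL0) (mul_pos hs hb)
    refine pos_of_mul_pos_left (b := (-1 : ℝ) ^ (n + 1) * (-1) ^ (n + 1)) ?_ (mul_self_nonneg _)
    linarith

theorem alternating (h : Admissible ζ) : ∀ n, Alternating ζ n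
  | 0 => h.alternating_zero
  | n + 1 => h.alternating_succ (h.alternating n)

/-- `T_n` alternates in sign at the `n+1` zeroes of `T_{n+1}`, which gives `n` separating zeroes;
the degree bound shows that there are no others. -/
theorem zeroes (h : Admissible ζ) (n : ℕ) :
    ∃ (c : Fin (n + 1) → ℝ) (b : Fin n → ℝ), StrictMono c ∧ StrictMono b ∧ (∀ i, 0 < b i) ∧
      (∃ L ≠ 0, atZeta (bigP (n + 1)) ζ = C L * ∏ i, (X - C (c i))) ∧
      (∃ L ≠ 0, atZeta (bigP n) ζ = C L * ∏ i, (X - C (b i))) ∧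
      ∀ i : Fin n, c i.castSucc < b i ∧ b i < c i.succ := by
  obtain ⟨hAB, hA0, c, hc, hci⟩ := h.alternating n
  obtain ⟨b, hb, hbi⟩ := exists_zeros_of_alternating hc
    (f := fun x => valA n ζ * valT n ζ x)
    ((continuous_valT h.ne_zero h.add_one_ne n).const_mul _) fun j => (hci j).2.2
  have hfac : ∀ {m : ℕ} {e : Fin m → ℝ}, StrictMono e → (∀ i, valT m ζ (e i) = 0) →
      valT m ζ 0 ≠ 0 → ∃ L ≠ 0, atZeta (bigP m) ζ = C L * ∏ i, (X - C (e i)) := by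
    intro m e he h0 hne
    obtain ⟨k, hk, hT⟩ := h.exists_valT_eq m
    obtain ⟨L, hL⟩ := exists_eq_C_mul_prod (h.natDegree_bigP_le m) he.injective
      fun i => (mul_eq_zero.1 ((hT _).symm.trans (h0 i))).resolve_left hk
    refine ⟨L, ?_, hL⟩
    rintro rfl
    rw [hT, hL, C_0, zero_mul, Polynomial.eval_zero, mul_zero] at hne
    exact hne rfl
  refine ⟨c, b, hc, hb, fun i => (hci i.castSucc).1.trans (hbi i).1,
    hfac hc (fun i => (hci i).2.1) ?_, hfac hb (fun i => ?_) (right_ne_zero_of_mul hA0.ne'),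
    fun i => ⟨(hbi i).1, (hbi i).2.1⟩⟩
  · exact right_ne_zero_of_mul (h.alternating (n + 1)).2.1.ne'
  · exact (mul_eq_zero.1 (hbi i).2.2).resolve_left (left_ne_zero_of_mul hAB.ne')

end Admissible

/-! ### From factorizations to complex zeroes. -/

theorem setOf_eval_C_mul_prod_eq_zero {m : ℕ} {L : ℝ} (hL : L ≠ 0) (c : Fin m → ℝ) :
    {x : ℝ | (C L * ∏ i, (X - C (c i))).eval x = 0} = Set.range c := by
  ext x
  simp [Polynomial.eval_prod, hL, Finset.prod_eq_zero_iff, sub_eq_zero, eq_comm (a := x)]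

/-- A nonzero multiple of a product of distinct linear factors is separable, so all its complex
zeroes are simple. -/
theorem isRoot_map_C_mul_prod {m : ℕ} {L : ℝ} (hL : L ≠ 0) {b : Fin m → ℝ}
    (hb : Function.Injective b) {w : ℂ}
    (hw : ((C L * ∏ i, (X - C (b i))).map Complex.ofRealHom).IsRoot w) :
    ((C L * ∏ i, (X - C (b i))).map Complex.ofRealHom).rootMultiplicity w = 1 ∧
      ∃ i, w = b i := by
  have hL' : (L : ℂ) ≠ 0 := Complex.ofReal_ne_zero.2 hL
  have e : (C L * ∏ i, (X - C (b i))).map Complex.ofRealHom =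
      C (L : ℂ) * ∏ i, (X - C ((b i : ℝ) : ℂ)) := by
    simp [Polynomial.map_prod]
  rw [e] at hw ⊢
  have hs : (C (L : ℂ) * ∏ i, (X - C ((b i : ℝ) : ℂ))).Separable :=
    Polynomial.Separable.unit_mul (Polynomial.isUnit_C.2 (isUnit_iff_ne_zero.2 hL'))
      (Polynomial.separable_prod_X_sub_C_iff.2 (Complex.ofReal_injective.comp hb))
  refine ⟨le_antisymm (Polynomial.rootMultiplicity_le_one_of_separable hs w)
    ((Polynomial.rootMultiplicity_pos hs.ne_zero).2 hw), ?_⟩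
  have hw' : (C (L : ℂ) * ∏ i, (X - C ((b i : ℝ) : ℂ))).eval w = 0 := hw
  simpa [Polynomial.eval_prod, hL, Finset.prod_eq_zero_iff, sub_eq_zero] using hw'

end ThreeColour

theorem proposition3p13
    (hconj : ThreeColour.NonvanishingConjecture ∨ ThreeColour.RealZeroesConjecture)
    (ζ : ℝ) (h₁ : -2 < ζ) (h₂ : ζ < -1 / 2) (h₃ : ζ ≠ -1) (n : ℕ) :
    (∀ w : ℂ, ((ThreeColour.atZeta (ThreeColour.bigP n) ζ).map Complex.ofRealHom).IsRoot w →
      ((ThreeColour.atZeta (ThreeColour.bigP n) ζ).map Complex.ofRealHom).rootMultiplicity w = 1 ∧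
        ∃ x : ℝ, 0 < x ∧ w = (x : ℂ)) ∧
    ThreeColour.ZeroesInterlace n (ThreeColour.atZeta (ThreeColour.bigP (n + 1)) ζ)
      (ThreeColour.atZeta (ThreeColour.bigP n) ζ) := by
  have h : ThreeColour.Admissible ζ := ⟨h₁, h₂, h₃⟩
  obtain ⟨c, b, hc, hb, hb0, ⟨L, hL, hQ⟩, ⟨M, hM, hP⟩, hcb⟩ := h.zeroes n
  refine ⟨fun w hw => ?_, c, b, hc, hb, ?_, ?_, hcb⟩
  · rw [hP] at hw ⊢
    obtain ⟨h1, i, hi⟩ := ThreeColour.isRoot_map_C_mul_prod hM hb.injective hw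
    exact ⟨h1, b i, hb0 i, hi⟩
  · rw [hQ]
    exact ThreeColour.setOf_eval_C_mul_prod_eq_zero hL c
  · rw [hP]
    exact ThreeColour.setOf_eval_C_mul_prod_eq_zero hM b
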